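/- Let $V$ be a finite-dimensional complex vector space with a nondegenerate symmetric bilinear form $h$, and let $\mathfrak g\subset\mathfrak{so}(V,h)$ be a complex Lie subalgebra which is semisimple but not simple, which acts irreducibly on $V$, and which is a weak-Berger algebra, i.e. $\mathfrak g=\operatorname{span}\{Q(x)\mid x\in V,\ Q\in\mathcal B_h(\mathfrak g)\}$, where $$\mathcal B_h(\mathfrak g)=\{Q\in V^*\otimes\mathfrak g\mid h(Q(x)y,z)+h(Q(y)z,x)+h(Q(z)x,y)=0\ \text{ for all } x,y,z\in V\}.$$ Let $\mathfrak g=\mathfrak g_1\oplus\mathfrak g_2$ be a decomposition into ideals and $V\cong V_1\otimes V_2$ the corresponding decomposition of $V$, where $V_i$ is an irreducible $\mathfrak g_i$-module and $(X_1,X_2)\in\mathfrak g$ acts by $v_1\otimes v_2\mapsto X_1v_1\otimes v_2+v_1\otimes X_2v_2$. Assume that $\dim V_1\ge 3$ and $\dim V_2\ge 3$. Then one of the following holds, where equalities of Lie algebras acting on spaces are understood up to linear isomorphisms of the spaces. 1. There are $n,m\ge 3$ such that $\mathfrak g_1\subset\mathfrak{gl}(V_1)$ is $\mathfrak{so}(n,\mathbb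 C)$ acting on $\mathbb C^n$, $\mathfrak g_2\subset\mathfrak{gl}(V_2)$ is $\mathfrak{so}(m,\mathbb C)$ acting on $\mathbb C^m$, and thus $\mathfrak g$ is $\mathfrak{so}(n,\mathbb C)\oplus\mathfrak{so}(m,\mathbb C)$ acting on $\mathbb C^n\otimes\mathbb C^m$. Moreover $\mathfrak g\subset\mathfrak{gl}(V)$ is the complexification of the holonomy representation of the Riemannian symmetric space $SO_0(n,m)/SO(n)\times SO(m)$ of type BDI. 2. There are $n,m\ge 2$ such that $\mathfrak g_1\subset\mathfrak{gl}(V_1)$ is $\mathfrak{sp}(n,\mathbb C)$ acting on $\mathbb C^{2n}$, $\mathfrak g_2\subset\mathfrak{gl}(V_2)$ is $\mathfrak{sp}(m,\mathbb C)$ acting on $\mathbb C^{2m}$, and thus $\mathfrak g$ is $\mathfrak{sp}(n,\mathbb C)\oplus\mathfrak{sp}(m,\mathbb C)$ acting on $\mathbb C^{2n}\otimes\mathbb C^{2m}$. Moreover $\mathfrak g\subset\mathfrak{gl}(V)$ is the complexification of the holonomy representation of the Riemannian symmetric space $Sp(n,m)/Sp(n)\times Sp(m)$ of type CII. Here the holonomy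 representation of a Riemannian manifold is the Lie algebra of its holonomy group (the Levi-Civita parallel transports along piecewise $C^1$ loops at a point) acting on the tangent space at that point. The two symmetric spaces are given by their standard models: the ball of all $n\times m$ matrices $X$ over $F=\mathbb R$, respectively $F=\mathbb H$, with $1-X^*X$ positive definite, with the metric $\langle A,B\rangle_X=\operatorname{Re}\operatorname{tr}\big((1-XX^*)^{-1}A(1-X^*X)^{-1}B^*\big)$, and with base point $X=0$. -/

import Mathlib

open scoped TensorProduct Matrix Quaternion

-- associative rings (endomorphisms, matrices) carry the commutator bracket
attribute [local instance 100] LieRing.ofAssociativeRing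

noncomputable section

/-! ## Weak-Berger algebras -/

section WeakBerger

variable {K V : Type*} [Field K] [AddCommGroup V] [Module K V]

/-- The space `𝓑_h(𝔤)` of all linear maps `Q : V → 𝔤` (that is, `Q ∈ V* ⊗ 𝔤`) which satisfy
`h(Q(x)y, z) + h(Q(y)z, x) + h(Q(z)x, y) = 0`. -/
def weakCurvatureSpace (h : LinearMap.BilinForm K V) (g : LieSubalgebra K (Module.End K V)) :
    Set (V →ₗ[K] g) :=
  {Q | ∀ x y z : V, h ((Q x : Module.End K V) y) z + h ((Q y : Module.End K V) z) x
    + h ((Q z : Module.End K V) x) y = 0}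

/-- `𝔤 ⊆ 𝔰𝔬(V, h)` is weak-Berger if it is spanned by the values of the elements of `𝓑_h(𝔤)`. -/
def IsWeakBerger (h : LinearMap.BilinForm K V) (g : LieSubalgebra K (Module.End K V)) : Prop :=
  g ≤ skewAdjointLieSubalgebra h ∧
    Submodule.span K {A : g | ∃ Q ∈ weakCurvatureSpace h g, ∃ x : V, A = Q x} = ⊤

end WeakBerger

/-! ## The classical Lie algebras as Lie algebras of endomorphisms, and sums acting on tensor
products -/

/-- `𝔰𝔬(n, ℂ)` in its standard representation on `ℂⁿ`. -/
def soStd (n : ℕ) : LieSubalgebra ℂ (Module.End ℂ (Fin n → ℂ)) :=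
  (LieAlgebra.Orthogonal.so (Fin n) ℂ).map
    ((lieEquivMatrix' (R := ℂ) (n := Fin n)).symm :
      Matrix (Fin n) (Fin n) ℂ →ₗ⁅ℂ⁆ Module.End ℂ (Fin n → ℂ))

/-- `𝔰𝔭(n, ℂ)` in its standard representation on `ℂ²ⁿ = ℂⁿ ⊕ ℂⁿ`. -/
def spStd (n : ℕ) : LieSubalgebra ℂ (Module.End ℂ (Fin n ⊕ Fin n → ℂ)) :=
  (LieAlgebra.Symplectic.sp (Fin n) ℂ).map
    ((lieEquivMatrix' (R := ℂ) (n := Fin n ⊕ Fin n)).symm :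
      Matrix (Fin n ⊕ Fin n) (Fin n ⊕ Fin n) ℂ →ₗ⁅ℂ⁆ Module.End ℂ (Fin n ⊕ Fin n → ℂ))

/-- For `𝔞 ⊆ 𝔤𝔩(W₁)` and `𝔟 ⊆ 𝔤𝔩(W₂)`, the Lie algebra of all endomorphisms `A ⊗ 1 + 1 ⊗ B` of
`W₁ ⊗ W₂` with `A ∈ 𝔞` and `B ∈ 𝔟`: the sum `𝔞 ⊕ 𝔟` acting on the tensor product. -/
def tensorSum {W₁ W₂ : Type*} [AddCommGroup W₁] [Module ℂ W₁] [AddCommGroup W₂] [Module ℂ W₂]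
    (a : LieSubalgebra ℂ (Module.End ℂ W₁)) (b : LieSubalgebra ℂ (Module.End ℂ W₂)) :
    LieSubalgebra ℂ (Module.End ℂ (W₁ ⊗[ℂ] W₂)) where
  carrier := {T | ∃ A ∈ a, ∃ B ∈ b, T = LinearMap.rTensor W₂ A + LinearMap.lTensor W₁ B}
  zero_mem' := ⟨0, a.zero_mem, 0, b.zero_mem, by simp⟩
  add_mem' := by
    rintro _ _ ⟨A, hA, B, hB, rfl⟩ ⟨A', hA', B', hB', rfl⟩
    refine ⟨A + A', a.add_mem hA hA', B + B', b.add_mem hB hB', ?_⟩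
    rw [LinearMap.rTensor_add, LinearMap.lTensor_add]
    abel
  smul_mem' := by
    rintro c _ ⟨A, hA, B, hB, rfl⟩
    refine ⟨c • A, a.smul_mem c hA, c • B, b.smul_mem c hB, ?_⟩
    rw [LinearMap.rTensor_smul, LinearMap.lTensor_smul, smul_add]
  lie_mem' := by
    rintro _ _ ⟨A, hA, B, hB, rfl⟩ ⟨A', hA', B', hB', rfl⟩
    refine ⟨⁅A, A'⁆, a.lie_mem hA hA', ⁅B, B'⁆, b.lie_mem hB hB', ?_⟩
    refine TensorProduct.ext' fun x y => ?_
    simp only [Ring.lie_def, Module.End.mul_apply, LinearMap.sub_apply, LinearMap.add_apply,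
      LinearMap.rTensor_tmul, LinearMap.lTensor_tmul, map_add, TensorProduct.sub_tmul,
      TensorProduct.tmul_sub]
    abel

/-! ## Holonomy of a Riemannian metric on an open subset of a real vector space -/

section Holonomy

variable {E : Type*} [NormedAddCommGroup E] [NormedSpace ℝ E]

/-- The Christoffel symbols of the first kind of the metric `g` (where `g x` is the inner product
at the point `x`): `g(Γ(u, v), w) = ½ (∂_u g(v, w) + ∂_v g(u, w) - ∂_w g(u, v))` at `x`. -/
def christoffelFirst (g : E → E → E → ℝ) (x u v w : E) : ℝ :=
  (fderiv ℝ (fun y => g y v w) x u + fderiv ℝ (fun y => g y u w) x v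
    - fderiv ℝ (fun y => g y u v) x w) / 2

/-- The vector field `X` along the curve `γ : [0, 1] → E` is parallel for the Levi-Civita
connection of `g`: its covariant derivative `X' + Γ(γ', X)` vanishes. The equation is written with
the index lowered by the (nondegenerate) metric. -/
def IsParallelAlong (g : E → E → E → ℝ) (γ X : ℝ → E) : Prop :=
  DifferentiableOn ℝ X (Set.Icc 0 1) ∧
    ∀ t ∈ Set.Icc (0 : ℝ) 1, ∀ w : E,
      g (γ t) (derivWithin X (Set.Icc 0 1) t) w
        + christoffelFirst g (γ t) (derivWithin γ (Set.Icc 0 1) t) (X t) w = 0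

/-- `T` is the parallel transport along the `C¹` curve `γ : [0, 1] → E`. -/
def IsTransportAlong (g : E → E → E → ℝ) (γ : ℝ → E) (T : E →L[ℝ] E) : Prop :=
  ∀ v : E, ∃ X : ℝ → E, IsParallelAlong g γ X ∧ X 0 = v ∧ X 1 = T v

/-- `IsParallelTransport U g x y T`: the map `T` from the tangent space at `x` to the tangent space
at `y` is the parallel transport along a piecewise `C¹` curve in `U` from `x` to `y`, that is, along
a finite concatenation of `C¹` curves. -/
inductive IsParallelTransport (U : Set E) (g : E → E → E → ℝ) : E → E → (E →L[ℝ] E) → Prop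
  | const (x : E) (hx : x ∈ U) : IsParallelTransport U g x x (ContinuousLinearMap.id ℝ E)
  | append (x : E) (γ : ℝ → E) (T S : E →L[ℝ] E) (hγ : ContDiffOn ℝ 1 γ (Set.Icc 0 1))
      (hU : ∀ t ∈ Set.Icc (0 : ℝ) 1, γ t ∈ U) (hT : IsParallelTransport U g x (γ 0) T)
      (hS : IsTransportAlong g γ S) : IsParallelTransport U g x (γ 1) (S.comp T)

/-- The holonomy group at `p` of the Riemannian metric `g` on the open set `U`: the parallel
transports along the piecewise `C¹` loops at `p`. -/
def holonomyGroup (U : Set E) (g : E → E → E → ℝ) (p : E) : Set (E →L[ℝ] E) :=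
  {T | IsParallelTransport U g p p T}

/-- The Lie algebra of the holonomy group at `p`: all `A` whose one-parameter group `exp(tA)` lies
in the holonomy group. It acts on `E`, the tangent space at `p`. -/
def holonomyAlgebra (U : Set E) (g : E → E → E → ℝ) (p : E) : Set (E →ₗ[ℝ] E) :=
  {A | ∃ B : E →L[ℝ] E, (B : E →ₗ[ℝ] E) = A ∧
    ∀ t : ℝ, NormedSpace.exp (t • B) ∈ holonomyGroup U g p}

end Holonomy

/-! ## The symmetric spaces of noncompact type BDI and CII, as matrix balls -/

section MatrixBall

variable {F : Type*} [NormedRing F] [StarRing F]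

/-- The open ball of all `p × q` matrices `X` with `1 - X* X` positive definite, that is, with
`|X y| < |y|` for all column vectors `y ≠ 0`. -/
def matrixBall (F : Type*) [NormedRing F] (p q : ℕ) : Set (Matrix (Fin p) (Fin q) F) :=
  {X | ∀ y : Fin q → F, y ≠ 0 → ∑ i, ‖(X *ᵥ y) i‖ ^ 2 < ∑ j, ‖y j‖ ^ 2}

/-- The invariant metric `⟨A, B⟩_X = Re tr ((1 - X X*)⁻¹ A (1 - X* X)⁻¹ B*)` of the matrix ball. -/
def matrixBallMetric (re : F → ℝ) {p q : ℕ} (X A B : Matrix (Fin p) (Fin q) F) : ℝ :=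
  re (Matrix.trace (Ring.inverse (1 - X * Xᴴ) * A * Ring.inverse (1 - Xᴴ * X) * Bᴴ))

end MatrixBall

section SymmetricSpaces

attribute [local instance] Matrix.normedAddCommGroup Matrix.normedSpace

/-- The holonomy algebra, at the base point `0` and acting on the tangent space `ℝᵖˣ𐞥`, of the
Riemannian symmetric space `SO₀(p, q) / SO(p) × SO(q)` of type BDI, in its standard model as the
ball of real `p × q` matrices (on which `SO₀(p, q)` acts by fractional linear transformations). -/
def holonomyBDI (p q : ℕ) : Set (Matrix (Fin p) (Fin q) ℝ →ₗ[ℝ] Matrix (Fin p) (Fin q) ℝ) :=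
  holonomyAlgebra (matrixBall ℝ p q) (matrixBallMetric (fun a : ℝ => a)) 0

/-- The holonomy algebra, at the base point `0` and acting on the tangent space `ℍᵖˣ𐞥`, of the
Riemannian symmetric space `Sp(p, q) / Sp(p) × Sp(q)` of type CII, in its standard model as the
ball of quaternionic `p × q` matrices (on which `Sp(p, q)` acts by fractional linear
transformations). -/
def holonomyCII (p q : ℕ) :
    Set (Matrix (Fin p) (Fin q) ℍ[ℝ] →ₗ[ℝ] Matrix (Fin p) (Fin q) ℍ[ℝ]) :=
  holonomyAlgebra (matrixBall ℍ[ℝ] p q) (matrixBallMetric (fun a : ℍ[ℝ] => a.re)) 0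

end SymmetricSpaces

/-- `𝔤 ⊆ 𝔤𝔩(V)` is (up to a complex-linear isomorphism `ℂ ⊗ E ≅ V`) the complexification of the
real Lie algebra `𝔨` of endomorphisms of the real vector space `E`, with the complexified
representation. -/
def IsComplexificationOf {V E : Type*} [AddCommGroup V] [Module ℂ V] [AddCommGroup E] [Module ℝ E]
    (g : LieSubalgebra ℂ (Module.End ℂ V)) (k : Set (E →ₗ[ℝ] E)) : Prop :=
  ∃ e : (ℂ ⊗[ℝ] E) ≃ₗ[ℂ] V,
    g.toSubmodule =
      (Submodule.span ℂ ((fun A : E →ₗ[ℝ] E => A.baseChange ℂ) '' k)).map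
        (e.conj : Module.End ℂ (ℂ ⊗[ℝ] E) →ₗ[ℂ] Module.End ℂ V)

end

/-!
Write `𝔤 = 𝔤₁ ⊕ 𝔤₂` acting on `V₁ ⊗ V₂`. By Schur's lemma the invariant form `h` is a product
`a ⊗ b` of invariant forms on the factors, and since `h` is symmetric, `a` and `b` are both
symmetric (`ε = 1`) or both alternating (`ε = -1`): `exists_factorization`. Take `Q ∈ 𝓑_h(𝔤)` with
components `Q₁`, `Q₂` in the two ideals, fix `x' ∈ V₂`, and choose `y'`, `z'` orthogonal to `x'`
with `b(y', z') = 1`, which is possible because `dim V₂ ≥ 3`. The cyclic identity then forces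
`Q₁(x ⊗ x')` to be the twisted wedge `a(x, ·) s - ε a(s, ·) x` for one vector `s` that does not
depend on `x`: `exists_eq_twistedWedge`. The vectors `s` all of whose twisted wedges lie in `𝔤₁`
form an invariant subspace of `V₁`, hence are all of `V₁`, and the twisted wedges span all
`a`-skew endomorphisms: `mem_of_twistedWedge_mem`. So `𝔤₁` is the full orthogonal or symplectic
Lie algebra of `a`, and likewise `𝔤₂`. The normal forms `exists_equiv_dotProduct` and
`exists_equiv_J` of `a` and `b` give the coordinates.

For the holonomy of the ball of `p × q` matrices over `F = ℝ, ℍ`, the parallel fields are the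
solutions of `A' + U Q X* A + A Q X* U = 0` along a curve `X` with velocity `U`, where
`Q = (1 - X* X)⁻¹`. For parallel fields `A`, `B` the matrix `M = A Q B* (1 - X X*)⁻¹` satisfies
`M' = [M, U Q X*]`, so the traces of `M` and of products of two such matrices are constant. At the
base point, elements of the holonomy algebra are therefore derivations of the triple product
`A B* C` which are skew for the metric (`isTernaryDerivation_of_mem_holonomyAlgebra`). These
normalize the Lie algebra `skewMulMaps` of all maps `A ↦ a A + A b` with `a`, `b` skew-Hermitian.
The trace form is negative definite on skew operators, so such a derivation is an element of
`skewMulMaps` plus a skew operator which commutes with `skewMulMaps`; by Schur's lemma on the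
irreducible complexification the latter is a scalar of trace zero, that is, zero
(`holonomyAlgebra_subset_skewMulMaps`). Conversely, transport along a radial segment, a
circle about the base point, and back, is computed in closed form (`rotation_mem_holonomyGroup`)
and yields enough one-parameter groups to span `skewMulMaps`
(`skewMulMaps_le_span_holonomyAlgebra`). Finally `𝔰𝔬(n, ℝ)` and the skew-Hermitian quaternionic
matrices are compact forms of `𝔰𝔬(n, ℂ)` and `𝔰𝔭(n, ℂ)`, which identifies the complexification of
`skewMulMaps` with the Lie algebra acting on the tensor product
(`exists_equiv_tensorSum_eq_map_span`).
-/

set_option linter.unusedSectionVars false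
set_option linter.unusedSimpArgs false

/-! ### The matrix ball and the inverse defect -/

/-- The linear functional `re` behaves like the real part of `ℝ` or of `ℍ`: it is a trace, it is
invariant under conjugation, and it recovers the multiplicative norm `a a* = |a|²`. The geometry of
the matrix balls uses only these properties, so both scalar rings are treated together. -/
structure IsRealPart {F : Type*} [NormedRing F] [StarRing F] [NormedAlgebra ℝ F]
    (re : F →ₗ[ℝ] ℝ) : Prop where
  map_mul_comm : ∀ a b, re (a * b) = re (b * a)
  map_star : ∀ a, re (star a) = re a
  mul_star_self : ∀ a : F, a * star a = (‖a‖ ^ 2) • (1 : F)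
  map_star_mul_self : ∀ a, re (star a * a) = ‖a‖ ^ 2

section Ball

attribute [local instance] Matrix.normedAddCommGroup Matrix.normedSpace

open Matrix

variable {F : Type*} [NormedRing F] [StarRing F] [NormedAlgebra ℝ F] [StarModule ℝ F]
  [FiniteDimensional ℝ F]
variable {p q r : ℕ}

namespace IsRealPart

variable {re : F →ₗ[ℝ] ℝ} (hre : IsRealPart re)
include hre

theorem trace_mul_comm (A : Matrix (Fin p) (Fin q) F) (B : Matrix (Fin q) (Fin p) F) :
    re (trace (A * B)) = re (trace (B * A)) := by
  simp only [trace, diag_apply, mul_apply, map_sum]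
  rw [Finset.sum_comm]
  exact Finset.sum_congr rfl fun i _ => Finset.sum_congr rfl fun j _ => hre.map_mul_comm _ _

theorem trace_conjTranspose (A : Matrix (Fin p) (Fin p) F) :
    re (trace Aᴴ) = re (trace A) := by
  simp only [trace, diag_apply, conjTranspose_apply, map_sum, hre.map_star]

theorem trace_conjTranspose_mul_self (A : Matrix (Fin p) (Fin q) F) :
    re (trace (Aᴴ * A)) = ∑ j, ∑ i, ‖A i j‖ ^ 2 := by
  simp only [trace, diag_apply, mul_apply, map_sum, conjTranspose_apply, hre.map_star_mul_self]

theorem dotProduct_star_self (y : Fin p → F) : re (star y ⬝ᵥ y) = ∑ i, ‖y i‖ ^ 2 := by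
  simp only [dotProduct, map_sum, Pi.star_apply, hre.map_star_mul_self]

theorem dotProduct_star_comm (x y : Fin p → F) : re (star x ⬝ᵥ y) = re (star y ⬝ᵥ x) := by
  rw [← hre.map_star]
  congr 1
  simp [dotProduct]

/-- A contraction has a contractive adjoint: expand `0 ≤ |X X* z - z|²`. -/
theorem conjTranspose_mem_matrixBall {X : Matrix (Fin p) (Fin q) F} (hX : X ∈ matrixBall F p q) :
    Xᴴ ∈ matrixBall F q p := by
  intro z hz
  have hpos : 0 < ∑ j, ‖z j‖ ^ 2 := by
    obtain ⟨j, hj⟩ := Function.ne_iff.mp hz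
    exact Finset.sum_pos' (fun i _ => by positivity)
      ⟨j, Finset.mem_univ j, pow_pos (norm_pos_iff.mpr hj) 2⟩
  rcases eq_or_ne (Xᴴ *ᵥ z) 0 with hw | hw
  · rw [hw]
    simpa using hpos
  · have h1 := hX _ hw
    set w := Xᴴ *ᵥ z with hwdef
    have h2 : re (star (X *ᵥ w) ⬝ᵥ z) = ∑ i, ‖w i‖ ^ 2 := by
      rw [star_mulVec, ← dotProduct_mulVec, ← hwdef, hre.dotProduct_star_self]
    have h3 : 0 ≤ re (star (X *ᵥ w - z) ⬝ᵥ (X *ᵥ w - z)) := by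
      rw [hre.dotProduct_star_self]
      positivity
    rw [star_sub, sub_dotProduct, dotProduct_sub, dotProduct_sub, map_sub, map_sub, map_sub,
      hre.dotProduct_star_comm z, hre.dotProduct_star_self, hre.dotProduct_star_self, h2] at h3
    linarith

/-- `1 - X* X` is injective on column vectors, hence left cancellable, and by finite dimension over
`ℝ` invertible; no determinant over the possibly noncommutative `F` is needed. -/
theorem isUnit_one_sub {X : Matrix (Fin p) (Fin q) F} (hX : X ∈ matrixBall F p q) :
    IsUnit (1 - Xᴴ * X) := by
  set M := 1 - Xᴴ * X with hM
  have hvec : ∀ y : Fin q → F, M *ᵥ y = 0 → y = 0 := by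
    intro y hy
    by_contra hne
    have h1 := hX y hne
    rw [hM, sub_mulVec, one_mulVec, sub_eq_zero, ← mulVec_mulVec] at hy
    have h2 : star y ⬝ᵥ y = star (X *ᵥ y) ⬝ᵥ (X *ᵥ y) := by
      rw [star_mulVec, ← dotProduct_mulVec, ← hy]
    rw [← hre.dotProduct_star_self, ← hre.dotProduct_star_self, h2] at h1
    exact lt_irrefl _ h1
  have hinj : ∀ Z : Matrix (Fin q) (Fin q) F, M * Z = 0 → Z = 0 := by
    intro Z hZ
    ext i j
    have := hvec (fun i => Z i j) (by
      ext i
      exact congrFun (congrFun hZ i) j)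
    exact congrFun this i
  have hsurj : Function.Surjective (LinearMap.mulLeft ℝ M) := by
    apply LinearMap.surjective_of_injective
    rw [injective_iff_map_eq_zero]
    exact hinj
  obtain ⟨Z, hZ⟩ := hsurj 1
  have hZ1 : M * Z = 1 := hZ
  refine ⟨⟨M, Z, hZ1, ?_⟩, rfl⟩
  have := hinj (Z * M - 1) (by rw [mul_sub, ← mul_assoc, hZ1]; simp)
  exact sub_eq_zero.mp this

end IsRealPart

/-- The inverse `Q = (1 - X* X)⁻¹` of the defect of `X`. It is written with `Ring.inverse`, so it is
the true inverse only for `X` in the matrix ball. The other factor of the metric,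
`P = (1 - X X*)⁻¹`, is `defectInv Xᴴ`. -/
noncomputable def defectInv (X : Matrix (Fin p) (Fin q) F) : Matrix (Fin q) (Fin q) F :=
  Ring.inverse (1 - Xᴴ * X)

section
variable {re : F →ₗ[ℝ] ℝ} (hre : IsRealPart re) {X : Matrix (Fin p) (Fin q) F}
  (hX : X ∈ matrixBall F p q)
include hre hX

theorem defectInv_mul_cancel : defectInv X * (1 - Xᴴ * X) = 1 :=
  Ring.inverse_mul_cancel _ (hre.isUnit_one_sub hX)

theorem mul_defectInv_cancel : (1 - Xᴴ * X) * defectInv X = 1 :=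
  Ring.mul_inverse_cancel _ (hre.isUnit_one_sub hX)

/-- The intertwining relation `P X = X Q`. -/
theorem defectInv_conjTranspose_mul : defectInv Xᴴ * X = X * defectInv X := by
  have h1 := mul_defectInv_cancel hre hX
  have h2 := defectInv_mul_cancel hre (hre.conjTranspose_mem_matrixBall hX)
  rw [conjTranspose_conjTranspose] at h2
  calc defectInv Xᴴ * X = defectInv Xᴴ * (X * ((1 - Xᴴ * X) * defectInv X)) := by
        rw [h1, Matrix.mul_one]
    _ = defectInv Xᴴ * (1 - X * Xᴴ) * (X * defectInv X) := by
        simp only [Matrix.mul_sub, Matrix.sub_mul, Matrix.mul_one, Matrix.one_mul, Matrix.mul_assoc]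
    _ = X * defectInv X := by rw [h2, Matrix.one_mul]

theorem conjTranspose_mul_defectInv : Xᴴ * defectInv Xᴴ = defectInv X * Xᴴ := by
  have := defectInv_conjTranspose_mul hre (hre.conjTranspose_mem_matrixBall hX)
  rw [conjTranspose_conjTranspose] at this
  exact this.symm

theorem conjTranspose_defectInv : (defectInv X)ᴴ = defectInv X := by
  have h1 := congrArg conjTranspose (mul_defectInv_cancel hre hX)
  rw [conjTranspose_mul] at h1
  simp only [conjTranspose_sub, conjTranspose_one, conjTranspose_mul,
    conjTranspose_conjTranspose] at h1
  calc (defectInv X)ᴴ = (defectInv X)ᴴ * ((1 - Xᴴ * X) * defectInv X) := by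
        rw [mul_defectInv_cancel hre hX, Matrix.mul_one]
    _ = defectInv X := by rw [← Matrix.mul_assoc, h1, Matrix.one_mul]

end

section Deriv

/-- Matrix multiplication as a continuous real-bilinear map. -/
noncomputable def matrixMulCLM (F : Type*) [NormedRing F] [NormedAlgebra ℝ F]
    [FiniteDimensional ℝ F] (p q r : ℕ) :
    Matrix (Fin p) (Fin q) F →L[ℝ] Matrix (Fin q) (Fin r) F →L[ℝ] Matrix (Fin p) (Fin r) F :=
  LinearMap.toContinuousBilinearMap (LinearMap.mk₂ ℝ (fun A B => A * B) Matrix.add_mul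
    (fun c A B => Matrix.smul_mul c A B) Matrix.mul_add (fun c A B => Matrix.mul_smul A c B))

theorem HasDerivWithinAt.matrix_mul {A : ℝ → Matrix (Fin p) (Fin q) F}
    {B : ℝ → Matrix (Fin q) (Fin r) F} {A' B'} {s : Set ℝ} {t : ℝ} (hA : HasDerivWithinAt A A' s t)
    (hB : HasDerivWithinAt B B' s t) :
    HasDerivWithinAt (fun t => A t * B t) (A' * B t + A t * B') s t := by
  have := (matrixMulCLM F p q r).hasFDerivWithinAt_of_bilinear hA.hasFDerivWithinAt
    hB.hasFDerivWithinAt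
  have h2 := this.hasDerivWithinAt
  refine h2.congr_deriv ?_
  have e1 : (ContinuousLinearMap.toSpanSingleton ℝ A') 1 = A' := by simp
  have e2 : (ContinuousLinearMap.toSpanSingleton ℝ B') 1 = B' := by simp
  change A t * (ContinuousLinearMap.toSpanSingleton ℝ B') 1
    + (ContinuousLinearMap.toSpanSingleton ℝ A') 1 * B t = _
  rw [e1, e2, add_comm]

/-- Conjugate transposition as a continuous real-linear map. -/
noncomputable def conjTransposeCLM (F : Type*) [NormedRing F] [StarRing F] [NormedAlgebra ℝ F]
    [StarModule ℝ F] [FiniteDimensional ℝ F] (p q : ℕ) :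
    Matrix (Fin p) (Fin q) F →L[ℝ] Matrix (Fin q) (Fin p) F :=
  LinearMap.toContinuousLinearMap
    { toFun := fun A => Aᴴ
      map_add' := conjTranspose_add
      map_smul' := fun c A => by simp [conjTranspose_smul] }

theorem HasDerivWithinAt.conjTranspose {A : ℝ → Matrix (Fin p) (Fin q) F} {A'} {s : Set ℝ} {t : ℝ}
    (hA : HasDerivWithinAt A A' s t) : HasDerivWithinAt (fun t => (A t)ᴴ) A'ᴴ s t :=
  (conjTransposeCLM F p q).hasFDerivAt.comp_hasDerivWithinAt t hA

end Deriv
end Ball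

section inv
open Matrix
variable {F : Type*} [NormedRing F] [NormedAlgebra ℝ F] [FiniteDimensional ℝ F] {p : ℕ}

attribute [local instance] Matrix.linftyOpNormedRing Matrix.linftyOpNormedAlgebra in
theorem hasFDerivAt_matrix_inverse_linfty (u : (Matrix (Fin p) (Fin p) F)ˣ) :
    HasFDerivAt (Ring.inverse : Matrix (Fin p) (Fin p) F → _)
      (-ContinuousLinearMap.mulLeftRight ℝ (Matrix (Fin p) (Fin p) F) ↑u⁻¹ ↑u⁻¹)
      (u : Matrix (Fin p) (Fin p) F) := by
  have : CompleteSpace (Matrix (Fin p) (Fin p) F) := FiniteDimensional.complete ℝ _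
  exact hasFDerivAt_ringInverse (𝕜 := ℝ) u

attribute [local instance] Matrix.normedAddCommGroup Matrix.normedSpace in
/-- Matrix inversion is differentiable for the entrywise sup norm. That norm is not submultiplicative,
so the derivative is computed in the operator norm, whose topology is definitionally the same. -/
theorem hasFDerivAt_matrix_inverse (u : (Matrix (Fin p) (Fin p) F)ˣ) :
    ∃ L : Matrix (Fin p) (Fin p) F →L[ℝ] Matrix (Fin p) (Fin p) F,
      HasFDerivAt (Ring.inverse : Matrix (Fin p) (Fin p) F → _) L
        (u : Matrix (Fin p) (Fin p) F) ∧
      ∀ H, L H = -((↑u⁻¹ : Matrix (Fin p) (Fin p) F) * H * (↑u⁻¹ : Matrix (Fin p) (Fin p) F)) :=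
  ⟨_, hasFDerivAt_matrix_inverse_linfty u, fun H => rfl⟩
end inv

/-! ### The Levi-Civita connection of the matrix ball -/

section Connection

attribute [local instance] Matrix.normedAddCommGroup Matrix.normedSpace

open Matrix

variable {F : Type*} [NormedRing F] [StarRing F] [NormedAlgebra ℝ F] [StarModule ℝ F]
  [FiniteDimensional ℝ F]
variable {p q r : ℕ} {re : F →ₗ[ℝ] ℝ} (hre : IsRealPart re)

include hre in
theorem hasDerivWithinAt_defectInv {γ : ℝ → Matrix (Fin p) (Fin q) F}
    {U : Matrix (Fin p) (Fin q) F} {s : Set ℝ} {t : ℝ} (hγ : HasDerivWithinAt γ U s t)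
    (hX : γ t ∈ matrixBall F p q) :
    HasDerivWithinAt (fun t => defectInv (γ t))
      (defectInv (γ t) * (Uᴴ * γ t + (γ t)ᴴ * U) * defectInv (γ t)) s t := by
  obtain ⟨u, hu⟩ := hre.isUnit_one_sub hX
  obtain ⟨L, hL, hL'⟩ := hasFDerivAt_matrix_inverse u
  have h1 : HasDerivWithinAt (fun t => 1 - (γ t)ᴴ * γ t) (-(Uᴴ * γ t + (γ t)ᴴ * U)) s t :=
    (hγ.conjTranspose.matrix_mul hγ).const_sub 1
  rw [hu] at hL
  refine (hL.comp_hasDerivWithinAt t h1).congr_deriv ?_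
  refine (hL' _).trans ?_
  rw [Matrix.mul_neg, Matrix.neg_mul, neg_neg, ← Ring.inverse_unit u, hu]
  rfl

include hre in
theorem differentiableAt_defectInv {X : Matrix (Fin p) (Fin q) F} (hX : X ∈ matrixBall F p q) :
    DifferentiableAt ℝ (fun X : Matrix (Fin p) (Fin q) F => defectInv X) X := by
  obtain ⟨u, hu⟩ := hre.isUnit_one_sub hX
  obtain ⟨L, hL, hL'⟩ := hasFDerivAt_matrix_inverse u
  have h1 : HasFDerivAt (fun Y : Matrix (Fin p) (Fin q) F => 1 - Yᴴ * Y) _ X :=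
    ((matrixMulCLM F q p q).hasFDerivAt_of_bilinear (conjTransposeCLM F p q).hasFDerivAt
      (hasFDerivAt_id X)).const_sub 1
  rw [hu] at hL
  exact (hL.comp X h1).differentiableAt

theorem DifferentiableAt.matrix_mul {E : Type*} [NormedAddCommGroup E] [NormedSpace ℝ E]
    {A : E → Matrix (Fin p) (Fin q) F}
    {B : E → Matrix (Fin q) (Fin r) F} {x : E} (hA : DifferentiableAt ℝ A x)
    (hB : DifferentiableAt ℝ B x) :
    DifferentiableAt ℝ (fun t => A t * B t) x :=
  ((matrixMulCLM F p q r).hasFDerivAt_of_bilinear hA.hasFDerivAt hB.hasFDerivAt).differentiableAt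

/-- The real part of the trace. -/
noncomputable def reTrace (re : F →ₗ[ℝ] ℝ) (p : ℕ) (A : Matrix (Fin p) (Fin p) F) : ℝ :=
  re (trace A)

theorem reTrace_apply (A : Matrix (Fin p) (Fin p) F) : reTrace re p A = re (trace A) := rfl

@[simp]
theorem reTrace_add (A B : Matrix (Fin p) (Fin p) F) :
    reTrace re p (A + B) = reTrace re p A + reTrace re p B := by simp [reTrace]

@[simp]
theorem reTrace_neg (A : Matrix (Fin p) (Fin p) F) :
    reTrace re p (-A) = -reTrace re p A := by simp [reTrace]

@[simp]
theorem reTrace_sub (A B : Matrix (Fin p) (Fin p) F) :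
    reTrace re p (A - B) = reTrace re p A - reTrace re p B := by simp [reTrace]

variable (re) in
theorem HasDerivWithinAt.reTrace {A : ℝ → Matrix (Fin p) (Fin p) F} {A'} {s : Set ℝ} {t : ℝ}
    (hA : HasDerivWithinAt A A' s t) :
    HasDerivWithinAt (fun t => reTrace re p (A t)) (reTrace re p A') s t :=
  (LinearMap.toContinuousLinearMap
    (re ∘ₗ Matrix.traceLinearMap (Fin p) ℝ F)).hasFDerivAt.comp_hasDerivWithinAt t hA

variable (re) in
theorem DifferentiableAt.reTrace {E : Type*} [NormedAddCommGroup E] [NormedSpace ℝ E]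
    {A : E → Matrix (Fin p) (Fin p) F} {x : E} (hA : DifferentiableAt ℝ A x) :
    DifferentiableAt ℝ (fun t => reTrace re p (A t)) x :=
  (LinearMap.toContinuousLinearMap
    (re ∘ₗ Matrix.traceLinearMap (Fin p) ℝ F)).differentiableAt.comp x hA

include hre in
theorem reTrace_mul_comm (A : Matrix (Fin p) (Fin q) F) (B : Matrix (Fin q) (Fin p) F) :
    reTrace re p (A * B) = reTrace re q (B * A) := hre.trace_mul_comm A B

include hre in
theorem reTrace_conjTranspose (A : Matrix (Fin p) (Fin p) F) :
    reTrace re p Aᴴ = reTrace re p A := hre.trace_conjTranspose A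

theorem matrixBallMetric_eq (X A B : Matrix (Fin p) (Fin q) F) :
    matrixBallMetric re X A B = reTrace re p (defectInv Xᴴ * A * defectInv X * Bᴴ) := by
  rw [defectInv, conjTranspose_conjTranspose]
  rfl

include hre in
theorem fderiv_matrixBallMetric {X : Matrix (Fin p) (Fin q) F} (hX : X ∈ matrixBall F p q)
    (U A B : Matrix (Fin p) (Fin q) F) :
    fderiv ℝ (fun Y => matrixBallMetric re Y A B) X U =
      reTrace re p (defectInv Xᴴ * (U * Xᴴ + X * Uᴴ) * defectInv Xᴴ * A * defectInv X * Bᴴ) +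
      reTrace re p (defectInv Xᴴ * A * (defectInv X * (Uᴴ * X + Xᴴ * U) * defectInv X) * Bᴴ) := by
  simp only [matrixBallMetric_eq]
  have hX' := hre.conjTranspose_mem_matrixBall hX
  have hd : DifferentiableAt ℝ (fun Y : Matrix (Fin p) (Fin q) F =>
      reTrace re p (defectInv Yᴴ * A * defectInv Y * Bᴴ)) X := by
    have h1 : DifferentiableAt ℝ (fun Y : Matrix (Fin p) (Fin q) F => defectInv Yᴴ) X :=
      (differentiableAt_defectInv hre hX').comp X (conjTransposeCLM F p q).differentiableAt
    exact (((h1.matrix_mul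
      (differentiableAt_const A)).matrix_mul (differentiableAt_defectInv hre hX)).matrix_mul
      (differentiableAt_const Bᴴ)).reTrace re
  have hline : HasDerivAt (fun t : ℝ => X + t • U) U 0 := by
    exact (((hasDerivAt_id (0 : ℝ)).smul_const U).const_add X).congr_deriv (one_smul _ _)
  have h0 : (fun t : ℝ => X + t • U) 0 = X := by simp
  have h1 : HasDerivAt (fun t : ℝ => reTrace re p (defectInv (X + t • U)ᴴ * A *
      defectInv (X + t • U) * Bᴴ)) (fderiv ℝ (fun Y : Matrix (Fin p) (Fin q) F =>
      reTrace re p (defectInv Yᴴ * A * defectInv Y * Bᴴ)) X U) 0 := by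
    have hd' := hd.hasFDerivAt
    rw [← h0] at hd'
    have := hd'.comp_hasDerivAt 0 hline
    rw [h0] at this
    exact this
  have hlw := hline.hasDerivWithinAt (s := Set.univ)
  have hP := hasDerivWithinAt_defectInv hre hlw.conjTranspose (by simpa using hX')
  have hQ := hasDerivWithinAt_defectInv hre hlw (by simpa using hX)
  have h2 := ((hP.matrix_mul (hasDerivWithinAt_const _ _ A)).matrix_mul hQ).matrix_mul
    (hasDerivWithinAt_const _ _ Bᴴ)
  have h3 := h2.reTrace re
  rw [hasDerivWithinAt_univ] at h3
  have h4 := h1.unique h3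
  rw [h4]
  simp only [zero_smul, add_zero, conjTranspose_conjTranspose, Matrix.mul_zero, Matrix.add_mul,
    reTrace_add]

/-- The Christoffel symbol of the second kind of the matrix ball,
`Γ_X(U, A) = U Q X* A + A Q X* U` with `Q = (1 - X* X)⁻¹`. -/
noncomputable def christoffel (X U A : Matrix (Fin p) (Fin q) F) : Matrix (Fin p) (Fin q) F :=
  U * defectInv X * Xᴴ * A + A * defectInv X * Xᴴ * U

include hre in
/-- The Koszul formula: `christoffel` is the Christoffel symbol of the ball metric with its index
raised. -/
theorem christoffelFirst_matrixBallMetric {X : Matrix (Fin p) (Fin q) F}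
    (hX : X ∈ matrixBall F p q) (U A B : Matrix (Fin p) (Fin q) F) :
    christoffelFirst (matrixBallMetric re) X U A B =
      matrixBallMetric re X (christoffel X U A) B := by
  have e1 := defectInv_conjTranspose_mul hre hX
  have e2 := conjTranspose_mul_defectInv hre hX
  have e3 := conjTranspose_defectInv hre hX
  have e4 := conjTranspose_defectInv hre (hre.conjTranspose_mem_matrixBall hX)
  refine (congrArg (· / 2) (congrArg₂ (· - ·) (congrArg₂ (· + ·)
    (fderiv_matrixBallMetric hre hX U A B) (fderiv_matrixBallMetric hre hX A U B))
    (fderiv_matrixBallMetric hre hX B U A))).trans ?_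
  rw [matrixBallMetric_eq, christoffel]
  set P := defectInv Xᴴ
  set Q := defectInv X
  have e1' : ∀ {r : ℕ} (Z : Matrix (Fin q) (Fin r) F), P * (X * Z) = X * (Q * Z) := fun Z => by
    rw [← Matrix.mul_assoc, e1, Matrix.mul_assoc]
  have e2' : ∀ {r : ℕ} (Z : Matrix (Fin p) (Fin r) F), Xᴴ * (P * Z) = Q * (Xᴴ * Z) := fun Z => by
    rw [← Matrix.mul_assoc, e2, Matrix.mul_assoc]
  -- The three derivatives of the metric give four traces each. `c1` to `c4` turn the four traces of
  -- the derivative along `B` into traces from the other two derivatives, where they cancel; the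
  -- remaining four traces agree in pairs.
  have c1 : reTrace re p (P * B * Xᴴ * P * U * Q * Aᴴ) =
      reTrace re p (P * A * Q * Uᴴ * X * Q * Bᴴ) := by
    rw [← reTrace_conjTranspose hre]
    simp only [conjTranspose_mul, conjTranspose_conjTranspose, e3, e4, ← Matrix.mul_assoc]
    rw [reTrace_mul_comm hre]
    simp only [Matrix.mul_assoc, e1']
  have c2 : reTrace re p (P * X * Bᴴ * P * U * Q * Aᴴ) =
      reTrace re p (P * U * Q * Aᴴ * X * Q * Bᴴ) := by
    rw [Matrix.mul_assoc (P * X * Bᴴ * P) U Q, Matrix.mul_assoc (P * X * Bᴴ * P),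
      Matrix.mul_assoc (P * X * Bᴴ) P, reTrace_mul_comm hre]
    simp only [Matrix.mul_assoc, e1']
  have c3 : reTrace re p (P * U * Q * Bᴴ * X * Q * Aᴴ) =
      reTrace re p (P * X * Aᴴ * P * U * Q * Bᴴ) := by
    rw [Matrix.mul_assoc (P * U * Q * Bᴴ), Matrix.mul_assoc (P * U * Q * Bᴴ),
      reTrace_mul_comm hre]
    simp only [Matrix.mul_assoc, e1']
  have c4 : reTrace re p (P * U * Q * Xᴴ * B * Q * Aᴴ) =
      reTrace re p (P * X * Uᴴ * P * A * Q * Bᴴ) := by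
    rw [← reTrace_conjTranspose hre]
    simp only [conjTranspose_mul, conjTranspose_conjTranspose, e3, e4, ← Matrix.mul_assoc]
    rw [Matrix.mul_assoc (A * Q * Bᴴ), Matrix.mul_assoc (A * Q * Bᴴ),
      Matrix.mul_assoc (A * Q * Bᴴ), reTrace_mul_comm hre]
    simp only [Matrix.mul_assoc, e1']
  simp only [Matrix.mul_assoc] at c1 c2 c3 c4
  simp only [Matrix.mul_add, Matrix.add_mul, reTrace_add, Matrix.mul_assoc, c1, c2, c3, c4]
  simp only [e1', e2']
  ring

include hre in
theorem eq_zero_of_matrixBallMetric {X : Matrix (Fin p) (Fin q) F}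
    (hX : X ∈ matrixBall F p q) {W : Matrix (Fin p) (Fin q) F}
    (hW : ∀ B, matrixBallMetric re X W B = 0) : W = 0 := by
  have h1 := mul_defectInv_cancel hre hX
  have h2 := mul_defectInv_cancel hre (hre.conjTranspose_mem_matrixBall hX)
  -- testing against `P W Q` gives the squared norm of `P W Q`
  have h3 := hW (defectInv Xᴴ * W * defectInv X)
  rw [matrixBallMetric_eq, reTrace_mul_comm hre, reTrace_apply,
    hre.trace_conjTranspose_mul_self] at h3
  have h4 : defectInv Xᴴ * W * defectInv X = 0 := by
    ext i j
    rw [Finset.sum_eq_zero_iff_of_nonneg (fun j _ => by positivity)] at h3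
    have h5 := h3 j (Finset.mem_univ j)
    rw [Finset.sum_eq_zero_iff_of_nonneg (fun j _ => by positivity)] at h5
    simpa using h5 i (Finset.mem_univ i)
  have h5 : W * defectInv X = 0 := by
    calc W * defectInv X = (1 - Xᴴᴴ * Xᴴ) * defectInv Xᴴ * (W * defectInv X) := by
          rw [h2, Matrix.one_mul]
      _ = (1 - Xᴴᴴ * Xᴴ) * (defectInv Xᴴ * W * defectInv X) := by simp only [Matrix.mul_assoc]
      _ = 0 := by rw [h4, Matrix.mul_zero]
  have h6 := defectInv_mul_cancel hre hX
  calc W = W * (defectInv X * (1 - Xᴴ * X)) := by rw [h6, Matrix.mul_one]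
    _ = 0 := by rw [← Matrix.mul_assoc, h5, Matrix.zero_mul]

include hre in
/-- The parallel transport equation with its index raised, `A' = -Γ(γ', A)`. -/
theorem isParallelAlong_matrixBallMetric_iff {γ γ' A : ℝ → Matrix (Fin p) (Fin q) F}
    (hγ : ∀ t ∈ Set.Icc (0 : ℝ) 1, γ t ∈ matrixBall F p q)
    (hγ' : ∀ t ∈ Set.Icc (0 : ℝ) 1, HasDerivWithinAt γ (γ' t) (Set.Icc 0 1) t) :
    IsParallelAlong (matrixBallMetric re) γ A ↔
      ∀ t ∈ Set.Icc (0 : ℝ) 1, HasDerivWithinAt A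
        (-christoffel (γ t) (γ' t) (A t)) (Set.Icc 0 1) t := by
  have huniq := uniqueDiffOn_Icc (zero_lt_one (α := ℝ))
  constructor
  · rintro ⟨h1, h2⟩ t ht
    have h3 := (h1 t ht).hasDerivWithinAt
    suffices derivWithin A (Set.Icc 0 1) t + christoffel (γ t) (γ' t) (A t) = 0 by
      exact h3.congr_deriv (eq_neg_of_add_eq_zero_left this)
    refine eq_zero_of_matrixBallMetric hre (hγ t ht) fun B => ?_
    have h4 := h2 t ht B
    rw [christoffelFirst_matrixBallMetric hre (hγ t ht), (hγ' t ht).derivWithin (huniq t ht)] at h4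
    refine Eq.trans ?_ h4
    simp only [matrixBallMetric_eq, Matrix.mul_add, Matrix.add_mul, reTrace_add]
    rfl
  · intro h
    refine ⟨fun t ht => (h t ht).differentiableWithinAt, fun t ht B => ?_⟩
    rw [christoffelFirst_matrixBallMetric hre (hγ t ht), (h t ht).derivWithin (huniq t ht),
      (hγ' t ht).derivWithin (huniq t ht)]
    simp only [matrixBallMetric_eq, Matrix.mul_neg, Matrix.neg_mul, reTrace_neg]
    exact neg_add_cancel _

end Connection

/-! ### Invariants of parallel transport -/

section Invariants

attribute [local instance] Matrix.normedAddCommGroup Matrix.normedSpace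

open Matrix

variable {F : Type*} [NormedRing F] [StarRing F] [NormedAlgebra ℝ F] [StarModule ℝ F]
  [FiniteDimensional ℝ F]
variable {p q r : ℕ} {re : F →ₗ[ℝ] ℝ} (hre : IsRealPart re)

/-- The matrix `A Q B* P` with `Q = (1 - X* X)⁻¹` and `P = (1 - X X*)⁻¹`. The real part of its trace
is the metric at `X`, and at the base point it is `A B*`. -/
noncomputable def ballPairing (X A B : Matrix (Fin p) (Fin q) F) : Matrix (Fin p) (Fin p) F :=
  A * defectInv X * Bᴴ * defectInv Xᴴ

theorem ballPairing_zero (A B : Matrix (Fin p) (Fin q) F) : ballPairing 0 A B = A * Bᴴ := by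
  simp [ballPairing, defectInv]

include hre in
/-- Along a curve, the pairing `M` of two parallel fields satisfies the Lax equation
`M' = M K - K M` with `K = U Q X*`, so that the traces of words in such pairings are constant. -/
theorem hasDerivWithinAt_ballPairing {γ A B : ℝ → Matrix (Fin p) (Fin q) F}
    {U : Matrix (Fin p) (Fin q) F} {s : Set ℝ} {t : ℝ} (hX : γ t ∈ matrixBall F p q)
    (hγ : HasDerivWithinAt γ U s t)
    (hA : HasDerivWithinAt A (-christoffel (γ t) U (A t)) s t)
    (hB : HasDerivWithinAt B (-christoffel (γ t) U (B t)) s t) :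
    HasDerivWithinAt (fun t => ballPairing (γ t) (A t) (B t))
      (ballPairing (γ t) (A t) (B t) * (U * defectInv (γ t) * (γ t)ᴴ) -
        U * defectInv (γ t) * (γ t)ᴴ * ballPairing (γ t) (A t) (B t)) s t := by
  have hX' := hre.conjTranspose_mem_matrixBall hX
  have hQ := hasDerivWithinAt_defectInv hre hγ hX
  have hP := hasDerivWithinAt_defectInv hre hγ.conjTranspose hX'
  refine (((hA.matrix_mul hQ).matrix_mul hB.conjTranspose).matrix_mul hP).congr_deriv ?_
  have e1 := defectInv_conjTranspose_mul hre hX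
  have e2 := conjTranspose_mul_defectInv hre hX
  have e3 := conjTranspose_defectInv hre hX
  simp only [ballPairing, christoffel]
  generalize γ t = X at *
  set P := defectInv Xᴴ
  set Q := defectInv X
  have e1' : ∀ {r : ℕ} (Z : Matrix (Fin q) (Fin r) F), P * (X * Z) = X * (Q * Z) := fun Z => by
    rw [← Matrix.mul_assoc, e1, Matrix.mul_assoc]
  simp only [conjTranspose_mul, conjTranspose_add, conjTranspose_neg, conjTranspose_conjTranspose,
    e3, Matrix.mul_add, Matrix.add_mul, Matrix.neg_mul, Matrix.mul_neg, Matrix.mul_assoc, e1', e2]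
  abel

/-- The map `T` from the tangent space at `X` to the tangent space at `Y` preserves the traces of the
pairings (that is, the metric) and of products of two pairings. At the base point the latter
determine the triple product `A B* C`. -/
structure PreservesPairing (re : F →ₗ[ℝ] ℝ) (X Y : Matrix (Fin p) (Fin q) F)
    (T : Matrix (Fin p) (Fin q) F → Matrix (Fin p) (Fin q) F) : Prop where
  metric : ∀ A B, reTrace re p (ballPairing Y (T A) (T B)) = reTrace re p (ballPairing X A B)
  quartic : ∀ A B C D,
    reTrace re p (ballPairing Y (T A) (T B) * ballPairing Y (T C) (T D)) =
      reTrace re p (ballPairing X A B * ballPairing X C D)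

theorem eq_of_hasDerivWithinAt_zero {f : ℝ → ℝ}
    (hf : ∀ t ∈ Set.Icc (0 : ℝ) 1, HasDerivWithinAt f 0 (Set.Icc 0 1) t) : f 1 = f 0 :=
  constant_of_derivWithin_zero (fun t ht => (hf t ht).differentiableWithinAt)
    (fun t ht => (hf t (Set.Ico_subset_Icc_self ht)).derivWithin
      (uniqueDiffOn_Icc zero_lt_one t (Set.Ico_subset_Icc_self ht))) 1 (by simp)

include hre in
theorem IsTransportAlong.preservesPairing {γ : ℝ → Matrix (Fin p) (Fin q) F}
    (hγ : ContDiffOn ℝ 1 γ (Set.Icc 0 1))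
    (hU : ∀ t ∈ Set.Icc (0 : ℝ) 1, γ t ∈ matrixBall F p q)
    {S : Matrix (Fin p) (Fin q) F →L[ℝ] Matrix (Fin p) (Fin q) F}
    (hS : IsTransportAlong (matrixBallMetric re) γ S) :
    PreservesPairing re (γ 0) (γ 1) S := by
  choose X hX h0 h1 using hS
  have hγ' : ∀ t ∈ Set.Icc (0 : ℝ) 1,
      HasDerivWithinAt γ (derivWithin γ (Set.Icc 0 1) t) (Set.Icc 0 1) t := fun t ht =>
    ((hγ.differentiableOn one_ne_zero) t ht).hasDerivWithinAt
  have hpar := fun v => (isParallelAlong_matrixBallMetric_iff hre hU hγ').mp (hX v)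
  have hM := fun A B t ht => hasDerivWithinAt_ballPairing hre (hU t ht) (hγ' t ht)
    (hpar A t ht) (hpar B t ht)
  constructor
  · intro A B
    have := eq_of_hasDerivWithinAt_zero
      (f := fun t => reTrace re p (ballPairing (γ t) (X A t) (X B t))) (fun t ht => by
        refine ((hM A B t ht).reTrace re).congr_deriv ?_
        rw [reTrace_sub, reTrace_mul_comm hre, sub_self])
    rw [h0, h0, h1, h1] at this
    exact this
  · intro A B C D
    have := eq_of_hasDerivWithinAt_zero
      (f := fun t => reTrace re p (ballPairing (γ t) (X A t) (X B t) *
        ballPairing (γ t) (X C t) (X D t))) (fun t ht => by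
        refine (((hM A B t ht).matrix_mul (hM C D t ht)).reTrace re).congr_deriv ?_
        generalize derivWithin γ (Set.Icc 0 1) t * defectInv (γ t) * (γ t)ᴴ = K
        rw [Matrix.sub_mul, Matrix.mul_sub, reTrace_add, reTrace_sub, reTrace_sub,
          Matrix.mul_assoc K, reTrace_mul_comm hre K, Matrix.mul_assoc, Matrix.mul_assoc]
        ring)
    rw [h0, h0, h0, h0, h1, h1, h1, h1] at this
    exact this

include hre in
theorem IsParallelTransport.preservesPairing {X Y : Matrix (Fin p) (Fin q) F}
    {T : Matrix (Fin p) (Fin q) F →L[ℝ] Matrix (Fin p) (Fin q) F}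
    (hT : IsParallelTransport (matrixBall F p q) (matrixBallMetric re) X Y T) :
    PreservesPairing re X Y T := by
  induction hT with
  | const hx => exact ⟨fun _ _ => rfl, fun _ _ _ _ => rfl⟩
  | append γ T S hγ hU hT hS ih =>
    have h := IsTransportAlong.preservesPairing hre hγ hU hS
    exact ⟨fun A B => (h.metric _ _).trans (ih.metric A B),
      fun A B C D => (h.quartic _ _ _ _).trans (ih.quartic A B C D)⟩

/-- A derivation of the triple product `A B* C` on matrices which is skew for the inner product
`Re tr (A B*)`. -/
structure IsTernaryDerivation (re : F →ₗ[ℝ] ℝ)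
    (D : Matrix (Fin p) (Fin q) F →ₗ[ℝ] Matrix (Fin p) (Fin q) F) : Prop where
  skew : ∀ A B, reTrace re p (D A * Bᴴ) + reTrace re p (A * (D B)ᴴ) = 0
  leibniz : ∀ A B C, D (A * Bᴴ * C) = D A * Bᴴ * C + A * (D B)ᴴ * C + A * Bᴴ * D C

include hre in
theorem eq_zero_of_reTrace {W : Matrix (Fin p) (Fin q) F}
    (h : ∀ Z : Matrix (Fin p) (Fin q) F, reTrace re p (W * Zᴴ) = 0) : W = 0 := by
  have h3 := h W
  rw [reTrace_mul_comm hre, reTrace_apply, hre.trace_conjTranspose_mul_self] at h3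
  ext i j
  rw [Finset.sum_eq_zero_iff_of_nonneg (fun j _ => by positivity)] at h3
  have h5 := h3 j (Finset.mem_univ j)
  rw [Finset.sum_eq_zero_iff_of_nonneg (fun j _ => by positivity)] at h5
  simpa using h5 i (Finset.mem_univ i)

theorem hasDerivAt_exp_smul_apply {E : Type*} [NormedAddCommGroup E] [NormedSpace ℝ E]
    [CompleteSpace E] (B : E →L[ℝ] E) (v : E) :
    HasDerivAt (fun t : ℝ => NormedSpace.exp (t • B) v) (B v) 0 := by
  have h2 := ((ContinuousLinearMap.apply ℝ E v).hasFDerivAt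
    (x := NormedSpace.exp ((0 : ℝ) • B))).comp_hasDerivAt 0 (hasDerivAt_exp_smul_const B (0 : ℝ))
  refine h2.congr_deriv ?_
  rw [zero_smul, NormedSpace.exp_zero, one_mul]
  rfl

theorem exp_zero_smul_apply {E : Type*} [NormedAddCommGroup E] [NormedSpace ℝ E]
    (B : E →L[ℝ] E) (v : E) : NormedSpace.exp ((0 : ℝ) • B) v = v := by
  rw [zero_smul, NormedSpace.exp_zero]
  rfl

include hre in
/-- Differentiate, at `t = 0`, the invariance of `Re tr (A B*)` and of `Re tr (A B* C D*)` under
`exp(tD)`. -/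
theorem isTernaryDerivation_of_mem_holonomyAlgebra
    {D : Matrix (Fin p) (Fin q) F →ₗ[ℝ] Matrix (Fin p) (Fin q) F}
    (hD : D ∈ holonomyAlgebra (matrixBall F p q) (matrixBallMetric re) 0) :
    IsTernaryDerivation re D := by
  obtain ⟨B, hB, hexp⟩ := hD
  have hpres := fun t => IsParallelTransport.preservesPairing hre (hexp t)
  have hderiv : ∀ v, HasDerivWithinAt (fun t : ℝ => NormedSpace.exp (t • B) v) (D v)
      Set.univ 0 := by
    intro v
    have : CompleteSpace (Matrix (Fin p) (Fin q) F) := FiniteDimensional.complete ℝ _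
    exact (hasDerivAt_exp_smul_apply B v).hasDerivWithinAt.congr_deriv (by rw [← hB]; rfl)
  have h00 : ∀ v, NormedSpace.exp ((0 : ℝ) • B) v = v := exp_zero_smul_apply B
  have hskew : ∀ A C, reTrace re p (D A * Cᴴ) + reTrace re p (A * (D C)ᴴ) = 0 := by
    intro A C
    have h1 := ((hderiv A).matrix_mul (hderiv C).conjTranspose).reTrace re
    have h2 : (fun t : ℝ => reTrace re p (NormedSpace.exp (t • B) A *
        (NormedSpace.exp (t • B) C)ᴴ)) = fun _ => reTrace re p (A * Cᴴ) := by
      funext t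
      have := (hpres t).metric A C
      rw [ballPairing_zero, ballPairing_zero] at this
      exact this
    rw [h2, h00, h00, hasDerivWithinAt_univ, reTrace_add] at h1
    exact h1.unique (hasDerivAt_const _ _)
  refine ⟨hskew, fun A C E => ?_⟩
  rw [← sub_eq_zero]
  refine eq_zero_of_reTrace hre fun Z => ?_
  have h1 := (((hderiv A).matrix_mul (hderiv C).conjTranspose).matrix_mul
    ((hderiv E).matrix_mul (hderiv Z).conjTranspose)).reTrace re
  have h2 : (fun t : ℝ => reTrace re p (NormedSpace.exp (t • B) A *
      (NormedSpace.exp (t • B) C)ᴴ * (NormedSpace.exp (t • B) E *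
      (NormedSpace.exp (t • B) Z)ᴴ))) = fun _ => reTrace re p (A * Cᴴ * (E * Zᴴ)) := by
    funext t
    have := (hpres t).quartic A C E Z
    rw [ballPairing_zero, ballPairing_zero, ballPairing_zero, ballPairing_zero] at this
    exact this
  rw [h2, h00, h00, h00, h00, hasDerivWithinAt_univ] at h1
  have h3 := h1.unique (hasDerivAt_const _ _)
  have h4 := hskew (A * Cᴴ * E) Z
  simp only [Matrix.sub_mul, Matrix.add_mul, Matrix.mul_add, reTrace_add, reTrace_sub,
    Matrix.mul_assoc] at h3 h4 ⊢
  linarith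

end Invariants

/-! ### Exponentials of operators with `B³ = -B` -/

section Exp

/-- The Rodrigues formula: both sides solve `G' = B G` with `G(0) = 1`. -/
theorem exp_smul_of_cube_eq_neg {R : Type*} [NormedRing R] [NormedAlgebra ℝ R] [CompleteSpace R]
    (B : R) (hB : B * B * B = -B) (t : ℝ) :
    NormedSpace.exp (t • B) = 1 + Real.sin t • B + (1 - Real.cos t) • (B * B) := by
  set G : ℝ → R := fun t => 1 + Real.sin t • B + (1 - Real.cos t) • (B * B) with hG
  have hGd : ∀ t, HasDerivAt G (B * G t) t := by
    intro t
    have h1 := (((Real.hasDerivAt_sin t).smul_const B).const_add 1).add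
      (((Real.hasDerivAt_cos t).const_sub 1).smul_const (B * B))
    refine h1.congr_deriv ?_
    have hB' : B * (B * B) = -B := by rw [← mul_assoc, hB]
    simp only [hG, mul_add, mul_one, mul_smul_comm, hB']
    module
  have hEd : ∀ t : ℝ, HasDerivAt (fun t : ℝ => G (-t) * NormedSpace.exp (t • B)) 0 t := by
    intro t
    refine (((hGd (-t)).scomp t (hasDerivAt_neg t)).mul
      (hasDerivAt_exp_smul_const' B t)).congr_deriv ?_
    have hB' : B * (B * B) = B * B * B := (mul_assoc _ _ _).symm
    have hcomm : B * G (-t) = G (-t) * B := by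
      simp only [hG, mul_add, add_mul, mul_one, one_mul, mul_smul_comm, smul_mul_assoc, hB']
    rw [hcomm, neg_one_smul, neg_mul, mul_assoc]
    exact neg_add_cancel _
  have hconst : G (-t) * NormedSpace.exp (t • B) = 1 := by
    have := is_const_of_deriv_eq_zero (fun t => (hEd t).differentiableAt)
      (fun t => (hEd t).deriv) t 0
    refine this.trans ?_
    simp [hG]
  have hinv : G t * G (-t) = 1 := by
    have h3 : B * (B * B) = -B := by rw [← mul_assoc, hB]
    simp only [hG, Real.sin_neg, Real.cos_neg, mul_add, add_mul, mul_one, one_mul, mul_smul_comm,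
      smul_mul_assoc, mul_assoc, h3, mul_neg]
    have h5 := Real.sin_sq_add_cos_sq t
    match_scalars <;> first | ring1 | linear_combination h5 | linear_combination -h5
  calc NormedSpace.exp (t • B) = G t * (G (-t) * NormedSpace.exp (t • B)) := by
        rw [← mul_assoc, hinv, one_mul]
    _ = G t := by rw [hconst, mul_one]

theorem exp_smul_apply_of_cube_eq_neg {E : Type*} [NormedAddCommGroup E] [NormedSpace ℝ E]
    [CompleteSpace E] (B : E →L[ℝ] E) (hB : ∀ v, B (B (B v)) = -B v) (t : ℝ) (v : E) :
    NormedSpace.exp (t • B) v = v + Real.sin t • B v + (1 - Real.cos t) • B (B v) := by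
  rw [exp_smul_of_cube_eq_neg B (by ext v; exact hB v) t]
  rfl

end Exp

/-! ### Curves in the matrix ball and their parallel transport -/

section Loops

attribute [local instance] Matrix.normedAddCommGroup Matrix.normedSpace

open Matrix

variable {F : Type*} [NormedRing F] [StarRing F] [NormedAlgebra ℝ F] [StarModule ℝ F]
  [FiniteDimensional ℝ F]
variable {p q r : ℕ} {re : F →ₗ[ℝ] ℝ} (hre : IsRealPart re)

theorem christoffel_conjTranspose (X U A : Matrix (Fin p) (Fin q) F)
    (hX : X ∈ matrixBall F p q) (hre : IsRealPart re) :
    christoffel Xᴴ Uᴴ Aᴴ = (christoffel X U A)ᴴ := by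
  have e1 := defectInv_conjTranspose_mul hre hX
  simp only [christoffel, conjTranspose_add, conjTranspose_mul, conjTranspose_conjTranspose,
    conjTranspose_defectInv hre hX, Matrix.mul_assoc, e1]
  exact add_comm _ _

include hre in
/-- `X ↦ X*` is an isometry from the ball of `p × q` matrices to that of `q × p` matrices. -/
theorem IsTransportAlong.conjTranspose {γ : ℝ → Matrix (Fin p) (Fin q) F}
    (hγ : ContDiffOn ℝ 1 γ (Set.Icc 0 1))
    (hU : ∀ t ∈ Set.Icc (0 : ℝ) 1, γ t ∈ matrixBall F p q)
    {S : Matrix (Fin p) (Fin q) F →L[ℝ] Matrix (Fin p) (Fin q) F}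
    (hS : IsTransportAlong (matrixBallMetric re) γ S) :
    IsTransportAlong (matrixBallMetric re) (fun t => (γ t)ᴴ)
      ((conjTransposeCLM F p q).comp (S.comp (conjTransposeCLM F q p))) := by
  intro v
  obtain ⟨X, hX, h0, h1⟩ := hS vᴴ
  have hU' : ∀ t ∈ Set.Icc (0 : ℝ) 1, (γ t)ᴴ ∈ matrixBall F q p := fun t ht =>
    hre.conjTranspose_mem_matrixBall (hU t ht)
  have hγ' := fun t ht => ((hγ.differentiableOn one_ne_zero) t ht).hasDerivWithinAt
  refine ⟨fun t => (X t)ᴴ, ?_, (congrArg Matrix.conjTranspose h0).trans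
    (conjTranspose_conjTranspose v), congrArg Matrix.conjTranspose h1⟩
  rw [isParallelAlong_matrixBallMetric_iff hre hU' fun t ht => (hγ' t ht).conjTranspose]
  intro t ht
  have h3 := (isParallelAlong_matrixBallMetric_iff hre hU hγ').mp hX t ht
  refine h3.conjTranspose.congr_deriv ?_
  rw [christoffel_conjTranspose _ _ _ (hU t ht) hre, conjTranspose_neg]

include hre in
theorem IsParallelTransport.conjTranspose {X Y : Matrix (Fin p) (Fin q) F}
    {T : Matrix (Fin p) (Fin q) F →L[ℝ] Matrix (Fin p) (Fin q) F}
    (hT : IsParallelTransport (matrixBall F p q) (matrixBallMetric re) X Y T) :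
    IsParallelTransport (matrixBall F q p) (matrixBallMetric re) Xᴴ Yᴴ
      ((conjTransposeCLM F p q).comp (T.comp (conjTransposeCLM F q p))) := by
  induction hT with
  | const hx =>
    have h := IsParallelTransport.const (g := matrixBallMetric re) Xᴴ
      (hre.conjTranspose_mem_matrixBall hx)
    refine Eq.mp (congrArg (IsParallelTransport _ _ _ _) ?_) h
    ext v : 1
    exact (conjTranspose_conjTranspose v).symm
  | append γ T S hγ hU hT hS ih =>
    have h := IsParallelTransport.append (g := matrixBallMetric re) Xᴴ (fun t => (γ t)ᴴ) _ _
      ((conjTransposeCLM F p q).contDiff.comp_contDiffOn hγ)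
      (fun t ht => hre.conjTranspose_mem_matrixBall (hU t ht)) ih
      (IsTransportAlong.conjTranspose hre hγ hU hS)
    refine Eq.mp (congrArg (IsParallelTransport _ _ _ _) ?_) h
    ext v : 1
    exact congrArg (fun w => (S w)ᴴ) (conjTranspose_conjTranspose (T vᴴ))

include hre in
theorem IsParallelTransport.append_of_hasDerivAt {X Y Z : Matrix (Fin p) (Fin q) F}
    {T S R : Matrix (Fin p) (Fin q) F →L[ℝ] Matrix (Fin p) (Fin q) F}
    (hT : IsParallelTransport (matrixBall F p q) (matrixBallMetric re) X Y T)
    (γ γ' : ℝ → Matrix (Fin p) (Fin q) F) (hγ : ContDiff ℝ 1 γ)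
    (hγ' : ∀ t, HasDerivAt γ (γ' t) t)
    (hU : ∀ t ∈ Set.Icc (0 : ℝ) 1, γ t ∈ matrixBall F p q)
    (h0 : γ 0 = Y) (h1 : γ 1 = Z)
    (A : Matrix (Fin p) (Fin q) F → ℝ → Matrix (Fin p) (Fin q) F)
    (hA : ∀ v, ∀ t ∈ Set.Icc (0 : ℝ) 1, HasDerivWithinAt (A v)
      (-christoffel (γ t) (γ' t) (A v t)) (Set.Icc 0 1) t)
    (hA0 : ∀ v, A v 0 = v) (hA1 : ∀ v, A v 1 = S v) (hR : ∀ v, R v = S (T v)) :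
    IsParallelTransport (matrixBall F p q) (matrixBallMetric re) X Z R := by
  subst h0 h1
  have hRe : R = S.comp T := by ext v : 1; exact hR v
  rw [hRe]
  refine .append X γ T S hγ.contDiffOn hU hT fun v => ⟨A v, ?_, hA0 v, hA1 v⟩
  rw [isParallelAlong_matrixBallMetric_iff hre hU fun t ht => (hγ' t).hasDerivWithinAt]
  exact hA v

include hre in
/-- A partial isometry `W` is contractive, so `r W` is in the ball for `|r| < 1`. -/
theorem smul_mem_matrixBall {W : Matrix (Fin p) (Fin q) F} (hW : W * (Wᴴ * W) = W) {r : ℝ}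
    (hr : r ^ 2 < 1) : r • W ∈ matrixBall F p q := by
  intro y hy
  have hpos : 0 < ∑ j, ‖y j‖ ^ 2 := by
    obtain ⟨j, hj⟩ := Function.ne_iff.mp hy
    exact Finset.sum_pos' (fun i _ => by positivity)
      ⟨j, Finset.mem_univ j, pow_pos (norm_pos_iff.mpr hj) 2⟩
  have h1 : ∑ i, ‖((r • W) *ᵥ y) i‖ ^ 2 = r ^ 2 * ∑ i, ‖(W *ᵥ y) i‖ ^ 2 := by
    rw [Finset.mul_sum]
    refine Finset.sum_congr rfl fun i _ => ?_
    rw [smul_mulVec, Pi.smul_apply, norm_smul, mul_pow, Real.norm_eq_abs, sq_abs]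
  have h2 : ∑ i, ‖(W *ᵥ y) i‖ ^ 2 ≤ ∑ j, ‖y j‖ ^ 2 := by
    have h3 : 0 ≤ re (star (y - (Wᴴ * W) *ᵥ y) ⬝ᵥ (y - (Wᴴ * W) *ᵥ y)) := by
      rw [hre.dotProduct_star_self]; positivity
    have h4 : star y ⬝ᵥ ((Wᴴ * W) *ᵥ y) = star (W *ᵥ y) ⬝ᵥ (W *ᵥ y) := by
      rw [star_mulVec, ← dotProduct_mulVec, mulVec_mulVec]
    have h5 : star ((Wᴴ * W) *ᵥ y) ⬝ᵥ ((Wᴴ * W) *ᵥ y) = star (W *ᵥ y) ⬝ᵥ (W *ᵥ y) := by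
      rw [star_mulVec, ← dotProduct_mulVec, mulVec_mulVec, conjTranspose_mul,
        conjTranspose_conjTranspose, Matrix.mul_assoc, hW, h4]
    rw [star_sub, sub_dotProduct, dotProduct_sub, dotProduct_sub, map_sub, map_sub, map_sub,
      hre.dotProduct_star_comm ((Wᴴ * W) *ᵥ y) y, h5, h4, hre.dotProduct_star_self,
      hre.dotProduct_star_self] at h3
    linarith
  rw [h1]
  have h6 : 0 ≤ ∑ i, ‖(W *ᵥ y) i‖ ^ 2 := by positivity
  nlinarith

theorem defectInv_smul {W : Matrix (Fin p) (Fin q) F} (hW : W * (Wᴴ * W) = W) {r : ℝ}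
    (hr : r ^ 2 < 1) : defectInv (r • W) = 1 + (r ^ 2 / (1 - r ^ 2)) • (Wᴴ * W) := by
  have hff : Wᴴ * (W * (Wᴴ * W)) = Wᴴ * W := by rw [hW]
  have hne : 1 - r ^ 2 ≠ 0 := by linarith
  have hk : r ^ 2 / (1 - r ^ 2) - r ^ 2 - r ^ 2 * (r ^ 2 / (1 - r ^ 2)) = 0 := by
    field_simp; ring
  have h1 : (1 - (r • W)ᴴ * (r • W)) * (1 + (r ^ 2 / (1 - r ^ 2)) • (Wᴴ * W)) = 1 := by
    rw [conjTranspose_smul, star_trivial, Matrix.smul_mul, Matrix.mul_smul, smul_smul, ← sq]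
    simp only [Matrix.sub_mul, Matrix.mul_add, Matrix.one_mul, Matrix.mul_one, Matrix.smul_mul,
      Matrix.mul_smul, Matrix.mul_assoc, hff, smul_sub]
    refine Eq.trans (b := 1 + (r ^ 2 / (1 - r ^ 2) - r ^ 2 - r ^ 2 * (r ^ 2 / (1 - r ^ 2))) •
      (Wᴴ * W)) (by module) ?_
    rw [hk, zero_smul, add_zero]
  have h2 : (1 + (r ^ 2 / (1 - r ^ 2)) • (Wᴴ * W)) * (1 - (r • W)ᴴ * (r • W)) = 1 := by
    rw [conjTranspose_smul, star_trivial, Matrix.smul_mul, Matrix.mul_smul, smul_smul, ← sq]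
    simp only [Matrix.mul_sub, Matrix.add_mul, Matrix.one_mul, Matrix.mul_one, Matrix.smul_mul,
      Matrix.mul_smul, Matrix.mul_assoc, hff, smul_add]
    refine Eq.trans (b := 1 + (r ^ 2 / (1 - r ^ 2) - r ^ 2 - r ^ 2 * (r ^ 2 / (1 - r ^ 2))) •
      (Wᴴ * W)) (by module) ?_
    rw [hk, zero_smul, add_zero]
  exact Ring.inverse_unit ⟨_, _, h1, h2⟩

/-- On the ray through a partial isometry the Christoffel symbol is a scalar multiple of the triple
product. -/
theorem christoffel_smul {W : Matrix (Fin p) (Fin q) F} (hW : W * (Wᴴ * W) = W) {r : ℝ}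
    (hr : r ^ 2 < 1) (U A : Matrix (Fin p) (Fin q) F) :
    christoffel (r • W) U A = (r / (1 - r ^ 2)) • (U * (Wᴴ * A) + A * (Wᴴ * U)) := by
  have hW' : Wᴴ * W * Wᴴ = Wᴴ := by
    have := congrArg Matrix.conjTranspose hW
    simpa only [conjTranspose_mul, conjTranspose_conjTranspose] using this
  have hne : 1 - r ^ 2 ≠ 0 := by linarith
  have h1 : defectInv (r • W) * (r • W)ᴴ = (r / (1 - r ^ 2)) • Wᴴ := by
    rw [defectInv_smul hW hr, conjTranspose_smul, star_trivial, Matrix.mul_smul, Matrix.add_mul,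
      Matrix.one_mul, Matrix.smul_mul, hW', smul_add, smul_smul, ← add_smul]
    congr 1
    field_simp
    ring
  rw [christoffel, Matrix.mul_assoc U, Matrix.mul_assoc A, h1]
  simp only [Matrix.mul_smul, Matrix.smul_mul, Matrix.mul_assoc, smul_add]

end Loops

/-! ### Parallel fields along radial segments and circles -/

section Transport

attribute [local instance] Matrix.normedAddCommGroup Matrix.normedSpace

open Matrix

variable {F : Type*} [NormedRing F] [StarRing F] [NormedAlgebra ℝ F] [StarModule ℝ F]
  [FiniteDimensional ℝ F]
variable {p q r : ℕ} {re : F →ₗ[ℝ] ℝ} (hre : IsRealPart re)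

/-- The real-linear map `A ↦ a A + A b` on matrices. -/
def mulLeftAddRight (a : Matrix (Fin p) (Fin p) F) (b : Matrix (Fin q) (Fin q) F) :
    Matrix (Fin p) (Fin q) F →ₗ[ℝ] Matrix (Fin p) (Fin q) F where
  toFun A := a * A + A * b
  map_add' A B := by rw [Matrix.mul_add, Matrix.add_mul]; abel
  map_smul' c A := by
    rw [Matrix.mul_smul, Matrix.smul_mul, smul_add, RingHom.id_apply]

@[simp]
theorem mulLeftAddRight_apply (a : Matrix (Fin p) (Fin p) F) (b : Matrix (Fin q) (Fin q) F)
    (A : Matrix (Fin p) (Fin q) F) : mulLeftAddRight a b A = a * A + A * b := rfl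

/-- The two-sided multiplication `A ↦ a A b` as a continuous real-linear map. -/
noncomputable def sandwichCLM (a : Matrix (Fin p) (Fin p) F) (b : Matrix (Fin q) (Fin q) F) :
    Matrix (Fin p) (Fin q) F →L[ℝ] Matrix (Fin p) (Fin q) F :=
  LinearMap.toContinuousLinearMap
    { toFun := fun A => a * A * b
      map_add' := fun A B => by rw [Matrix.mul_add, Matrix.add_mul]
      map_smul' := fun c A => by rw [Matrix.mul_smul, Matrix.smul_mul, RingHom.id_apply] }

theorem sandwichCLM_apply (a : Matrix (Fin p) (Fin p) F) (b : Matrix (Fin q) (Fin q) F)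
    (A : Matrix (Fin p) (Fin q) F) : sandwichCLM a b A = a * A * b := rfl

/-- Two partial isometries `x`, `y` with the same final projection `x x* = y y*` and with orthogonal
initial spaces, `x y* = 0`. Then `cos θ x + sin θ y` is a partial isometry for every `θ`, and
`r (cos θ x + sin θ y)` is a circle in the ball for `r < 1`. Over `ℝ` an example is two unit
vectors of `ℝ^q` which are orthogonal, placed in the same row. -/
structure IsOrthoPair (x y : Matrix (Fin p) (Fin q) F) : Prop where
  mul_conj : x * yᴴ = 0
  norm_eq : y * yᴴ = x * xᴴ
  left : x * (xᴴ * x) = x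
  right : x * (xᴴ * y) = y

namespace IsOrthoPair

variable {x y : Matrix (Fin p) (Fin q) F} (h : IsOrthoPair x y)
include h

theorem mul_conj' : y * xᴴ = 0 := by
  have := congrArg Matrix.conjTranspose h.mul_conj
  simpa using this

theorem left' : y * (yᴴ * x) = x := by
  rw [← Matrix.mul_assoc, h.norm_eq, Matrix.mul_assoc, h.left]

theorem right' : y * (yᴴ * y) = y := by
  rw [← Matrix.mul_assoc, h.norm_eq, Matrix.mul_assoc, h.right]

theorem left_assoc (Z : Matrix (Fin q) (Fin r) F) : x * (xᴴ * (x * Z)) = x * Z := by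
  rw [← Matrix.mul_assoc xᴴ, ← Matrix.mul_assoc, h.left]

theorem right_assoc (Z : Matrix (Fin q) (Fin r) F) : x * (xᴴ * (y * Z)) = y * Z := by
  rw [← Matrix.mul_assoc xᴴ, ← Matrix.mul_assoc, h.right]

theorem left_assoc' (Z : Matrix (Fin q) (Fin r) F) : y * (yᴴ * (x * Z)) = x * Z := by
  rw [← Matrix.mul_assoc yᴴ, ← Matrix.mul_assoc, h.left']

theorem mul_conj_assoc (Z : Matrix (Fin p) (Fin r) F) : x * (yᴴ * Z) = 0 := by
  rw [← Matrix.mul_assoc, h.mul_conj, Matrix.zero_mul]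

theorem mul_conj_assoc' (Z : Matrix (Fin p) (Fin r) F) : y * (xᴴ * Z) = 0 := by
  rw [← Matrix.mul_assoc, h.mul_conj', Matrix.zero_mul]

/-- The unit circle of the plane spanned by `x` and `y` consists of partial isometries. -/
theorem rotate {c s : ℝ} (hcs : c ^ 2 + s ^ 2 = 1) :
    (c • x + s • y) * ((c • x + s • y)ᴴ * (c • x + s • y)) = c • x + s • y := by
  have e : (c • x + s • y) * (c • x + s • y)ᴴ = x * xᴴ := by
    simp only [conjTranspose_add, conjTranspose_smul, star_trivial, Matrix.add_mul, Matrix.mul_add,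
      Matrix.smul_mul, Matrix.mul_smul, h.mul_conj, h.mul_conj', h.norm_eq, smul_zero, add_zero,
      zero_add, smul_smul, ← add_smul]
    rw [← sq, ← sq, hcs, one_smul]
  rw [← Matrix.mul_assoc, e]
  simp only [Matrix.mul_add, Matrix.mul_smul, Matrix.mul_assoc, h.left, h.right]

/-- Parallel fields along `ρ x`: the factor `d` is `√(1 - ρ²)` up to a constant, which is what the
hypothesis on its derivative says. -/
theorem hasDerivAt_radial {d ρ : ℝ → ℝ} {d' ρ' t : ℝ} (hd : HasDerivAt d d' t)
    (hd' : d' = -(ρ t * ρ' / (1 - ρ t ^ 2)) * d t) (hρ : ρ t ^ 2 < 1)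
    (v : Matrix (Fin p) (Fin q) F) (s : Set ℝ) :
    HasDerivWithinAt (fun t => (1 + (d t - 1) • (x * xᴴ)) * v * (1 + (d t - 1) • (xᴴ * x)))
      (-christoffel (ρ t • x) (ρ' • x)
        ((1 + (d t - 1) • (x * xᴴ)) * v * (1 + (d t - 1) • (xᴴ * x)))) s t := by
  have h1 := (((hd.sub_const 1).smul_const (x * xᴴ)).const_add 1).hasDerivWithinAt (s := s)
  have h2 := (((hd.sub_const 1).smul_const (xᴴ * x)).const_add 1).hasDerivWithinAt (s := s)
  refine ((h1.matrix_mul (hasDerivWithinAt_const _ _ v)).matrix_mul h2).congr_deriv ?_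
  have e1 : (x * xᴴ) * (1 + (d t - 1) • (x * xᴴ)) = d t • (x * xᴴ) := by
    simp only [Matrix.mul_add, Matrix.mul_one, Matrix.mul_smul, Matrix.mul_assoc, h.left_assoc]
    module
  have e2 : (1 + (d t - 1) • (xᴴ * x)) * (xᴴ * x) = d t • (xᴴ * x) := by
    simp only [Matrix.add_mul, Matrix.one_mul, Matrix.smul_mul, Matrix.mul_assoc, h.left]
    module
  rw [christoffel_smul h.left hρ, hd', Matrix.mul_zero, add_zero]
  have e3 : ρ' • x * (xᴴ * ((1 + (d t - 1) • (x * xᴴ)) * v * (1 + (d t - 1) • (xᴴ * x)))) =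
      (ρ' * d t) • (x * xᴴ * v * (1 + (d t - 1) • (xᴴ * x))) := by
    rw [Matrix.smul_mul, ← Matrix.mul_assoc x, ← Matrix.mul_assoc (x * xᴴ),
      ← Matrix.mul_assoc (x * xᴴ), e1, Matrix.smul_mul, Matrix.smul_mul, smul_smul]
  have e4 : (1 + (d t - 1) • (x * xᴴ)) * v * (1 + (d t - 1) • (xᴴ * x)) * (xᴴ * ρ' • x) =
      (ρ' * d t) • ((1 + (d t - 1) • (x * xᴴ)) * v * (xᴴ * x)) := by
    rw [Matrix.mul_smul, Matrix.mul_smul, Matrix.mul_assoc _ _ (xᴴ * x), e2, Matrix.mul_smul,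
      smul_smul]
  rw [e3, e4, Matrix.smul_mul, Matrix.smul_mul, Matrix.mul_smul]
  module

/-- Parallel fields along the circle of radius `√(1 - c²)` with angle `θ`. The second factor rotates
the frame `x`, `y` along with the curve; in this moving frame the equation has constant coefficients,
and the first factor is its solution. In the basis of the plane rescaled by `c` that factor is a
rotation by the angle `-θ / c`. -/
theorem hasDerivAt_circle {c : ℝ} (hc : 0 < c) (hc1 : c < 1) (v : Matrix (Fin p) (Fin q) F)
    (s : Set ℝ) (θ : ℝ) :
    HasDerivWithinAt (fun θ : ℝ => v *
      ((1 + (Real.cos (θ / c) - 1) • (xᴴ * x + yᴴ * y)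
        - Real.sin (θ / c) • ((1 / c) • (xᴴ * y) - c • (yᴴ * x))) *
      (1 + (Real.cos θ - 1) • (xᴴ * x + yᴴ * y) + Real.sin θ • (xᴴ * y - yᴴ * x))))
      (-christoffel (Real.sqrt (1 - c ^ 2) • (Real.cos θ • x + Real.sin θ • y))
        (Real.sqrt (1 - c ^ 2) • (-Real.sin θ • x + Real.cos θ • y))
        (v * ((1 + (Real.cos (θ / c) - 1) • (xᴴ * x + yᴴ * y)
        - Real.sin (θ / c) • ((1 / c) • (xᴴ * y) - c • (yᴴ * x))) *
      (1 + (Real.cos θ - 1) • (xᴴ * x + yᴴ * y) + Real.sin θ • (xᴴ * y - yᴴ * x))))) s θ := by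
  have hdiv : HasDerivAt (fun θ : ℝ => θ / c) (1 / c) θ := (hasDerivAt_id θ).div_const c
  have h1 := ((((hdiv.cos.sub_const 1).smul_const (xᴴ * x + yᴴ * y)).const_add 1).sub
    (hdiv.sin.smul_const ((1 / c) • (xᴴ * y) - c • (yᴴ * x)))).hasDerivWithinAt (s := s)
  have h2 := (((((Real.hasDerivAt_cos θ).sub_const 1).smul_const (xᴴ * x + yᴴ * y)).const_add
    1).add ((Real.hasDerivAt_sin θ).smul_const (xᴴ * y - yᴴ * x))).hasDerivWithinAt (s := s)
  refine ((hasDerivWithinAt_const _ _ v).matrix_mul (h1.matrix_mul h2)).congr_deriv ?_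
  have hr : Real.sqrt (1 - c ^ 2) ^ 2 = 1 - c ^ 2 := Real.sq_sqrt (by nlinarith)
  have hcs : Real.cos θ ^ 2 + Real.sin θ ^ 2 = 1 := by
    rw [add_comm]; exact Real.sin_sq_add_cos_sq θ
  rw [christoffel_smul (h.rotate hcs) (by rw [hr]; nlinarith), Matrix.zero_mul, zero_add]
  have e1 : Real.sqrt (1 - c ^ 2) • (-Real.sin θ • x + Real.cos θ • y) *
      (Real.cos θ • x + Real.sin θ • y)ᴴ = 0 := by
    simp only [conjTranspose_add, conjTranspose_smul, star_trivial, Matrix.add_mul, Matrix.mul_add,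
      Matrix.smul_mul, Matrix.mul_smul, h.mul_conj, h.mul_conj', h.norm_eq, smul_zero, add_zero,
      zero_add]
    module
  rw [← Matrix.mul_assoc (_ • (_ + _)), e1, Matrix.zero_mul, zero_add, hr]
  have hk : Real.sqrt (1 - c ^ 2) / (1 - (1 - c ^ 2)) * Real.sqrt (1 - c ^ 2) =
      1 / c * (1 / c) - 1 := by
    rw [div_mul_eq_mul_div, ← sq, hr]
    field_simp
    ring
  rw [Matrix.mul_smul, Matrix.mul_smul, smul_smul, hk, Matrix.mul_assoc v, ← Matrix.mul_smul v,
    ← Matrix.mul_neg v]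
  refine congrArg (v * ·) ?_
  rw [← sub_eq_zero]
  dsimp only [Pi.add_apply, Pi.sub_apply]
  have hcc : c * (1 / c) = 1 := by field_simp
  generalize Real.cos (θ / c) = C
  generalize Real.sin (θ / c) = S
  generalize Real.cos θ = a at *
  generalize Real.sin θ = b at *
  generalize 1 / c = d at *
  simp only [conjTranspose_add, conjTranspose_smul, star_trivial, Matrix.add_mul, Matrix.mul_add,
      Matrix.smul_mul, Matrix.mul_smul, Matrix.sub_mul, Matrix.mul_sub, Matrix.one_mul,
      Matrix.mul_one, Matrix.mul_assoc,
      h.left, h.right, h.left', h.right', h.mul_conj_assoc, h.mul_conj_assoc',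
      smul_zero, add_zero, sub_zero, zero_add, zero_sub, Matrix.mul_zero, neg_zero, Matrix.neg_mul]
  match_scalars
  · linear_combination (-(d * d - 1) * b * C) * hcs
  · linear_combination (b * C + a * S * d) * hcc + (d * d - 1) * a * S * c * hcs
  · linear_combination ((d * d - 1) * a * C) * hcs
  · linear_combination (a * C - b * S * d) * hcc - (d * d - 1) * b * S * c * hcs

end IsOrthoPair

end Transport

/-! ### Rotations in the holonomy group -/

section Rotations

attribute [local instance] Matrix.normedAddCommGroup Matrix.normedSpace

open Matrix

variable {F : Type*} [NormedRing F] [StarRing F] [NormedAlgebra ℝ F] [StarModule ℝ F]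
  [FiniteDimensional ℝ F]
variable {p q r : ℕ} {re : F →ₗ[ℝ] ℝ} (hre : IsRealPart re)

theorem christoffel_smul_middle (X U A : Matrix (Fin p) (Fin q) F) (k : ℝ) :
    christoffel X (k • U) A = k • christoffel X U A := by
  simp only [christoffel, Matrix.smul_mul, Matrix.mul_smul, smul_add]

namespace IsOrthoPair

variable {x y : Matrix (Fin p) (Fin q) F} (h : IsOrthoPair x y)
include h

include hre in
/-- Parallel transport along the radial segment from `α x` to `β x` scales the two one-sided factors
by `√(1 - β²) / √(1 - α²)`. -/
theorem append_radial {X : Matrix (Fin p) (Fin q) F}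
    {T R : Matrix (Fin p) (Fin q) F →L[ℝ] Matrix (Fin p) (Fin q) F} {α β : ℝ}
    (hT : IsParallelTransport (matrixBall F p q) (matrixBallMetric re) X (α • x) T)
    (hα : α ^ 2 < 1) (hβ : β ^ 2 < 1)
    (hR : ∀ v, R v =
      (1 + (Real.sqrt (1 - β ^ 2) / Real.sqrt (1 - α ^ 2) - 1) • (x * xᴴ)) * T v *
        (1 + (Real.sqrt (1 - β ^ 2) / Real.sqrt (1 - α ^ 2) - 1) • (xᴴ * x))) :
    IsParallelTransport (matrixBall F p q) (matrixBallMetric re) X (β • x) R := by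
  set ρ : ℝ → ℝ := fun s => α + s * (β - α) with hρdef
  have hρ : ∀ s, HasDerivAt ρ (β - α) s := fun s =>
    (((hasDerivAt_id s).mul_const (β - α)).const_add α).congr_deriv (one_mul _)
  have hρ1 : ∀ s ∈ Set.Icc (0 : ℝ) 1, ρ s ^ 2 < 1 := by
    intro s hs
    rw [sq_lt_one_iff_abs_lt_one, abs_lt] at *
    exact (convex_Ioo (-1 : ℝ) 1).add_smul_sub_mem hα hβ hs
  have hk : Real.sqrt (1 - α ^ 2) ≠ 0 := (Real.sqrt_pos.mpr (by linarith)).ne'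
  refine hT.append_of_hasDerivAt hre (fun s => ρ s • x) (fun _ => (β - α) • x)
    (S := sandwichCLM (1 + (Real.sqrt (1 - β ^ 2) / Real.sqrt (1 - α ^ 2) - 1) • (x * xᴴ))
      (1 + (Real.sqrt (1 - β ^ 2) / Real.sqrt (1 - α ^ 2) - 1) • (xᴴ * x)))
    ?_ (fun s => (hρ s).smul_const x) (fun s hs => smul_mem_matrixBall hre h.left (hρ1 s hs))
    (by simp [hρdef]) (by simp [hρdef])
    (fun v s => (1 + (Real.sqrt (1 - ρ s ^ 2) / Real.sqrt (1 - α ^ 2) - 1) • (x * xᴴ)) * v *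
      (1 + (Real.sqrt (1 - ρ s ^ 2) / Real.sqrt (1 - α ^ 2) - 1) • (xᴴ * x)))
    ?_ ?_ ?_ hR
  · have : ContDiff ℝ 1 ρ := by fun_prop
    exact this.smul contDiff_const
  · intro v s hs
    have hpos : 0 < 1 - ρ s ^ 2 := by linarith [hρ1 s hs]
    have hd := ((((hρ s).pow 2).const_sub 1).sqrt hpos.ne').div_const (Real.sqrt (1 - α ^ 2))
    refine h.hasDerivAt_radial hd ?_ (hρ1 s hs) v _
    have hsq : Real.sqrt (1 - ρ s ^ 2) ^ 2 = 1 - ρ s ^ 2 := Real.sq_sqrt hpos.le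
    have hne : Real.sqrt (1 - ρ s ^ 2) ≠ 0 := (Real.sqrt_pos.mpr hpos).ne'
    rw [Pi.pow_apply]
    generalize Real.sqrt (1 - ρ s ^ 2) = w at *
    rw [← hsq]
    field_simp
    norm_num
    ring
  · intro v
    simp [hρdef, hk]
  · intro v
    simp only [hρdef, one_mul, add_sub_cancel]
    rfl

include hre in
/-- Parallel transport once around the circle of radius `√(1 - c²)`. -/
theorem append_circle {X : Matrix (Fin p) (Fin q) F}
    {T R : Matrix (Fin p) (Fin q) F →L[ℝ] Matrix (Fin p) (Fin q) F} {c : ℝ}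
    (hc : 0 < c) (hc1 : c < 1)
    (hT : IsParallelTransport (matrixBall F p q) (matrixBallMetric re) X
      (Real.sqrt (1 - c ^ 2) • x) T)
    (hR : ∀ v, R v = T v * (1 + (Real.cos (2 * Real.pi / c) - 1) • (xᴴ * x + yᴴ * y)
        - Real.sin (2 * Real.pi / c) • ((1 / c) • (xᴴ * y) - c • (yᴴ * x)))) :
    IsParallelTransport (matrixBall F p q) (matrixBallMetric re) X
      (Real.sqrt (1 - c ^ 2) • x) R := by
  have hr : Real.sqrt (1 - c ^ 2) ^ 2 = 1 - c ^ 2 := Real.sq_sqrt (by nlinarith)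
  have hθ : ∀ s : ℝ, HasDerivAt (fun s => 2 * Real.pi * s) (2 * Real.pi) s := fun s => by
    simpa using (hasDerivAt_id s).const_mul (2 * Real.pi)
  refine hT.append_of_hasDerivAt hre
    (fun s => Real.sqrt (1 - c ^ 2) •
      (Real.cos (2 * Real.pi * s) • x + Real.sin (2 * Real.pi * s) • y))
    (fun s => (2 * Real.pi) • Real.sqrt (1 - c ^ 2) •
      (-Real.sin (2 * Real.pi * s) • x + Real.cos (2 * Real.pi * s) • y))
    (S := sandwichCLM 1 (1 + (Real.cos (2 * Real.pi / c) - 1) • (xᴴ * x + yᴴ * y)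
        - Real.sin (2 * Real.pi / c) • ((1 / c) • (xᴴ * y) - c • (yᴴ * x))))
    ?_ ?_ ?_ (by simp) (by simp)
    (fun v s => (fun θ : ℝ => v *
      ((1 + (Real.cos (θ / c) - 1) • (xᴴ * x + yᴴ * y)
        - Real.sin (θ / c) • ((1 / c) • (xᴴ * y) - c • (yᴴ * x))) *
      (1 + (Real.cos θ - 1) • (xᴴ * x + yᴴ * y) + Real.sin θ • (xᴴ * y - yᴴ * x))))
        (2 * Real.pi * s)) ?_ ?_ ?_ ?_
  · have h1 : ContDiff ℝ 1 (fun s => Real.cos (2 * Real.pi * s)) := by fun_prop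
    have h2 : ContDiff ℝ 1 (fun s => Real.sin (2 * Real.pi * s)) := by fun_prop
    exact ((h1.smul contDiff_const).add (h2.smul contDiff_const)).const_smul _
  · intro s
    refine ((((hθ s).cos.smul_const x).add ((hθ s).sin.smul_const y)).const_smul
      (Real.sqrt (1 - c ^ 2))).congr_deriv ?_
    module
  · intro s _
    refine smul_mem_matrixBall hre (h.rotate ?_) (by rw [hr]; nlinarith)
    exact Real.cos_sq_add_sin_sq _
  · intro v s _
    rw [christoffel_smul_middle, ← smul_neg]
    exact (h.hasDerivAt_circle hc hc1 v Set.univ (2 * Real.pi * s)).scomp s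
      (hθ s).hasDerivWithinAt (fun _ _ => Set.mem_univ _)
  · intro v
    simp
  · intro v
    simp [sandwichCLM_apply]
  · intro v
    rw [hR, sandwichCLM_apply, Matrix.one_mul]

include hre in
/-- Go out radially to radius `√(1 - c²)`, once around the circle, and back. The holonomy of this
loop is right multiplication by the rotation by `-2π / c` in the plane of `x` and `y`, and
`c = 2π / (t + 2πk)` realizes every angle `t`. -/
theorem rotation_mem_holonomyGroup (t : ℝ) :
    sandwichCLM 1 (1 + (Real.cos t - 1) • (xᴴ * x + yᴴ * y) - Real.sin t • (xᴴ * y - yᴴ * x)) ∈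
      holonomyGroup (matrixBall F p q) (matrixBallMetric re) 0 := by
  have hpi := Real.pi_pos
  -- a positive radius `√(1 - c²)` less than 1 needs `0 < c < 1`, so `t` is shifted beyond `2π`
  obtain ⟨k, hk⟩ : ∃ k : ℕ, 2 * Real.pi < t + k * (2 * Real.pi) := by
    obtain ⟨k, hk⟩ := exists_nat_gt ((2 * Real.pi - t) / (2 * Real.pi))
    refine ⟨k, ?_⟩
    rw [div_lt_iff₀ (by positivity)] at hk
    linarith
  set c := 2 * Real.pi / (t + k * (2 * Real.pi)) with hcdef
  have hden : 0 < t + k * (2 * Real.pi) := by linarith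
  have hc : 0 < c := by positivity
  have hc1 : c < 1 := by rw [hcdef, div_lt_one hden]; exact hk
  have hct : 2 * Real.pi / c = t + k * (2 * Real.pi) := by
    rw [hcdef]; field_simp
  have hcos : Real.cos (2 * Real.pi / c) = Real.cos t := by
    rw [hct, Real.cos_add_nat_mul_two_pi]
  have hsin : Real.sin (2 * Real.pi / c) = Real.sin t := by
    rw [hct, Real.sin_add_nat_mul_two_pi]
  have hr : Real.sqrt (1 - c ^ 2) ^ 2 = 1 - c ^ 2 := Real.sq_sqrt (by nlinarith)
  have hr1 : Real.sqrt (1 - c ^ 2) ^ 2 < 1 := by rw [hr]; nlinarith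
  have hrc : Real.sqrt (1 - Real.sqrt (1 - c ^ 2) ^ 2) = c := by
    rw [hr, sub_sub_cancel, Real.sqrt_sq hc.le]
  have h00 : (0 : Matrix (Fin p) (Fin q) F) ∈ matrixBall F p q := by
    simpa using smul_mem_matrixBall hre h.left (r := 0) (by norm_num)
  have T0 := IsParallelTransport.const (g := matrixBallMetric re) _ h00
  have T1 := h.append_radial hre (α := 0) (β := Real.sqrt (1 - c ^ 2))
    (R := sandwichCLM (1 + (c - 1) • (x * xᴴ)) (1 + (c - 1) • (xᴴ * x)))
    (by rw [zero_smul]; exact T0) (by norm_num) hr1 (fun v => by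
      rw [hrc, sandwichCLM_apply]; norm_num; rfl)
  have T2 := h.append_circle hre hc hc1 (R := sandwichCLM (1 + (c - 1) • (x * xᴴ))
    ((1 + (c - 1) • (xᴴ * x)) * (1 + (Real.cos (2 * Real.pi / c) - 1) • (xᴴ * x + yᴴ * y)
        - Real.sin (2 * Real.pi / c) • ((1 / c) • (xᴴ * y) - c • (yᴴ * x))))) T1 (fun v => by
      rw [sandwichCLM_apply, sandwichCLM_apply, ← Matrix.mul_assoc])
  have T3 := h.append_radial hre (β := 0)
    (R := sandwichCLM 1 (1 + (Real.cos t - 1) • (xᴴ * x + yᴴ * y) -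
      Real.sin t • (xᴴ * y - yᴴ * x))) T2 hr1 (by norm_num) (fun v => by
      rw [hrc, sandwichCLM_apply, sandwichCLM_apply, hcos, hsin]
      have hcc : c * (1 / c) = 1 := by field_simp
      have hz : Real.sqrt (1 - 0 ^ 2) = 1 := by norm_num
      rw [hz, Matrix.one_mul]
      generalize 1 / c = d at *
      have e1 : (1 + (d - 1) • (x * xᴴ)) * (1 + (c - 1) • (x * xᴴ)) = 1 := by
        simp only [Matrix.mul_add, Matrix.add_mul, Matrix.one_mul, Matrix.mul_one, Matrix.smul_mul,
          Matrix.mul_smul, Matrix.mul_assoc, h.left_assoc]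
        match_scalars
        · ring1
        · linear_combination hcc
      have e2 : (1 + (c - 1) • (xᴴ * x)) * (1 + (Real.cos t - 1) • (xᴴ * x + yᴴ * y)
          - Real.sin t • (d • (xᴴ * y) - c • (yᴴ * x))) * (1 + (d - 1) • (xᴴ * x)) =
          1 + (Real.cos t - 1) • (xᴴ * x + yᴴ * y) - Real.sin t • (xᴴ * y - yᴴ * x) := by
        generalize Real.cos t = C
        generalize Real.sin t = S
        simp only [Matrix.add_mul, Matrix.mul_add,
          Matrix.smul_mul, Matrix.mul_smul, Matrix.sub_mul, Matrix.mul_sub, Matrix.one_mul,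
          Matrix.mul_one, Matrix.mul_assoc, h.left, h.right, h.mul_conj_assoc,
          h.mul_conj_assoc', smul_zero, add_zero, zero_sub, Matrix.mul_zero]
        match_scalars
        · ring1
        · linear_combination C * hcc
        · linear_combination 0 * hcc
        · linear_combination -S * hcc
        · linear_combination S * hcc
      rw [← e2]
      simp only [← Matrix.mul_assoc]
      rw [e1, Matrix.one_mul])
  rw [zero_smul] at T3
  exact T3

/-- The generator of the rotations of `rotation_mem_holonomyGroup`. -/
theorem mulRight_mem_holonomyAlgebra (hre : IsRealPart re) :
    mulLeftAddRight 0 (-(xᴴ * y - yᴴ * x)) ∈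
      holonomyAlgebra (matrixBall F p q) (matrixBallMetric re) 0 := by
  have hcomplete : CompleteSpace (Matrix (Fin p) (Fin q) F) := FiniteDimensional.complete ℝ _
  set B : Matrix (Fin p) (Fin q) F →L[ℝ] Matrix (Fin p) (Fin q) F :=
    LinearMap.toContinuousLinearMap (mulLeftAddRight 0 (-(xᴴ * y - yᴴ * x))) with hBdef
  have hB : ∀ v, B v = -(v * (xᴴ * y - yᴴ * x)) := fun v => by
    change (0 : Matrix (Fin p) (Fin p) F) * v + v * (-(xᴴ * y - yᴴ * x)) = _
    rw [Matrix.zero_mul, zero_add, Matrix.mul_neg]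
  have hBB : ∀ v, B (B v) = -(v * (xᴴ * x + yᴴ * y)) := fun v => by
    rw [hB, hB, Matrix.neg_mul, neg_neg, Matrix.mul_assoc]
    simp only [Matrix.mul_sub, Matrix.sub_mul, Matrix.mul_assoc, h.left', h.right,
      h.mul_conj_assoc, h.mul_conj_assoc', Matrix.mul_zero, sub_zero, zero_sub, Matrix.mul_add,
      Matrix.mul_neg]
    abel
  have hBBB : ∀ v, B (B (B v)) = -B v := fun v => by
    rw [hBB, hB, Matrix.neg_mul, neg_neg, neg_neg]
    simp only [Matrix.mul_sub, Matrix.sub_mul, Matrix.mul_add, Matrix.mul_assoc,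
      h.left, h.right', h.mul_conj_assoc, h.mul_conj_assoc', Matrix.mul_zero, sub_zero, zero_sub]
    abel
  refine ⟨B, rfl, fun t => ?_⟩
  refine (congrArg (· ∈ holonomyGroup (matrixBall F p q) (matrixBallMetric re) 0)
    (ContinuousLinearMap.ext fun v => ?_)).mpr (h.rotation_mem_holonomyGroup hre t)
  refine (exp_smul_apply_of_cube_eq_neg B hBBB t v).trans ?_
  change v + Real.sin t • B v + (1 - Real.cos t) • B (B v) =
    (1 : Matrix (Fin p) (Fin p) F) * v * (1 + (Real.cos t - 1) • (xᴴ * x + yᴴ * y) -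
      Real.sin t • (xᴴ * y - yᴴ * x))
  rw [hBB, hB]
  simp only [Matrix.one_mul, Matrix.mul_sub, Matrix.mul_add, Matrix.mul_smul, Matrix.mul_one]
  module

/-- The left multiplications, from the right ones by the isometry `X ↦ X*`. -/
theorem mulLeft_mem_holonomyAlgebra (hre : IsRealPart re) :
    mulLeftAddRight (xᴴ * y - yᴴ * x) 0 ∈
      holonomyAlgebra (matrixBall F q p) (matrixBallMetric re) 0 := by
  have hcomplete : CompleteSpace (Matrix (Fin q) (Fin p) F) := FiniteDimensional.complete ℝ _
  set B : Matrix (Fin q) (Fin p) F →L[ℝ] Matrix (Fin q) (Fin p) F :=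
    LinearMap.toContinuousLinearMap (mulLeftAddRight (xᴴ * y - yᴴ * x) 0) with hBdef
  have hB : ∀ v, B v = (xᴴ * y - yᴴ * x) * v := fun v => by
    change (xᴴ * y - yᴴ * x) * v + v * (0 : Matrix (Fin p) (Fin p) F) = _
    rw [Matrix.mul_zero, add_zero]
  have hBB : ∀ v, B (B v) = -((xᴴ * x + yᴴ * y) * v) := fun v => by
    rw [hB, hB, ← Matrix.mul_assoc]
    simp only [Matrix.mul_sub, Matrix.sub_mul, Matrix.mul_assoc, h.left_assoc', h.right_assoc,
      h.mul_conj_assoc, h.mul_conj_assoc', Matrix.mul_zero, sub_zero, zero_sub, Matrix.add_mul,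
      Matrix.neg_mul]
    abel
  have hBBB : ∀ v, B (B (B v)) = -B v := fun v => by
    rw [hBB, hB]
    simp only [Matrix.mul_sub, Matrix.sub_mul, Matrix.add_mul, Matrix.mul_assoc,
      h.left_assoc', h.right_assoc, h.mul_conj_assoc, h.mul_conj_assoc', Matrix.mul_zero]
    abel
  refine ⟨B, rfl, fun t => ?_⟩
  have hmem := IsParallelTransport.conjTranspose hre (h.rotation_mem_holonomyGroup hre t)
  rw [conjTranspose_zero] at hmem
  refine (congrArg (· ∈ holonomyGroup (matrixBall F q p) (matrixBallMetric re) 0)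
    (ContinuousLinearMap.ext fun v => ?_)).mpr hmem
  refine (exp_smul_apply_of_cube_eq_neg B hBBB t v).trans ?_
  change v + Real.sin t • B v + (1 - Real.cos t) • B (B v) =
    ((1 : Matrix (Fin p) (Fin p) F) * vᴴ * (1 + (Real.cos t - 1) • (xᴴ * x + yᴴ * y) -
      Real.sin t • (xᴴ * y - yᴴ * x)))ᴴ
  rw [hBB, hB]
  simp only [Matrix.one_mul, conjTranspose_mul, conjTranspose_sub, conjTranspose_add,
    conjTranspose_smul, star_trivial, conjTranspose_conjTranspose, conjTranspose_one,
    Matrix.sub_mul, Matrix.add_mul, Matrix.smul_mul]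
  module

end IsOrthoPair

end Rotations

/-! ### Skew-Hermitian matrices spanned by orthogonal pairs -/

section Spans

open Matrix

variable {F : Type*} [NormedRing F] [StarRing F] [NormedAlgebra ℝ F] [StarModule ℝ F]
  [FiniteDimensional ℝ F]
variable {p q r : ℕ} {re : F →ₗ[ℝ] ℝ} (hre : IsRealPart re)

section
variable {S : Submodule ℝ (Matrix (Fin q) (Fin q) F)}
  (hS : ∀ x y : Matrix (Fin p) (Fin q) F, IsOrthoPair x y → xᴴ * y - yᴴ * x ∈ S) (i : Fin p)
include hS i

theorem single_sub_single_mem_of_unit {j k : Fin q} (hjk : j ≠ k) {u : F} (hu : u * star u = 1) :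
    single j k u - single k j (star u) ∈ S := by
  have h : IsOrthoPair (single i j 1) (single i k u) := by
    constructor <;> simp [conjTranspose_single, hjk, hu]
  simpa [conjTranspose_single] using hS _ _ h

include hre in
theorem single_sub_single_mem {j k : Fin q} (hjk : j ≠ k) (a : F) :
    single j k a - single k j (star a) ∈ S := by
  rcases eq_or_ne a 0 with rfl | ha
  · simp
  · have hn : ‖a‖ ≠ 0 := norm_ne_zero_iff.mpr ha
    have h1 := single_sub_single_mem_of_unit hS i hjk (u := ‖a‖⁻¹ • a) (by
      rw [star_smul, star_trivial, smul_mul_smul_comm, hre.mul_star_self, smul_smul]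
      rw [show ‖a‖⁻¹ * ‖a‖⁻¹ * ‖a‖ ^ 2 = 1 by field_simp, one_smul])
    have h2 := S.smul_mem ‖a‖ h1
    rwa [smul_sub, smul_single, smul_single, star_smul, star_trivial, smul_smul, smul_smul,
      mul_inv_cancel₀ hn, one_smul, one_smul] at h2

/-- For `u = w z` a product of two anticommuting imaginary units, two orthogonal pairs supported in
the columns `j` and `k` contribute `u (E_jj - E_kk)` and `u (E_jj + E_kk)`. -/
theorem single_self_mem {j k : Fin q} (hjk : j ≠ k) {w z u : F} (hw : star w = -w)
    (hz : star z = -z) (hww : w * w = -1) (hzz : z * z = -1) (hwz : w * z = u)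
    (hzw : z * w = -u) : single j j u ∈ S := by
  -- the normalization which makes the two pairs below partial isometries
  obtain ⟨s, hs⟩ : ∃ s : ℝ, s * s = 1 / 2 := ⟨Real.sqrt (1 / 2), Real.mul_self_sqrt (by norm_num)⟩
  have hu : star u = -u := by rw [← hwz, star_mul, hw, hz, neg_mul_neg, hzw, hwz]
  have hwu : w * u = -z := by rw [← hwz, ← mul_assoc, hww, neg_one_mul]
  have huz : u * z = -w := by rw [← hwz, mul_assoc, hzz, mul_neg_one]
  have hzu : z * u = w := by
    rw [← neg_eq_iff_eq_neg.mpr hzw, mul_neg, ← mul_assoc, hzz, neg_one_mul, neg_neg]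
  have huw : u * w = z := by
    rw [← neg_eq_iff_eq_neg.mpr hzw, neg_mul, mul_assoc, hww, mul_neg_one, neg_neg]
  have huu : u * u = -1 := by
    nth_rw 2 [← hwz]
    rw [← mul_assoc, huw, hzz]
  have h1 : IsOrthoPair (s • (single i j 1 + single i k 1) : Matrix (Fin p) (Fin q) F)
      (s • (single i j u - single i k u)) := by
    constructor <;>
    simp [conjTranspose_single, hjk, hjk.symm, Matrix.add_mul, Matrix.mul_add, Matrix.sub_mul,
      Matrix.mul_sub, hu, huu]
    all_goals
      simp only [← smul_single, ← single_neg]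
      match_scalars <;>
        first | ring1 | linear_combination (2 * s) * hs | linear_combination -(2 * s) * hs
  have h2 : IsOrthoPair (s • (single i j 1 + single i k z) : Matrix (Fin p) (Fin q) F)
      (s • (single i j u + single i k w)) := by
    constructor <;>
    simp [conjTranspose_single, hjk, hjk.symm, Matrix.add_mul, Matrix.mul_add, Matrix.sub_mul,
      Matrix.mul_sub, hu, huu, hw, hz, hww, hzz, hwz, hzw, hwu, huz, hzu, huw]
    all_goals
      simp only [← smul_single, ← single_neg]
      match_scalars <;>
        first | ring1 | linear_combination (2 * s) * hs
  have h3 := S.add_mem (hS _ _ h1) (hS _ _ h2)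
  refine (congrArg (· ∈ S) ?_).mp (S.smul_mem (1 / 2 : ℝ) h3)
  simp [conjTranspose_single, hjk, hjk.symm, Matrix.add_mul, Matrix.mul_add, Matrix.sub_mul,
      Matrix.mul_sub, hu, huu, hw, hz, hww, hzz, hwz, hzw, hwu, huz, hzu, huw]
  simp only [← smul_single, ← single_neg]
  match_scalars <;> first | ring1 | linear_combination 2 * hs

end

/-- Skew-Hermitian matrices are spanned by the matrices `a E_jk - a* E_kj` with `j ≠ k` and
`(a - a*) E_jj`. -/
theorem mem_of_conjTranspose_eq_neg {S : Submodule ℝ (Matrix (Fin q) (Fin q) F)}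
    (hoff : ∀ j k : Fin q, j ≠ k → ∀ a : F, single j k a - single k j (star a) ∈ S)
    (hdiag : ∀ (j : Fin q) (a : F), single j j (a - star a) ∈ S)
    {b : Matrix (Fin q) (Fin q) F} (hb : bᴴ = -b) : b ∈ S := by
  have h1 : b = (1 / 2 : ℝ) • ∑ j, ∑ k, (single j k (b j k) - single k j (star (b j k))) := by
    have h2 : ∑ j, ∑ k, single k j (star (b j k)) = -b := by
      rw [← hb, Finset.sum_comm]
      exact (matrix_eq_sum_single bᴴ).symm
    simp only [Finset.sum_sub_distrib]
    rw [h2, ← matrix_eq_sum_single b, sub_neg_eq_add]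
    module
  rw [h1]
  refine S.smul_mem _ (S.sum_mem fun j _ => S.sum_mem fun k _ => ?_)
  rcases eq_or_ne j k with rfl | hjk
  · rw [sub_eq_add_neg, single_neg, ← single_add, ← sub_eq_add_neg]
    exact hdiag j _
  · exact hoff j k hjk _

end Spans

section SkewSpans

open Matrix

/-- The matrices `x* y - y* x`, for orthogonal pairs `(x, y)` of `p × q` matrices, span all
skew-Hermitian `q × q` matrices over `F`. -/
def OrthoPairsSpanSkew (F : Type*) [NormedRing F] [StarRing F] [NormedAlgebra ℝ F]
    [StarModule ℝ F] [FiniteDimensional ℝ F] (p q : ℕ) : Prop :=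
  ∀ b : Matrix (Fin q) (Fin q) F, bᴴ = -b →
    b ∈ Submodule.span ℝ {c | ∃ x y : Matrix (Fin p) (Fin q) F, IsOrthoPair x y ∧
      c = xᴴ * y - yᴴ * x}

theorem isRealPart_id : IsRealPart (LinearMap.id : ℝ →ₗ[ℝ] ℝ) where
  map_mul_comm := mul_comm
  map_star _ := rfl
  mul_star_self a := by simp [sq]
  map_star_mul_self a := by simp [sq]

instance Quaternion.instStarModuleReal : StarModule ℝ ℍ[ℝ] :=
  ⟨fun a b => by rw [Quaternion.star_smul]; rfl⟩

/-- The real part of a quaternion as a linear functional. -/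
def quaternionRe : ℍ[ℝ] →ₗ[ℝ] ℝ where
  toFun a := a.re
  map_add' _ _ := rfl
  map_smul' _ _ := rfl

theorem isRealPart_quaternionRe : IsRealPart quaternionRe where
  map_mul_comm a b := by
    change (a * b).re = (b * a).re
    simp only [Quaternion.re_mul]
    ring
  map_star a := Quaternion.re_star a
  mul_star_self a := by
    rw [Quaternion.self_mul_star, Quaternion.normSq_eq_norm_mul_self, ← sq,
      ← Algebra.algebraMap_eq_smul_one]
    rfl
  map_star_mul_self a := by
    rw [Quaternion.star_mul_self, Quaternion.normSq_eq_norm_mul_self, ← sq]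
    exact Quaternion.re_coe _

theorem orthoPairsSpanSkew_real {p q : ℕ} (hp : 0 < p) : OrthoPairsSpanSkew ℝ p q := by
  intro b hb
  refine mem_of_conjTranspose_eq_neg ?_ ?_ hb
  · intro j k hjk a
    exact single_sub_single_mem (p := p) isRealPart_id
      (fun x y h => Submodule.subset_span (Exists.intro x ⟨y, h, rfl⟩)) ⟨0, hp⟩ hjk a
  · intro j a
    simp

/-- The quaternion unit `i`. -/
def quaternionI : ℍ[ℝ] := ⟨0, 1, 0, 0⟩

/-- The quaternion unit `j`. -/
def quaternionJ : ℍ[ℝ] := ⟨0, 0, 1, 0⟩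

/-- The quaternion unit `k`. -/
def quaternionK : ℍ[ℝ] := ⟨0, 0, 0, 1⟩

@[simp] theorem quaternionI_re : quaternionI.re = 0 := rfl
@[simp] theorem quaternionI_imI : quaternionI.imI = 1 := rfl
@[simp] theorem quaternionI_imJ : quaternionI.imJ = 0 := rfl
@[simp] theorem quaternionI_imK : quaternionI.imK = 0 := rfl

@[simp] theorem quaternionJ_re : quaternionJ.re = 0 := rfl
@[simp] theorem quaternionJ_imI : quaternionJ.imI = 0 := rfl
@[simp] theorem quaternionJ_imJ : quaternionJ.imJ = 1 := rfl
@[simp] theorem quaternionJ_imK : quaternionJ.imK = 0 := rfl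

@[simp] theorem quaternionK_re : quaternionK.re = 0 := rfl
@[simp] theorem quaternionK_imI : quaternionK.imI = 0 := rfl
@[simp] theorem quaternionK_imJ : quaternionK.imJ = 0 := rfl
@[simp] theorem quaternionK_imK : quaternionK.imK = 1 := rfl

theorem orthoPairsSpanSkew_quaternion {p q : ℕ} (hp : 0 < p) (hq : 2 ≤ q) :
    OrthoPairsSpanSkew ℍ[ℝ] p q := by
  intro b hb
  refine mem_of_conjTranspose_eq_neg ?_ ?_ hb
  · intro j k hjk a
    exact single_sub_single_mem (p := p) isRealPart_quaternionRe
      (fun x y h => Submodule.subset_span (Exists.intro x ⟨y, h, rfl⟩)) ⟨0, hp⟩ hjk a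
  · intro j a
    set S := Submodule.span ℝ {c | ∃ x y : Matrix (Fin p) (Fin q) ℍ[ℝ], IsOrthoPair x y ∧
      c = xᴴ * y - yᴴ * x}
    obtain ⟨k, hjk⟩ : ∃ k : Fin q, j ≠ k := by
      have : Nontrivial (Fin q) := Fin.nontrivial_iff_two_le.mpr hq
      obtain ⟨k, hk⟩ := exists_ne j
      exact ⟨k, hk.symm⟩
    have hS : ∀ x y : Matrix (Fin p) (Fin q) ℍ[ℝ], IsOrthoPair x y → xᴴ * y - yᴴ * x ∈ S :=
      fun x y h => Submodule.subset_span ⟨x, y, h, rfl⟩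
    have h1 : single j j quaternionI ∈ S :=
      single_self_mem hS ⟨0, hp⟩ hjk (w := quaternionJ) (z := quaternionK)
        (by apply Quaternion.ext <;> simp) (by apply Quaternion.ext <;> simp)
        (by apply Quaternion.ext <;> simp) (by apply Quaternion.ext <;> simp)
        (by apply Quaternion.ext <;> simp) (by apply Quaternion.ext <;> simp)
    have h2 : single j j quaternionJ ∈ S :=
      single_self_mem hS ⟨0, hp⟩ hjk (w := quaternionK) (z := quaternionI)
        (by apply Quaternion.ext <;> simp) (by apply Quaternion.ext <;> simp)
        (by apply Quaternion.ext <;> simp) (by apply Quaternion.ext <;> simp)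
        (by apply Quaternion.ext <;> simp) (by apply Quaternion.ext <;> simp)
    have h3 : single j j quaternionK ∈ S :=
      single_self_mem hS ⟨0, hp⟩ hjk (w := quaternionI) (z := quaternionJ)
        (by apply Quaternion.ext <;> simp) (by apply Quaternion.ext <;> simp)
        (by apply Quaternion.ext <;> simp) (by apply Quaternion.ext <;> simp)
        (by apply Quaternion.ext <;> simp) (by apply Quaternion.ext <;> simp)
    refine (congrArg (· ∈ S) ?_).mp (S.add_mem (S.smul_mem (2 * a.imI) h1)
      (S.add_mem (S.smul_mem (2 * a.imJ) h2) (S.smul_mem (2 * a.imK) h3)))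
    rw [smul_single, smul_single, smul_single, ← single_add, ← single_add]
    congr 1
    apply Quaternion.ext <;> simp <;> ring

end SkewSpans

/-! ### The Lie algebra of skew-Hermitian left and right multiplications -/

section Skew
open Matrix
attribute [local instance] Matrix.normedAddCommGroup Matrix.normedSpace

variable {F : Type*} [NormedRing F] [StarRing F] [NormedAlgebra ℝ F] [StarModule ℝ F]
  [FiniteDimensional ℝ F]
variable {p q : ℕ} {re : F →ₗ[ℝ] ℝ} (hre : IsRealPart re)

/-- The maps `A ↦ a A + A b` with `a` and `b` skew-Hermitian: the isotropy representation of the matrix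
ball at its base point. -/
def skewMulMaps (F : Type*) [NormedRing F] [StarRing F] [NormedAlgebra ℝ F] [StarModule ℝ F]
    [FiniteDimensional ℝ F] (p q : ℕ) :
    Submodule ℝ (Module.End ℝ (Matrix (Fin p) (Fin q) F)) where
  carrier := {T | ∃ a b, aᴴ = -a ∧ bᴴ = -b ∧ T = mulLeftAddRight a b}
  zero_mem' := ⟨0, 0, by simp, by simp, by ext; simp⟩
  add_mem' := by
    rintro _ _ ⟨a, b, ha, hb, rfl⟩ ⟨c, d, hc, hd, rfl⟩
    refine ⟨a + c, b + d, by rw [conjTranspose_add, ha, hc, neg_add],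
      by rw [conjTranspose_add, hb, hd, neg_add], LinearMap.ext fun A => ?_⟩
    simp only [LinearMap.add_apply, mulLeftAddRight_apply, Matrix.add_mul, Matrix.mul_add]
    abel
  smul_mem' := by
    rintro t _ ⟨a, b, ha, hb, rfl⟩
    refine ⟨t • a, t • b, by rw [conjTranspose_smul, ha, star_trivial, smul_neg],
      by rw [conjTranspose_smul, hb, star_trivial, smul_neg], LinearMap.ext fun A => ?_⟩
    simp only [LinearMap.smul_apply, mulLeftAddRight_apply, Matrix.smul_mul, Matrix.mul_smul,
      smul_add]

theorem mulLeftAddRight_mem_skewMulMaps {a : Matrix (Fin p) (Fin p) F}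
    {b : Matrix (Fin q) (Fin q) F} (ha : aᴴ = -a) (hb : bᴴ = -b) :
    mulLeftAddRight a b ∈ skewMulMaps F p q := ⟨a, b, ha, hb, rfl⟩

/-- To contain all of `skewMulMaps` it suffices to contain the one-sided multiplications that come
from orthogonal pairs. -/
theorem skewMulMaps_le (h1 : OrthoPairsSpanSkew F p q) (h2 : OrthoPairsSpanSkew F q p)
    {S : Submodule ℝ (Module.End ℝ (Matrix (Fin p) (Fin q) F))}
    (hr : ∀ x y : Matrix (Fin p) (Fin q) F, IsOrthoPair x y →
      mulLeftAddRight 0 (xᴴ * y - yᴴ * x) ∈ S)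
    (hl : ∀ x y : Matrix (Fin q) (Fin p) F, IsOrthoPair x y →
      mulLeftAddRight (xᴴ * y - yᴴ * x) 0 ∈ S) : skewMulMaps F p q ≤ S := by
  rintro _ ⟨a, b, ha, hb, rfl⟩
  have hb' : mulLeftAddRight 0 b ∈ S := by
    refine Submodule.span_induction (p := fun b _ => mulLeftAddRight 0 b ∈ S) ?_ ?_ ?_ ?_ (h1 b hb)
    · rintro _ ⟨x, y, h, rfl⟩
      exact hr x y h
    · exact (congrArg (· ∈ S) (LinearMap.ext fun A => by simp)).mp S.zero_mem
    · intro c d _ _ hc hd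
      refine (congrArg (· ∈ S) (LinearMap.ext fun A => ?_)).mp (S.add_mem hc hd)
      simp [Matrix.mul_add]
    · intro t c _ hc
      refine (congrArg (· ∈ S) (LinearMap.ext fun A => ?_)).mp (S.smul_mem t hc)
      simp
  have ha' : mulLeftAddRight a 0 ∈ S := by
    refine Submodule.span_induction (p := fun b _ => mulLeftAddRight b 0 ∈ S) ?_ ?_ ?_ ?_ (h2 a ha)
    · rintro _ ⟨x, y, h, rfl⟩
      exact hl x y h
    · exact (congrArg (· ∈ S) (LinearMap.ext fun A => by simp)).mp S.zero_mem
    · intro c d _ _ hc hd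
      refine (congrArg (· ∈ S) (LinearMap.ext fun A => ?_)).mp (S.add_mem hc hd)
      simp [Matrix.add_mul]
    · intro t c _ hc
      refine (congrArg (· ∈ S) (LinearMap.ext fun A => ?_)).mp (S.smul_mem t hc)
      simp
  refine (congrArg (· ∈ S) (LinearMap.ext fun A => ?_)).mp (S.add_mem ha' hb')
  simp

include hre in
theorem skewMulMaps_le_span_holonomyAlgebra (h1 : OrthoPairsSpanSkew F p q)
    (h2 : OrthoPairsSpanSkew F q p) :
    skewMulMaps F p q ≤
      Submodule.span ℝ (holonomyAlgebra (matrixBall F p q) (matrixBallMetric re) 0) := by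
  refine skewMulMaps_le h1 h2 (fun x y h => ?_) fun x y h =>
    Submodule.subset_span (h.mulLeft_mem_holonomyAlgebra hre)
  refine (congrArg (· ∈ Submodule.span ℝ _) (LinearMap.ext fun A => ?_)).mp
    (Submodule.neg_mem _ (Submodule.subset_span (h.mulRight_mem_holonomyAlgebra hre)))
  simp [Matrix.mul_sub]

/-- Ternary derivations normalize `skewMulMaps`. With `R(x, y)` the map
`z ↦ (x y* - y x*) z + z (y* x - x* y)`, a derivation satisfies
`[D, R(x, y)] = R(D x, y) + R(x, D y)`; for an orthogonal pair one of the two terms of `R(x, y)`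
vanishes, so that these maps span. -/
theorem IsTernaryDerivation.comm_mem_skewMulMaps (h1 : OrthoPairsSpanSkew F p q)
    (h2 : OrthoPairsSpanSkew F q p) {D : Module.End ℝ (Matrix (Fin p) (Fin q) F)}
    (hD : IsTernaryDerivation re D) {T : Module.End ℝ (Matrix (Fin p) (Fin q) F)}
    (hT : T ∈ skewMulMaps F p q) : D * T - T * D ∈ skewMulMaps F p q := by
  have key : ∀ x y : Matrix (Fin p) (Fin q) F,
      (x * yᴴ - y * xᴴ)ᴴ = -(x * yᴴ - y * xᴴ) ∧ (yᴴ * x - xᴴ * y)ᴴ = -(yᴴ * x - xᴴ * y) :=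
    fun x y => by constructor <;> simp [conjTranspose_mul]
  have hR : ∀ x y : Matrix (Fin p) (Fin q) F,
      D * mulLeftAddRight (x * yᴴ - y * xᴴ) (yᴴ * x - xᴴ * y) -
      mulLeftAddRight (x * yᴴ - y * xᴴ) (yᴴ * x - xᴴ * y) * D ∈ skewMulMaps F p q := fun x y => by
    refine (congrArg (· ∈ skewMulMaps F p q) (LinearMap.ext fun z => ?_)).mp
      ((skewMulMaps F p q).add_mem
        (mulLeftAddRight_mem_skewMulMaps (key (D x) y).1 (key (D x) y).2)
        (mulLeftAddRight_mem_skewMulMaps (key x (D y)).1 (key x (D y)).2))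
    simp only [LinearMap.add_apply, LinearMap.sub_apply, Module.End.mul_apply,
      mulLeftAddRight_apply, Matrix.sub_mul, Matrix.mul_sub, map_add, map_sub, hD.leibniz,
      ← Matrix.mul_assoc]
    abel
  refine skewMulMaps_le h1 h2 (S := (skewMulMaps F p q).comap
    (LinearMap.mulLeft ℝ D - LinearMap.mulRight ℝ D)) (fun x y h => ?_) (fun x y h => ?_) hT
  · change D * _ - _ * D ∈ skewMulMaps F p q
    have := hR y x
    rwa [h.mul_conj, h.mul_conj', sub_zero] at this
  · change D * _ - _ * D ∈ skewMulMaps F p q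
    have := hR xᴴ yᴴ
    rwa [conjTranspose_conjTranspose, conjTranspose_conjTranspose, h.mul_conj, h.mul_conj',
      sub_zero] at this

end Skew

/-! ### Schur's lemma -/

section Schur

/-- An endomorphism commuting with an irreducible set of endomorphisms is a scalar. -/
theorem exists_eq_smul_one_of_commute {M : Type*} [AddCommGroup M] [Module ℂ M]
    [FiniteDimensional ℂ M] [Nontrivial M] {S : Set (Module.End ℂ M)}
    (hS : ∀ N : Submodule ℂ M, (∀ A ∈ S, ∀ v ∈ N, A v ∈ N) → N = ⊥ ∨ N = ⊤)
    {T : Module.End ℂ M} (hT : ∀ A ∈ S, ∀ v, T (A v) = A (T v)) : ∃ c : ℂ, T = c • 1 := by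
  obtain ⟨c, hc⟩ := Module.End.exists_eigenvalue T
  refine ⟨c, LinearMap.ext fun m => ?_⟩
  have hm : m ∈ Module.End.eigenspace T c := by
    rw [(hS (Module.End.eigenspace T c) fun A hA v hv => ?_).resolve_left hc]
    · exact Submodule.mem_top
    · rw [Module.End.mem_eigenspace_iff] at hv ⊢
      rw [hT A hA, hv, map_smul]
  exact Module.End.mem_eigenspace_iff.mp hm

theorem LieModule.IsIrreducible.eq_bot_or_eq_top_of_forall_mem {L M : Type*} [LieRing L]
    [LieAlgebra ℂ L] [AddCommGroup M] [Module ℂ M] [LieRingModule L M] [LieModule ℂ L M]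
    (hM : LieModule.IsIrreducible ℂ L M) (N : Submodule ℂ M)
    (hN : ∀ A ∈ (LieModule.toEnd ℂ L M).range, ∀ v ∈ N, A v ∈ N) : N = ⊥ ∨ N = ⊤ := by
  let N' : LieSubmodule ℂ L M := { N with lie_mem := fun {x m} hm => hN _ ⟨x, rfl⟩ m hm }
  exact (hM.eq_bot_or_eq_top N').imp (congrArg LieSubmodule.toSubmodule)
    (congrArg LieSubmodule.toSubmodule)

end Schur

/-! ### The trace form on skew operators -/

section TraceForm

variable {E : Type*} [AddCommGroup E] [Module ℝ E] [FiniteDimensional ℝ E]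
  {B : LinearMap.BilinForm ℝ E}

/-- The trace as a sum of diagonal entries in an orthonormal basis of the positive definite `B`. -/
theorem exists_basis_trace_eq_sum (hsymm : ∀ x y, B x y = B y x)
    (hpos : ∀ x, x ≠ 0 → 0 < B x x) :
    ∃ (n : ℕ) (b : Module.Basis (Fin n) ℝ E),
      ∀ T : Module.End ℝ E, LinearMap.trace ℝ E T = ∑ i, B (b i) (T (b i)) := by
  let core : InnerProductSpace.Core ℝ E :=
    { inner := fun x y => B x y
      conj_inner_symm := fun x y => hsymm y x
      re_inner_nonneg := fun x => by
        rcases eq_or_ne x 0 with rfl | hx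
        · simp
        · exact (hpos x hx).le
      add_left := fun x y z => by simp
      smul_left := fun x y r => by simp
      definite := fun x hx => by
        by_contra h
        exact (hpos x h).ne' hx }
  let : NormedAddCommGroup E := core.toNormedAddCommGroup
  let : InnerProductSpace ℝ E := InnerProductSpace.ofCore core.toCore
  refine ⟨_, (stdOrthonormalBasis ℝ E).toBasis, fun T => ?_⟩
  rw [LinearMap.trace_eq_sum_inner _ (stdOrthonormalBasis ℝ E)]
  simp only [OrthonormalBasis.coe_toBasis]
  rfl

theorem trace_mul_self_neg_of_skew (hsymm : ∀ x y, B x y = B y x) (hpos : ∀ x, x ≠ 0 → 0 < B x x)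
    {S : Module.End ℝ E} (hS : ∀ x y, B (S x) y = -B x (S y)) (hS0 : S ≠ 0) :
    LinearMap.trace ℝ E (S * S) < 0 := by
  obtain ⟨n, b, hb⟩ := exists_basis_trace_eq_sum hsymm hpos
  have h1 : ∀ i, B (b i) ((S * S) (b i)) = -B (S (b i)) (S (b i)) := fun i => by
    rw [hS, neg_neg, Module.End.mul_apply]
  rw [hb]
  simp only [h1]
  obtain ⟨i, hi⟩ : ∃ i, S (b i) ≠ 0 := by
    by_contra! h
    exact hS0 (b.ext fun i => by simpa using h i)
  refine Finset.sum_neg' (fun i _ => ?_) ⟨i, Finset.mem_univ i, ?_⟩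
  · rcases eq_or_ne (S (b i)) 0 with h0 | h0
    · simp [h0]
    · exact (neg_neg_of_pos (hpos _ h0)).le
  · exact neg_neg_of_pos (hpos _ hi)

theorem trace_eq_zero_of_skew (hsymm : ∀ x y, B x y = B y x) (hpos : ∀ x, x ≠ 0 → 0 < B x x)
    {S : Module.End ℝ E} (hS : ∀ x y, B (S x) y = -B x (S y)) : LinearMap.trace ℝ E S = 0 := by
  obtain ⟨n, b, hb⟩ := exists_basis_trace_eq_sum hsymm hpos
  rw [hb]
  refine Finset.sum_eq_zero fun i _ => ?_
  have h1 := hS (b i) (b i)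
  rw [hsymm] at h1
  linarith

/-- An operator `D` which normalizes a Lie algebra `k` of skew operators is an element of `k` plus an
operator commuting with `k`: split `D` along the trace form, which is negative definite on `k`. If
`b` is orthogonal to `k`, then `[b, S]` lies in `k` and is orthogonal to `k` by invariance of the
trace form. -/
theorem exists_mem_forall_commute (hsymm : ∀ x y, B x y = B y x)
    (hpos : ∀ x, x ≠ 0 → 0 < B x x) {k : Submodule ℝ (Module.End ℝ E)}
    (hk : ∀ S ∈ k, ∀ x y, B (S x) y = -B x (S y))
    (hlie : ∀ S ∈ k, ∀ T ∈ k, S * T - T * S ∈ k)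
    {D : Module.End ℝ E} (hnorm : ∀ S ∈ k, D * S - S * D ∈ k) :
    ∃ K ∈ k, ∀ S ∈ k, (D - K) * S = S * (D - K) := by
  let β : LinearMap.BilinForm ℝ (Module.End ℝ E) :=
    (LinearMap.mul ℝ (Module.End ℝ E)).compr₂ (LinearMap.trace ℝ E)
  have hβ : ∀ S T, β S T = LinearMap.trace ℝ E (S * T) := fun S T => rfl
  have hβsymm : ∀ S T, β S T = β T S := fun S T => LinearMap.trace_mul_comm ℝ S T
  have hneg : ∀ S ∈ k, (∀ T ∈ k, β T S = 0) → S = 0 := fun S hS h => by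
    by_contra h0
    exact (trace_mul_self_neg_of_skew hsymm hpos (hk S hS) h0).ne (h S hS)
  have hcompl : IsCompl k (β.orthogonal k) := by
    refine LinearMap.BilinForm.isCompl_orthogonal_of_restrict_nondegenerate
      (fun S T h => (hβsymm T S).trans h) ⟨?_, ?_⟩
    · intro S h
      exact Subtype.ext (hneg S S.2 fun T hT => (hβsymm _ _).trans (h ⟨T, hT⟩))
    · intro S h
      exact Subtype.ext (hneg S S.2 fun T hT => h ⟨T, hT⟩)
  obtain ⟨K, hK, b, hb, hKb⟩ := Submodule.mem_sup.mp
    (hcompl.sup_eq_top ▸ Submodule.mem_top : D ∈ k ⊔ β.orthogonal k)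
  refine ⟨K, hK, fun S hS => ?_⟩
  have hDb : D - K = b := by rw [← hKb]; abel
  rw [hDb]
  have hmem : b * S - S * b ∈ k := by
    have := k.sub_mem (hnorm S hS) (hlie K hK S hS)
    rw [← hDb]
    convert this using 1
    noncomm_ring
  refine sub_eq_zero.mp (hneg _ hmem fun T hT => ?_)
  have h2 : β (T * S - S * T) b = 0 := hb _ (hlie T hT S hS)
  rw [hβ] at h2 ⊢
  simp only [mul_sub, sub_mul, map_sub] at h2 ⊢
  rw [sub_eq_zero] at h2 ⊢
  rw [← mul_assoc T b S, LinearMap.trace_mul_comm, ← mul_assoc, ← h2, mul_assoc]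

end TraceForm

/-! ### The holonomy algebra of the matrix ball and its complexification -/

section Complexification

open Matrix
attribute [local instance] Matrix.normedAddCommGroup Matrix.normedSpace

variable {F : Type*} [NormedRing F] [StarRing F] [NormedAlgebra ℝ F] [StarModule ℝ F]
  [FiniteDimensional ℝ F]
variable {p q : ℕ} {re : F →ₗ[ℝ] ℝ} (hre : IsRealPart re)

/-- The inner product `Re tr (A B*)` on matrices, the metric of the ball at its base point. -/
noncomputable def traceBilinForm (re : F →ₗ[ℝ] ℝ) (p q : ℕ) :
    LinearMap.BilinForm ℝ (Matrix (Fin p) (Fin q) F) :=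
  LinearMap.mk₂ ℝ (fun A B => reTrace re p (A * Bᴴ))
    (fun A A' B => by rw [Matrix.add_mul, reTrace_add])
    (fun c A B => by simp [reTrace_apply, Matrix.smul_mul])
    (fun A B B' => by rw [conjTranspose_add, Matrix.mul_add, reTrace_add])
    (fun c A B => by simp [reTrace_apply, Matrix.mul_smul])

theorem traceBilinForm_apply (A B : Matrix (Fin p) (Fin q) F) :
    traceBilinForm re p q A B = reTrace re p (A * Bᴴ) := rfl

include hre in
theorem traceBilinForm_symm (A B : Matrix (Fin p) (Fin q) F) :
    traceBilinForm re p q A B = traceBilinForm re p q B A := by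
  rw [traceBilinForm_apply, traceBilinForm_apply, ← reTrace_conjTranspose hre, conjTranspose_mul,
    conjTranspose_conjTranspose]

include hre in
theorem traceBilinForm_self_pos (A : Matrix (Fin p) (Fin q) F) (hA : A ≠ 0) :
    0 < traceBilinForm re p q A A := by
  have h0 : 0 ≤ traceBilinForm re p q A A := by
    rw [traceBilinForm_apply, reTrace_mul_comm hre, reTrace_apply,
      hre.trace_conjTranspose_mul_self]
    positivity
  refine lt_of_le_of_ne h0 fun h => hA ?_
  rw [traceBilinForm_apply, reTrace_mul_comm hre, reTrace_apply, hre.trace_conjTranspose_mul_self]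
    at h
  have h3 := h.symm
  ext i j
  rw [Finset.sum_eq_zero_iff_of_nonneg (fun j _ => by positivity)] at h3
  have h5 := h3 j (Finset.mem_univ j)
  rw [Finset.sum_eq_zero_iff_of_nonneg (fun j _ => by positivity)] at h5
  simpa using h5 i (Finset.mem_univ i)

include hre in
theorem traceBilinForm_skew_of_mem_skewMulMaps {S : Module.End ℝ (Matrix (Fin p) (Fin q) F)}
    (hS : S ∈ skewMulMaps F p q) (A B : Matrix (Fin p) (Fin q) F) :
    traceBilinForm re p q (S A) B = -traceBilinForm re p q A (S B) := by
  obtain ⟨a, b, ha, hb, rfl⟩ := hS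
  simp only [traceBilinForm_apply, mulLeftAddRight_apply, conjTranspose_add, conjTranspose_mul,
    ha, hb, Matrix.add_mul, Matrix.mul_add, reTrace_add, Matrix.mul_neg, Matrix.neg_mul]
  rw [Matrix.mul_assoc a, reTrace_mul_comm hre a, ← Matrix.mul_assoc A Bᴴ a, Matrix.mul_assoc A b]
  simp only [reTrace_apply, trace_neg, map_neg]
  ring

theorem skewMulMaps_comm_mem {S T : Module.End ℝ (Matrix (Fin p) (Fin q) F)}
    (hS : S ∈ skewMulMaps F p q) (hT : T ∈ skewMulMaps F p q) :
    S * T - T * S ∈ skewMulMaps F p q := by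
  obtain ⟨a, b, ha, hb, rfl⟩ := hS
  obtain ⟨c, d, hc, hd, rfl⟩ := hT
  refine ⟨a * c - c * a, d * b - b * d, ?_, ?_, LinearMap.ext fun A => ?_⟩
  · simp [conjTranspose_mul, ha, hc]
  · simp [conjTranspose_mul, hb, hd]
  · simp only [LinearMap.sub_apply, Module.End.mul_apply, mulLeftAddRight_apply, Matrix.mul_add,
      Matrix.add_mul, Matrix.sub_mul, Matrix.mul_sub, Matrix.mul_assoc]
    abel

include hre in
/-- The holonomy algebra lies in `skewMulMaps`, provided that the complexification of `skewMulMaps`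
acts irreducibly: a holonomy element minus its `skewMulMaps` component is skew and commutes with
`skewMulMaps`, hence is a scalar of trace zero. -/
theorem holonomyAlgebra_subset_skewMulMaps (h1 : OrthoPairsSpanSkew F p q)
    (h2 : OrthoPairsSpanSkew F q p)
    {V : Type*} [AddCommGroup V] [Module ℂ V] {g : LieSubalgebra ℂ (Module.End ℂ V)}
    (hirr : LieModule.IsIrreducible ℂ g V) (e : (ℂ ⊗[ℝ] Matrix (Fin p) (Fin q) F) ≃ₗ[ℂ] V)
    (hg : g.toSubmodule =
      (Submodule.span ℂ ((fun A : Module.End ℝ (Matrix (Fin p) (Fin q) F) => A.baseChange ℂ) ''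
        (skewMulMaps F p q : Set (Module.End ℝ (Matrix (Fin p) (Fin q) F))))).map
        (e.conj : Module.End ℂ (ℂ ⊗[ℝ] Matrix (Fin p) (Fin q) F) →ₗ[ℂ] Module.End ℂ V)) :
    holonomyAlgebra (matrixBall F p q) (matrixBallMetric re) 0 ⊆
      (skewMulMaps F p q : Set (Module.End ℝ (Matrix (Fin p) (Fin q) F))) := by
  intro D hD
  have hT := isTernaryDerivation_of_mem_holonomyAlgebra hre hD
  have hpos : ∀ A : Matrix (Fin p) (Fin q) F, A ≠ 0 → 0 < traceBilinForm re p q A A :=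
    traceBilinForm_self_pos hre
  obtain ⟨K, hK, hcomm⟩ := exists_mem_forall_commute (D := D) (traceBilinForm_symm hre) hpos
    (fun S hS => traceBilinForm_skew_of_mem_skewMulMaps hre hS)
    (fun S hS T hT => skewMulMaps_comm_mem hS hT)
    (fun S hS => hT.comm_mem_skewMulMaps h1 h2 hS)
  have : FiniteDimensional ℂ V := Module.Finite.equiv e
  have : Nontrivial V := (LieSubmodule.nontrivial_iff ℂ g V).mp hirr.toNontrivial
  set b := D - K with hb
  have hbskew : ∀ A B, traceBilinForm re p q (b A) B = -traceBilinForm re p q A (b B) := by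
    intro A B
    have h3 := traceBilinForm_skew_of_mem_skewMulMaps hre hK A B
    have h4 := hT.skew A B
    rw [hb, LinearMap.sub_apply, LinearMap.sub_apply, map_sub, map_sub, LinearMap.sub_apply, h3]
    simp only [traceBilinForm_apply] at *
    linarith
  have htr : LinearMap.trace ℝ _ b = 0 :=
    trace_eq_zero_of_skew (traceBilinForm_symm hre) hpos hbskew
  obtain ⟨c, hc⟩ := exists_eq_smul_one_of_commute (T := e.conj (b.baseChange ℂ))
    hirr.eq_bot_or_eq_top_of_forall_mem (fun x ⟨x', hx'⟩ v => by
    have hx : (x' : Module.End ℂ V) ∈ g.toSubmodule := x'.2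
    rw [hg] at hx
    have hxx : (x' : Module.End ℂ V) = x := hx'
    rw [hxx] at hx
    obtain ⟨y, hy, hyx⟩ := hx
    rw [← hyx]
    have hcy : b.baseChange ℂ * y = y * b.baseChange ℂ := by
      refine Submodule.span_induction (p := fun y _ => b.baseChange ℂ * y = y * b.baseChange ℂ)
        ?_ (by simp) ?_ ?_ hy
      · rintro _ ⟨S, hS, rfl⟩
        have := congrArg (LinearMap.baseChange ℂ) (hcomm S hS)
        simpa only [LinearMap.baseChange_mul] using this
      · intro y z _ _ hy hz
        rw [mul_add, add_mul, hy, hz]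
      · intro t y _ hy
        rw [mul_smul_comm, smul_mul_assoc, hy]
    have := LinearMap.congr_fun hcy (e.symm v)
    simp only [Module.End.mul_apply] at this
    simp [LinearEquiv.conj_apply, this])
  have hc0 : c = 0 := by
    have h3 := congrArg (LinearMap.trace ℂ V) hc
    rw [LinearMap.trace_conj', LinearMap.trace_baseChange, htr, map_zero, map_smul,
      LinearMap.trace_one, smul_eq_mul] at h3
    have h4 : (Module.finrank ℂ V : ℂ) ≠ 0 := by exact_mod_cast Module.finrank_pos.ne'
    exact (mul_eq_zero.mp h3.symm).resolve_right h4
  have hb0 : b = 0 := by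
    rw [hc0, zero_smul] at hc
    have hc' : b.baseChange ℂ = 0 := e.conj.injective (by rw [hc, map_zero])
    ext1 A
    refine Module.FaithfullyFlat.tensorProduct_mk_injective (A := ℝ) (B := ℂ) _ ?_
    have := LinearMap.congr_fun hc' ((1 : ℂ) ⊗ₜ A)
    simpa using this
  rw [sub_eq_zero.mp (hb.symm.trans hb0)]
  exact hK

include hre in
/-- The complexification of `skewMulMaps`, if irreducible, is that of the holonomy algebra. -/
theorem isComplexificationOf_holonomyAlgebra (h1 : OrthoPairsSpanSkew F p q)
    (h2 : OrthoPairsSpanSkew F q p)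
    {V : Type*} [AddCommGroup V] [Module ℂ V] {g : LieSubalgebra ℂ (Module.End ℂ V)}
    (hirr : LieModule.IsIrreducible ℂ g V) (e : (ℂ ⊗[ℝ] Matrix (Fin p) (Fin q) F) ≃ₗ[ℂ] V)
    (hg : g.toSubmodule =
      (Submodule.span ℂ ((fun A : Module.End ℝ (Matrix (Fin p) (Fin q) F) => A.baseChange ℂ) ''
        (skewMulMaps F p q : Set (Module.End ℝ (Matrix (Fin p) (Fin q) F))))).map
        (e.conj : Module.End ℂ (ℂ ⊗[ℝ] Matrix (Fin p) (Fin q) F) →ₗ[ℂ] Module.End ℂ V)) :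
    IsComplexificationOf g (holonomyAlgebra (matrixBall F p q) (matrixBallMetric re) 0) := by
  refine ⟨e, hg.trans (congrArg (Submodule.map _) (le_antisymm (Submodule.span_le.mpr ?_)
    (Submodule.span_mono (Set.image_mono
      (holonomyAlgebra_subset_skewMulMaps hre h1 h2 hirr e hg)))))⟩
  rintro _ ⟨S, hS, rfl⟩
  refine Submodule.span_induction (p := fun S _ => S.baseChange ℂ ∈ Submodule.span ℂ
    ((fun A : Module.End ℝ (Matrix (Fin p) (Fin q) F) => A.baseChange ℂ) '' _)) ?_ ?_ ?_ ?_
    (skewMulMaps_le_span_holonomyAlgebra hre h1 h2 hS)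
  · exact fun A hA => Submodule.subset_span ⟨A, hA, rfl⟩
  · rw [LinearMap.baseChange_zero]
    exact Submodule.zero_mem _
  · intro A B _ _ hA hB
    rw [LinearMap.baseChange_add]
    exact Submodule.add_mem _ hA hB
  · intro t A _ hA
    rw [LinearMap.baseChange_smul, ← algebraMap_smul ℂ t]
    exact Submodule.smul_mem _ _ hA

end Complexification

/-! ### Tensor products as matrices, and compact forms -/

section TensorMatrix

open Matrix

variable {ι κ : Type*} [Fintype ι] [DecidableEq ι] [Fintype κ] [DecidableEq κ]

/-- The linear map from a tensor product of coordinate spaces to matrices with `u ⊗ v ↦ u vᵀ`. -/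
noncomputable def vecMulVecLift (ι κ : Type*) [Fintype ι] [DecidableEq ι] [Fintype κ]
    [DecidableEq κ] : (ι → ℂ) ⊗[ℂ] (κ → ℂ) →ₗ[ℂ] Matrix ι κ ℂ :=
  TensorProduct.lift (vecMulVecBilin ℂ ℂ)

theorem vecMulVecLift_tmul (u : ι → ℂ) (v : κ → ℂ) :
    vecMulVecLift ι κ (u ⊗ₜ v) = vecMulVec u v := rfl

theorem vecMulVecLift_bijective : Function.Bijective (vecMulVecLift ι κ) := by
  have hsurj : Function.Surjective (vecMulVecLift ι κ) := by
    intro M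
    refine ⟨∑ i, ∑ j, M i j • (Pi.single i 1 ⊗ₜ Pi.single j 1), ?_⟩
    simp only [map_sum, map_smul, vecMulVecLift_tmul, ← single_eq_single_vecMulVec_single,
      smul_single, smul_eq_mul, mul_one]
    exact (matrix_eq_sum_single M).symm
  refine ⟨(LinearMap.injective_iff_surjective_of_finrank_eq_finrank ?_).mpr hsurj, hsurj⟩
  simp [Module.finrank_tensorProduct, Module.finrank_matrix]

/-- The identification of a tensor product of coordinate spaces with matrices, `u ⊗ v ↦ u vᵀ`. -/
noncomputable def tensorMatrixEquiv (ι κ : Type*) [Fintype ι] [DecidableEq ι] [Fintype κ]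
    [DecidableEq κ] : (ι → ℂ) ⊗[ℂ] (κ → ℂ) ≃ₗ[ℂ] Matrix ι κ ℂ :=
  LinearEquiv.ofBijective (vecMulVecLift ι κ) vecMulVecLift_bijective

theorem tensorMatrixEquiv_tmul (u : ι → ℂ) (v : κ → ℂ) :
    tensorMatrixEquiv ι κ (u ⊗ₜ v) = vecMulVec u v := rfl

/-- On matrices, `A ⊗ 1 + 1 ⊗ B` acts by `M ↦ A M + M Bᵀ`. -/
theorem tensorMatrixEquiv_rTensor_add_lTensor (A : Matrix ι ι ℂ) (B : Matrix κ κ ℂ)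
    (t : (ι → ℂ) ⊗[ℂ] (κ → ℂ)) :
    tensorMatrixEquiv ι κ ((LinearMap.rTensor (κ → ℂ) (Matrix.toLin' A) +
      LinearMap.lTensor (ι → ℂ) (Matrix.toLin' B)) t) =
      A * tensorMatrixEquiv ι κ t + tensorMatrixEquiv ι κ t * Bᵀ := by
  induction t with
  | zero => simp
  | tmul u v =>
    simp only [LinearMap.add_apply, LinearMap.rTensor_tmul, LinearMap.lTensor_tmul, map_add,
      tensorMatrixEquiv_tmul, toLin'_apply, mul_vecMulVec, vecMulVec_mul, vecMul_transpose]
  | add x y hx hy =>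
    rw [map_add, map_add, hx, hy, map_add, Matrix.mul_add, Matrix.add_mul]
    abel

variable {F : Type*} [NormedRing F] [StarRing F] [NormedAlgebra ℝ F] [StarModule ℝ F]
  [FiniteDimensional ℝ F] {p q : ℕ}

/-- The map `ψ` sends skew-Hermitian matrices over `F` into the complex matrix Lie algebra `L` and
reaches all skew-Hermitian elements of `L`. Moreover `L` is stable under adjoints, so that its
skew-Hermitian elements span it over `ℂ`, and under transposition. Linearity and injectivity of `ψ`
are not part of this. -/
structure IsCompactForm (ψ : Matrix (Fin p) (Fin p) F → Matrix ι ι ℂ)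
    (L : LieSubalgebra ℂ (Matrix ι ι ℂ)) : Prop where
  mem : ∀ a, aᴴ = -a → ψ a ∈ L
  exists_eq : ∀ Y ∈ L, Yᴴ = -Y → ∃ a, aᴴ = -a ∧ ψ a = Y
  conjTranspose_mem : ∀ Y ∈ L, Yᴴ ∈ L
  transpose_mem : ∀ Y ∈ L, Yᵀ ∈ L

/-- Split `Y` into `(Y - Y*) / 2` and `(Y + Y*) / 2`, the latter being `i` times a skew-Hermitian
element. -/
theorem IsCompactForm.exists_eq_add {ψ : Matrix (Fin p) (Fin p) F → Matrix ι ι ℂ}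
    {L : LieSubalgebra ℂ (Matrix ι ι ℂ)} (h : IsCompactForm ψ L) {Y : Matrix ι ι ℂ} (hY : Y ∈ L) :
    ∃ a b, aᴴ = -a ∧ bᴴ = -b ∧ Y = ψ a + Complex.I • ψ b := by
  have hYH := h.conjTranspose_mem Y hY
  obtain ⟨a, ha, ha'⟩ := h.exists_eq ((1 / 2 : ℂ) • (Y - Yᴴ)) (L.smul_mem _ (L.sub_mem hY hYH))
    (by rw [conjTranspose_smul, conjTranspose_sub, conjTranspose_conjTranspose, ← smul_neg, neg_sub]
        simp)
  obtain ⟨b, hb, hb'⟩ := h.exists_eq ((-Complex.I / 2 : ℂ) • (Y + Yᴴ))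
    (L.smul_mem _ (L.add_mem hY hYH))
    (by rw [conjTranspose_smul, conjTranspose_add, conjTranspose_conjTranspose, add_comm Yᴴ,
          ← neg_smul]
        congr 1
        simp [neg_div])
  refine ⟨a, b, ha, hb, ?_⟩
  rw [ha', hb', smul_smul, show Complex.I * (-Complex.I / 2) = 1 / 2 by
    rw [mul_div_assoc', mul_neg, Complex.I_mul_I, neg_neg]]
  module

/-- If `ψ` exhibits the complex matrices as the complexification of the matrices over `F`,
compatibly with multiplication by square matrices from both sides, then the complexification of
`skewMulMaps` is `L₁ ⊕ L₂` acting on the tensor product, where `L₁` and `L₂` are the complexified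
algebras of skew-Hermitian matrices. -/
theorem exists_equiv_tensorSum_eq_map_span
    (ψ : Matrix (Fin p) (Fin q) F →ₗ[ℝ] Matrix ι κ ℂ)
    (ψ₁ : Matrix (Fin p) (Fin p) F → Matrix ι ι ℂ) (ψ₂ : Matrix (Fin q) (Fin q) F → Matrix κ κ ℂ)
    (hψ₁ : ∀ a A, ψ (a * A) = ψ₁ a * ψ A) (hψ₂ : ∀ A b, ψ (A * b) = ψ A * ψ₂ b)
    (hψ : ∀ M, ∃ A B, M = ψ A + Complex.I • ψ B)
    (hdim : Module.finrank ℝ (Matrix (Fin p) (Fin q) F) = Fintype.card ι * Fintype.card κ)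
    {L₁ : LieSubalgebra ℂ (Matrix ι ι ℂ)} {L₂ : LieSubalgebra ℂ (Matrix κ κ ℂ)}
    (h₁ : IsCompactForm ψ₁ L₁) (h₂ : IsCompactForm ψ₂ L₂) :
    ∃ e : (ℂ ⊗[ℝ] Matrix (Fin p) (Fin q) F) ≃ₗ[ℂ] (ι → ℂ) ⊗[ℂ] (κ → ℂ),
      (tensorSum (L₁.map ((lieEquivMatrix' (R := ℂ) (n := ι)).symm :
          Matrix ι ι ℂ →ₗ⁅ℂ⁆ Module.End ℂ (ι → ℂ)))
        (L₂.map ((lieEquivMatrix' (R := ℂ) (n := κ)).symm :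
          Matrix κ κ ℂ →ₗ⁅ℂ⁆ Module.End ℂ (κ → ℂ)))).toSubmodule =
      (Submodule.span ℂ ((fun A : Module.End ℝ (Matrix (Fin p) (Fin q) F) => A.baseChange ℂ) ''
        (skewMulMaps F p q : Set (Module.End ℝ (Matrix (Fin p) (Fin q) F))))).map
        (e.conj : Module.End ℂ (ℂ ⊗[ℝ] Matrix (Fin p) (Fin q) F) →ₗ[ℂ]
          Module.End ℂ ((ι → ℂ) ⊗[ℂ] (κ → ℂ))) := by
  let ψC := ψ.liftBaseChange ℂ
  have hψC : ∀ c A, ψC (c ⊗ₜ A) = c • ψ A := fun c A => LinearMap.liftBaseChange_tmul _ _ _ _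
  have hsurj : Function.Surjective ψC := fun M => by
    obtain ⟨A, B, rfl⟩ := hψ M
    exact ⟨1 ⊗ₜ A + Complex.I ⊗ₜ B, by rw [map_add, hψC, hψC, one_smul]⟩
  have hbij : Function.Bijective ψC := by
    refine ⟨(LinearMap.injective_iff_surjective_of_finrank_eq_finrank ?_).mpr hsurj, hsurj⟩
    rw [Module.finrank_baseChange, hdim, Module.finrank_matrix, Module.finrank_self, mul_one]
  let e := (LinearEquiv.ofBijective ψC hbij).trans (tensorMatrixEquiv ι κ).symm
  have he : ∀ x, tensorMatrixEquiv ι κ (e x) = ψC x := fun x => by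
    simp [e]
  have hconj : ∀ a b, e.conj ((mulLeftAddRight a b).baseChange ℂ) =
      LinearMap.rTensor (κ → ℂ) (Matrix.toLin' (ψ₁ a)) +
        LinearMap.lTensor (ι → ℂ) (Matrix.toLin' (ψ₂ b)ᵀ) := fun a b => by
    refine LinearMap.ext fun t => (tensorMatrixEquiv ι κ).injective ?_
    obtain ⟨s, rfl⟩ := e.surjective t
    rw [tensorMatrixEquiv_rTensor_add_lTensor, LinearEquiv.conj_apply, LinearMap.comp_apply,
      LinearMap.comp_apply, LinearEquiv.coe_coe, LinearEquiv.coe_coe, e.symm_apply_apply, he, he,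
      transpose_transpose]
    induction s with
    | zero => simp
    | tmul c A =>
      rw [LinearMap.baseChange_tmul, hψC, hψC, mulLeftAddRight_apply, map_add, hψ₁, hψ₂,
        Matrix.mul_smul, Matrix.smul_mul, smul_add]
    | add x y hx hy =>
      rw [map_add, map_add, hx, hy, map_add, Matrix.mul_add, Matrix.add_mul]
      abel
  refine ⟨e, le_antisymm ?_ ?_⟩
  · set S := (Submodule.span ℂ ((fun A : Module.End ℝ (Matrix (Fin p) (Fin q) F) =>
        A.baseChange ℂ) ''
        (skewMulMaps F p q : Set (Module.End ℝ (Matrix (Fin p) (Fin q) F))))).map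
        (e.conj : Module.End ℂ (ℂ ⊗[ℝ] Matrix (Fin p) (Fin q) F) →ₗ[ℂ]
          Module.End ℂ ((ι → ℂ) ⊗[ℂ] (κ → ℂ)))
    have hS : ∀ a b, aᴴ = -a → bᴴ = -b →
        LinearMap.rTensor (κ → ℂ) (Matrix.toLin' (ψ₁ a)) +
        LinearMap.lTensor (ι → ℂ) (Matrix.toLin' (ψ₂ b)ᵀ) ∈ S := fun a b ha hb => by
      rw [← hconj]
      exact Submodule.mem_map_of_mem (Submodule.subset_span
        ⟨_, mulLeftAddRight_mem_skewMulMaps ha hb, rfl⟩)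
    rintro _ ⟨_, ⟨A, hA, rfl⟩, _, ⟨B, hB, rfl⟩, rfl⟩
    obtain ⟨a, a', ha, ha', rfl⟩ := h₁.exists_eq_add hA
    obtain ⟨b, b', hb, hb', hBeq⟩ := h₂.exists_eq_add (h₂.transpose_mem B hB)
    have hB' : B = (ψ₂ b)ᵀ + Complex.I • (ψ₂ b')ᵀ := by
      rw [← transpose_smul, ← transpose_add, ← hBeq, transpose_transpose]
    rw [hB']
    refine (congrArg (· ∈ S) ?_).mp (S.add_mem (hS a b ha hb)
      (S.smul_mem Complex.I (hS a' b' ha' hb')))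
    change _ = LinearMap.rTensor (κ → ℂ) (Matrix.toLin' (ψ₁ a + Complex.I • ψ₁ a')) +
      LinearMap.lTensor (ι → ℂ) (Matrix.toLin' ((ψ₂ b)ᵀ + Complex.I • (ψ₂ b')ᵀ))
    rw [map_add, map_add, map_smul, map_smul, LinearMap.rTensor_add, LinearMap.lTensor_add,
      LinearMap.rTensor_smul, LinearMap.lTensor_smul]
    module
  · rw [Submodule.map_le_iff_le_comap, Submodule.span_le]
    rintro _ ⟨_, ⟨a, b, ha, hb, rfl⟩, rfl⟩
    change e.conj ((mulLeftAddRight a b).baseChange ℂ) ∈ tensorSum _ _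
    rw [hconj]
    exact ⟨_, ⟨_, h₁.mem a ha, rfl⟩, _, ⟨_, h₂.transpose_mem _ (h₂.mem b hb), rfl⟩, rfl⟩

end TensorMatrix

/-! ### The real and quaternionic compact forms -/

section RealForms

open Matrix

theorem isCompactForm_so (n : ℕ) :
    IsCompactForm (fun a : Matrix (Fin n) (Fin n) ℝ => a.map ((↑) : ℝ → ℂ))
      (LieAlgebra.Orthogonal.so (Fin n) ℂ) where
  mem a ha := by
    rw [LieAlgebra.Orthogonal.mem_so]
    ext i j
    have := congrFun (congrFun ha i) j
    simp only [conjTranspose_apply, star_trivial, Matrix.neg_apply] at this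
    simp [this]
  exists_eq Y hY hYH := by
    rw [LieAlgebra.Orthogonal.mem_so] at hY
    have hreal : ∀ i j, ((Y i j).re : ℂ) = Y i j := fun i j => by
      have h1 := congrFun (congrFun hY j) i
      have h2 := congrFun (congrFun hYH j) i
      simp only [conjTranspose_apply, transpose_apply, Matrix.neg_apply] at h1 h2
      exact Complex.conj_eq_iff_re.mp (h2.trans h1.symm)
    refine ⟨Y.map Complex.re, ?_, ?_⟩
    · ext i j
      have h1 := congrFun (congrFun hY i) j
      simp only [transpose_apply, Matrix.neg_apply] at h1
      simp [h1]
    · ext i j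
      exact hreal i j
  conjTranspose_mem Y hY := by
    rw [LieAlgebra.Orthogonal.mem_so] at hY ⊢
    ext i j
    have h1 := congrFun (congrFun hY i) j
    simp only [transpose_apply, Matrix.neg_apply] at h1
    simp [h1]
  transpose_mem Y hY := by
    rw [LieAlgebra.Orthogonal.mem_so] at hY ⊢
    rw [hY, transpose_neg, hY]

/-- The complex number `z` in the decomposition `a = z + w j` of a quaternion. -/
def quaternionFst (a : ℍ[ℝ]) : ℂ := ⟨a.re, a.imI⟩

/-- The complex number `w` in the decomposition `a = z + w j` of a quaternion. -/
def quaternionSnd (a : ℍ[ℝ]) : ℂ := ⟨a.imJ, a.imK⟩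

/-- The complex `2p × 2q` matrix of a quaternionic `p × q` matrix `Z + W j`, with blocks `Z`, `W` in the
first row and `-W̄`, `Z̄` in the second. -/
def quaternionBlocks {p q : ℕ} :
    Matrix (Fin p) (Fin q) ℍ[ℝ] →ₗ[ℝ] Matrix (Fin p ⊕ Fin p) (Fin q ⊕ Fin q) ℂ where
  toFun A := fromBlocks (A.map quaternionFst) (A.map quaternionSnd)
    (-(A.map fun a => star (quaternionSnd a))) (A.map fun a => star (quaternionFst a))
  map_add' A B := by
    ext (i | i) (j | j) <;> apply Complex.ext <;>
      simp [quaternionFst, quaternionSnd, add_comm]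
  map_smul' c A := by
    ext (i | i) (j | j) <;> apply Complex.ext <;>
      simp [quaternionFst, quaternionSnd]

theorem quaternionBlocks_apply {p q : ℕ} (A : Matrix (Fin p) (Fin q) ℍ[ℝ]) :
    quaternionBlocks A = fromBlocks (A.map quaternionFst) (A.map quaternionSnd)
    (-(A.map fun a => star (quaternionSnd a))) (A.map fun a => star (quaternionFst a)) := rfl

theorem quaternionBlocks_mul {p q r : ℕ} (A : Matrix (Fin p) (Fin q) ℍ[ℝ])
    (B : Matrix (Fin q) (Fin r) ℍ[ℝ]) :
    quaternionBlocks (A * B) = quaternionBlocks A * quaternionBlocks B := by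
  have hf : ∀ (s : Finset (Fin q)) (f : Fin q → ℍ[ℝ]),
      quaternionFst (∑ i ∈ s, f i) = ∑ i ∈ s, quaternionFst (f i) := fun s f =>
    map_sum (AddMonoidHom.mk' quaternionFst fun a b => rfl) f s
  have hs : ∀ (s : Finset (Fin q)) (f : Fin q → ℍ[ℝ]),
      quaternionSnd (∑ i ∈ s, f i) = ∑ i ∈ s, quaternionSnd (f i) := fun s f =>
    map_sum (AddMonoidHom.mk' quaternionSnd fun a b => rfl) f s
  have hfm : ∀ a b : ℍ[ℝ], quaternionFst (a * b) =
      quaternionFst a * quaternionFst b - quaternionSnd a * star (quaternionSnd b) := fun a b => by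
    apply Complex.ext <;> simp [quaternionFst, quaternionSnd] <;> ring
  have hsm : ∀ a b : ℍ[ℝ], quaternionSnd (a * b) =
      quaternionFst a * quaternionSnd b + quaternionSnd a * star (quaternionFst b) := fun a b => by
    apply Complex.ext <;> simp [quaternionFst, quaternionSnd] <;> ring
  simp only [quaternionBlocks_apply, fromBlocks_multiply]
  congr 1 <;> ext i j <;>
    simp only [map_apply, mul_apply, Matrix.add_apply, Matrix.neg_apply, hf, hs, hfm, hsm, star_sum,
      ← Finset.sum_add_distrib, ← Finset.sum_neg_distrib] <;>
    refine Finset.sum_congr rfl fun k _ => ?_ <;> simp <;> ring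

/-- The complex matrices are the complexification of the quaternionic ones. -/
theorem exists_eq_quaternionBlocks_add {p q : ℕ}
    (M : Matrix (Fin p ⊕ Fin p) (Fin q ⊕ Fin q) ℂ) :
    ∃ A B : Matrix (Fin p) (Fin q) ℍ[ℝ],
      M = quaternionBlocks A + Complex.I • quaternionBlocks B := by
  have key : ∀ a b c d : ℂ, ∃ x y : ℍ[ℝ],
      a = quaternionFst x + Complex.I * quaternionFst y ∧
      b = quaternionSnd x + Complex.I * quaternionSnd y ∧
      c = -star (quaternionSnd x) + Complex.I * -star (quaternionSnd y) ∧
      d = star (quaternionFst x) + Complex.I * star (quaternionFst y) := fun a b c d => by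
    refine ⟨⟨(a.re + d.re) / 2, (a.im - d.im) / 2, (b.re - c.re) / 2, (b.im + c.im) / 2⟩,
      ⟨(a.im + d.im) / 2, (d.re - a.re) / 2, (b.im - c.im) / 2, -(b.re + c.re) / 2⟩, ?_, ?_, ?_, ?_⟩ <;>
    apply Complex.ext <;> simp [quaternionFst, quaternionSnd] <;> ring
  choose x y h1 h2 h3 h4 using key
  refine ⟨of fun i j => x (M (.inl i) (.inl j)) (M (.inl i) (.inr j)) (M (.inr i) (.inl j))
      (M (.inr i) (.inr j)), of fun i j => y (M (.inl i) (.inl j)) (M (.inl i) (.inr j))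
      (M (.inr i) (.inl j)) (M (.inr i) (.inr j)), ?_⟩
  ext (i | i) (j | j)
  · exact h1 _ _ _ _
  · exact h2 _ _ _ _
  · exact h3 _ _ _ _
  · exact h4 _ _ _ _

theorem mem_sp_iff {n : ℕ} {A : Matrix (Fin n ⊕ Fin n) (Fin n ⊕ Fin n) ℂ} :
    A ∈ LieAlgebra.Symplectic.sp (Fin n) ℂ ↔ Aᵀ * J (Fin n) ℂ = J (Fin n) ℂ * -A := by
  rw [LieAlgebra.Symplectic.sp, mem_skewAdjointMatricesLieSubalgebra,
    mem_skewAdjointMatricesSubmodule]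
  rfl

theorem fromBlocks_mem_sp_iff {n : ℕ} {P Q R S : Matrix (Fin n) (Fin n) ℂ} :
    fromBlocks P Q R S ∈ LieAlgebra.Symplectic.sp (Fin n) ℂ ↔ S = -Pᵀ ∧ Qᵀ = Q ∧ Rᵀ = R := by
  rw [mem_sp_iff, fromBlocks_transpose, J, fromBlocks_neg, fromBlocks_multiply,
    fromBlocks_multiply, fromBlocks_inj]
  simp only [Matrix.mul_zero, Matrix.mul_one, zero_add, Matrix.mul_neg, add_zero, Matrix.zero_mul,
    Matrix.neg_mul, Matrix.one_mul, neg_neg, neg_zero]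
  constructor
  · rintro ⟨h1, h2, h3, h4⟩
    exact ⟨h2.symm, by rw [← neg_inj, h4], h1⟩
  · rintro ⟨rfl, h2, h3⟩
    exact ⟨h3, rfl, by simp, by rw [h2]⟩

theorem isCompactForm_sp (n : ℕ) :
    IsCompactForm (quaternionBlocks (p := n) (q := n)) (LieAlgebra.Symplectic.sp (Fin n) ℂ) where
  mem a ha := by
    rw [quaternionBlocks_apply, fromBlocks_mem_sp_iff]
    refine ⟨?_, ?_, ?_⟩ <;> ext i j <;> have h1 := congrFun (congrFun ha i) j <;>
      simp only [conjTranspose_apply, Matrix.neg_apply] at h1 <;>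
      have hre := congrArg QuaternionAlgebra.re h1 <;>
      have hi := congrArg QuaternionAlgebra.imI h1 <;>
      have hj := congrArg QuaternionAlgebra.imJ h1 <;>
      have hk := congrArg QuaternionAlgebra.imK h1 <;>
      simp at hre hi hj hk <;>
      apply Complex.ext <;> simp [quaternionFst, quaternionSnd] <;> linarith
  exists_eq Y hY hYH := by
    obtain ⟨P, Q, R, S, rfl⟩ : ∃ P Q R S, Y = fromBlocks P Q R S :=
      ⟨_, _, _, _, (fromBlocks_toBlocks Y).symm⟩
    rw [fromBlocks_mem_sp_iff] at hY
    rw [fromBlocks_conjTranspose, fromBlocks_neg, fromBlocks_inj] at hYH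
    have hQ : ∀ i j, Q j i = Q i j := fun i j => congrFun (congrFun hY.2.1 i) j
    have hP : ∀ i j, star (P j i) = -P i j := fun i j => congrFun (congrFun hYH.1 i) j
    have hR : ∀ i j, star (Q j i) = -R i j := fun i j => congrFun (congrFun hYH.2.2.1 i) j
    refine ⟨of fun i j => ⟨(P i j).re, (P i j).im, (Q i j).re, (Q i j).im⟩, ?_, ?_⟩
    · ext1 i j
      have h1 := congrArg Complex.re (hP i j)
      have h2 := congrArg Complex.im (hP i j)
      simp at h1 h2
      apply Quaternion.ext
      · exact (Quaternion.re_star _).trans h1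
      · exact (Quaternion.imI_star _).trans (neg_inj.mpr h2)
      · exact (Quaternion.imJ_star _).trans (congrArg (fun z => -z.re) (hQ i j))
      · exact (Quaternion.imK_star _).trans (congrArg (fun z => -z.im) (hQ i j))
    · rw [quaternionBlocks_apply, fromBlocks_inj, hY.1]
      refine ⟨rfl, rfl, ?_, ?_⟩ <;> ext1 i j
      · change -star (Q i j) = _
        rw [← hQ, hR, neg_neg]
      · change star (P i j) = -P j i
        exact hP j i
  conjTranspose_mem Y hY := by
    obtain ⟨P, Q, R, S, rfl⟩ : ∃ P Q R S, Y = fromBlocks P Q R S :=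
      ⟨_, _, _, _, (fromBlocks_toBlocks Y).symm⟩
    rw [fromBlocks_mem_sp_iff] at hY
    obtain ⟨rfl, hQ, hR⟩ := hY
    rw [fromBlocks_conjTranspose, fromBlocks_mem_sp_iff]
    have hcomm : ∀ A : Matrix (Fin n) (Fin n) ℂ, Aᴴᵀ = Aᵀᴴ := fun A => rfl
    refine ⟨?_, ?_, ?_⟩
    · ext; simp
    · rw [hcomm, hR]
    · rw [hcomm, hQ]
  transpose_mem Y hY := by
    obtain ⟨P, Q, R, S, rfl⟩ : ∃ P Q R S, Y = fromBlocks P Q R S :=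
      ⟨_, _, _, _, (fromBlocks_toBlocks Y).symm⟩
    rw [fromBlocks_mem_sp_iff] at hY
    obtain ⟨rfl, hQ, hR⟩ := hY
    rw [fromBlocks_transpose, fromBlocks_mem_sp_iff, hQ, hR]
    simp [hQ, hR]

/-! ### Complexified holonomy of the two symmetric spaces -/

section SymmetricSpaceHolonomy

variable {V : Type*} [AddCommGroup V] [Module ℂ V] {g : LieSubalgebra ℂ (Module.End ℂ V)}

theorem toSubmodule_eq_map_trans {W U : Type*} [AddCommGroup W] [Module ℂ W] [AddCommGroup U]
    [Module ℂ U] {ψ : W ≃ₗ[ℂ] V} {L : LieSubalgebra ℂ (Module.End ℂ W)}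
    (hg : g = L.map (ψ.lieConj : Module.End ℂ W →ₗ⁅ℂ⁆ Module.End ℂ V)) {e : U ≃ₗ[ℂ] W}
    {S : Submodule ℂ (Module.End ℂ U)}
    (hL : L.toSubmodule = S.map (e.conj : Module.End ℂ U →ₗ[ℂ] Module.End ℂ W)) :
    g.toSubmodule = S.map ((e.trans ψ).conj : Module.End ℂ U →ₗ[ℂ] Module.End ℂ V) := by
  have h1 : g.toSubmodule = L.toSubmodule.map (ψ.conj : Module.End ℂ W →ₗ[ℂ] Module.End ℂ V) := by
    rw [hg]
    rfl
  rw [h1, hL, ← Submodule.map_comp]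
  rfl

theorem isComplexificationOf_holonomyBDI {n m : ℕ} (hn : 0 < n) (hm : 0 < m)
    (hirr : LieModule.IsIrreducible ℂ g V) (ψ : ((Fin n → ℂ) ⊗[ℂ] (Fin m → ℂ)) ≃ₗ[ℂ] V)
    (hg : g = (tensorSum (soStd n) (soStd m)).map
      (ψ.lieConj : Module.End ℂ ((Fin n → ℂ) ⊗[ℂ] (Fin m → ℂ)) →ₗ⁅ℂ⁆ Module.End ℂ V)) :
    IsComplexificationOf g (holonomyBDI n m) := by
  have hmap : ∀ {p q r : ℕ} (A : Matrix (Fin p) (Fin q) ℝ) (B : Matrix (Fin q) (Fin r) ℝ),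
      (A * B).map ((↑) : ℝ → ℂ) = A.map ((↑) : ℝ → ℂ) * B.map ((↑) : ℝ → ℂ) := fun A B =>
    Matrix.map_mul (f := Complex.ofRealHom)
  obtain ⟨e, he⟩ := exists_equiv_tensorSum_eq_map_span (p := n) (q := m) (F := ℝ)
    (Complex.ofRealAm.toLinearMap.mapMatrix) _ _ (fun a A => hmap a A) (fun A b => hmap A b)
    (fun M => ⟨M.map Complex.re, M.map Complex.im, by
      ext i j
      change M i j = (M i j).re + Complex.I * (M i j).im
      rw [mul_comm, Complex.re_add_im]⟩) (by simp [Module.finrank_matrix])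
    (isCompactForm_so n) (isCompactForm_so m)
  exact isComplexificationOf_holonomyAlgebra isRealPart_id (orthoPairsSpanSkew_real hn)
    (orthoPairsSpanSkew_real hm) hirr (e.trans ψ) (toSubmodule_eq_map_trans hg he)

theorem isComplexificationOf_holonomyCII {n m : ℕ} (hn : 2 ≤ n) (hm : 2 ≤ m)
    (hirr : LieModule.IsIrreducible ℂ g V)
    (ψ : ((Fin n ⊕ Fin n → ℂ) ⊗[ℂ] (Fin m ⊕ Fin m → ℂ)) ≃ₗ[ℂ] V)
    (hg : g = (tensorSum (spStd n) (spStd m)).map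
      (ψ.lieConj : Module.End ℂ ((Fin n ⊕ Fin n → ℂ) ⊗[ℂ] (Fin m ⊕ Fin m → ℂ)) →ₗ⁅ℂ⁆
        Module.End ℂ V)) :
    IsComplexificationOf g (holonomyCII n m) := by
  obtain ⟨e, he⟩ := exists_equiv_tensorSum_eq_map_span (p := n) (q := m) (F := ℍ[ℝ])
    quaternionBlocks _ _ (fun a A => quaternionBlocks_mul a A) (fun A b => quaternionBlocks_mul A b)
    exists_eq_quaternionBlocks_add
    (by rw [Module.finrank_matrix, Quaternion.finrank_eq_four]; simp; ring)
    (isCompactForm_sp n) (isCompactForm_sp m)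
  exact isComplexificationOf_holonomyAlgebra isRealPart_quaternionRe
    (orthoPairsSpanSkew_quaternion (by lia) hm) (orthoPairsSpanSkew_quaternion (by lia) hn) hirr
    (e.trans ψ) (toSubmodule_eq_map_trans hg he)

end SymmetricSpaceHolonomy

end RealForms

/-! ### Normal forms of bilinear forms -/

section Coordinates

open Matrix

variable {V : Type*} [AddCommGroup V] [Module ℂ V] {B : LinearMap.BilinForm ℂ V}

/-- A spanning family with invertible Gram matrix `G` is a basis, in whose coordinates the form is
given by `G`. -/
theorem exists_equiv_of_gram {ι : Type*} [Fintype ι] [DecidableEq ι] {f : ι → V}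
    (hf : ⊤ ≤ Submodule.span ℂ (Set.range f)) {G G' : Matrix ι ι ℂ}
    (hG : ∀ i j, B (f i) (f j) = G i j) (hG' : G * G' = 1) :
    ∃ e : (ι → ℂ) ≃ₗ[ℂ] V, ∀ u v, B (e u) (e v) = u ⬝ᵥ (G *ᵥ v) := by
  have hB : ∀ u v, B (Fintype.linearCombination ℂ f u) (Fintype.linearCombination ℂ f v) =
      u ⬝ᵥ (G *ᵥ v) := fun u v => by
    simp only [Fintype.linearCombination_apply, map_sum, map_smul, LinearMap.sum_apply,
      LinearMap.smul_apply, hG, dotProduct, mulVec, smul_eq_mul, Finset.mul_sum]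
    rw [Finset.sum_comm]
    exact Finset.sum_congr rfl fun i _ => Finset.sum_congr rfl fun j _ => by ring
  refine ⟨LinearEquiv.ofBijective (Fintype.linearCombination ℂ f) ⟨?_, ?_⟩, hB⟩
  · rw [injective_iff_map_eq_zero]
    intro u hu
    have h1 : ∀ v, u ⬝ᵥ (G *ᵥ v) = 0 := fun v => by rw [← hB, hu, map_zero, LinearMap.zero_apply]
    refine funext fun i => ?_
    have h2 := h1 (G' *ᵥ Pi.single i 1)
    rw [mulVec_mulVec, hG', one_mulVec, dotProduct_single_one] at h2
    exact h2
  · rw [← LinearMap.range_eq_top, Fintype.range_linearCombination]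
    exact top_le_iff.mp hf

/-- In coordinates in which the form `B` has matrix `G`, the Lie algebra of all `B`-skew endomorphisms
is that of the matrices skew-adjoint for `G`. -/
theorem eq_map_skewAdjointMatrices {ι : Type*} [Fintype ι] [DecidableEq ι] {G : Matrix ι ι ℂ}
    {e : (ι → ℂ) ≃ₗ[ℂ] V} (he : ∀ u v, B (e u) (e v) = u ⬝ᵥ (G *ᵥ v))
    {L : LieSubalgebra ℂ (Module.End ℂ V)}
    (hL : ∀ A, A ∈ L ↔ ∀ x y, B (A x) y = -B x (A y)) :
    L = ((skewAdjointMatricesLieSubalgebra G).map ((lieEquivMatrix' (R := ℂ) (n := ι)).symm :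
      Matrix ι ι ℂ →ₗ⁅ℂ⁆ Module.End ℂ (ι → ℂ))).map
        (e.lieConj : Module.End ℂ (ι → ℂ) →ₗ⁅ℂ⁆ Module.End ℂ V) := by
  have key : ∀ M : Matrix ι ι ℂ, M ∈ skewAdjointMatricesLieSubalgebra G ↔
      e.conj (Matrix.toLin' M) ∈ L := fun M => by
    rw [hL, mem_skewAdjointMatricesLieSubalgebra, mem_skewAdjointMatricesSubmodule]
    have h1 : ∀ u v : ι → ℂ, B (e.conj (Matrix.toLin' M) (e u)) (e v) = u ⬝ᵥ ((Mᵀ * G) *ᵥ v) :=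
      fun u v => by
        simp only [LinearEquiv.conj_apply_apply, LinearEquiv.symm_apply_apply, toLin'_apply, he]
        rw [← mulVec_mulVec, dotProduct_mulVec u, vecMul_transpose]
    have h2 : ∀ u v : ι → ℂ, -B (e u) (e.conj (Matrix.toLin' M) (e v)) =
        u ⬝ᵥ ((G * -M) *ᵥ v) := fun u v => by
        simp only [LinearEquiv.conj_apply_apply, LinearEquiv.symm_apply_apply, toLin'_apply, he]
        rw [Matrix.mul_neg, neg_mulVec, dotProduct_neg, mulVec_mulVec]
    constructor
    · intro h x y
      obtain ⟨u, rfl⟩ := e.surjective x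
      obtain ⟨v, rfl⟩ := e.surjective y
      rw [h1, h2]
      exact congrArg (fun N : Matrix ι ι ℂ => u ⬝ᵥ (N *ᵥ v)) h
    · intro h
      change Mᵀ * G = G * -M
      ext i j
      have := h (e (Pi.single i 1)) (e (Pi.single j 1))
      rw [h1, h2] at this
      simpa using this
  ext A
  constructor
  · intro hA
    refine ⟨_, ⟨LinearMap.toMatrix' (e.symm.conj A), ?_, rfl⟩, ?_⟩
    · refine (key _).mpr ?_
      rw [Matrix.toLin'_toMatrix']
      convert hA
      ext x
      simp [LinearEquiv.conj_apply_apply]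
    · change e.conj (Matrix.toLin' (LinearMap.toMatrix' (e.symm.conj A))) = A
      rw [Matrix.toLin'_toMatrix']
      ext x
      simp [LinearEquiv.conj_apply_apply]
  · rintro ⟨_, ⟨M, hM, rfl⟩, rfl⟩
    exact (key M).mp hM

/-- Over `ℂ` an orthogonal basis can be normalized, so a nondegenerate symmetric form is a dot
product. The identity matrix is kept to match the definition of `LieAlgebra.Orthogonal.so`. -/
theorem exists_equiv_dotProduct [FiniteDimensional ℂ V] (hB : B.Nondegenerate)
    (hsymm : ∀ x y, B x y = B y x) :
    ∃ e : (Fin (Module.finrank ℂ V) → ℂ) ≃ₗ[ℂ] V,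
      ∀ u v, B (e u) (e v) = u ⬝ᵥ ((1 : Matrix (Fin (Module.finrank ℂ V)) _ ℂ) *ᵥ v) := by
  obtain ⟨v, hv⟩ := LinearMap.BilinForm.exists_orthogonal_basis (B := B) ⟨fun x y => hsymm x y⟩
  have hne : ∀ i, B (v i) (v i) ≠ 0 := fun i h0 => by
    refine v.ne_zero i (hB.1 _ fun y => ?_)
    have : B (v i) = 0 := v.ext fun j => by
      rcases eq_or_ne i j with rfl | hij
      · exact h0
      · exact hv hij
    rw [this, LinearMap.zero_apply]
  choose c hc using fun i => IsAlgClosed.exists_eq_mul_self (B (v i) (v i))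
  have hc0 : ∀ i, c i ≠ 0 := fun i h => hne i (by rw [hc, h, mul_zero])
  refine exists_equiv_of_gram (f := fun i => (c i)⁻¹ • v i) (G' := 1) ?_ ?_ (mul_one 1)
  · rw [← v.span_eq, Submodule.span_le]
    rintro _ ⟨i, rfl⟩
    have : v i = c i • (c i)⁻¹ • v i := by rw [smul_smul, mul_inv_cancel₀ (hc0 i), one_smul]
    rw [this]
    exact Submodule.smul_mem _ _ (Submodule.subset_span ⟨i, rfl⟩)
  · intro i j
    rcases eq_or_ne i j with rfl | hij
    · have := hc0 i
      simp only [map_smul, LinearMap.smul_apply, smul_eq_mul, one_apply_eq, hc]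
      field_simp
    · have h0 : B (v i) (v j) = 0 := hv hij
      simp [one_apply_ne hij, h0]

/-- A nondegenerate alternating form has a spanning family whose Gram matrix is the standard symplectic
matrix `J`. The induction splits off a hyperbolic plane spanned by `x`, `y` and continues in its
orthogonal complement. The sign convention of `J` is `B x y = -1`. -/
theorem exists_symplectic_family (n : ℕ) : ∀ {V : Type*} [AddCommGroup V] [Module ℂ V]
    [FiniteDimensional ℂ V] (B : LinearMap.BilinForm ℂ V), Module.finrank ℂ V ≤ n →
    (∀ x, (∀ y, B x y = 0) → x = 0) → (∀ x y, B x y = -B y x) →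
    ∃ (l : ℕ) (f : Fin l ⊕ Fin l → V), ⊤ ≤ Submodule.span ℂ (Set.range f) ∧
      ∀ i j, B (f i) (f j) = J (Fin l) ℂ i j := by
  induction n with
  | zero =>
    intro V _ _ _ B hn _ _
    have : Subsingleton V := Module.finrank_zero_iff.mp (Nat.le_zero.mp hn)
    exact ⟨0, fun _ => 0, fun x _ => by rw [Subsingleton.elim x 0]; exact zero_mem _,
      fun i => i.elim Fin.elim0 Fin.elim0⟩
  | succ n ih =>
    intro V _ _ _ B hn hB hskew
    by_cases hV : ∃ x : V, x ≠ 0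
    swap
    · push Not at hV
      exact ⟨0, fun _ => 0, fun x _ => by rw [hV x]; exact zero_mem _,
        fun i => i.elim Fin.elim0 Fin.elim0⟩
    obtain ⟨x, hx⟩ := hV
    obtain ⟨y, hxy⟩ : ∃ y, B y x = 1 := by
      by_contra! h
      refine hx (hB x fun y => ?_)
      by_contra h0
      refine h (-(B x y)⁻¹ • y) ?_
      rw [map_smul, LinearMap.smul_apply, hskew y x, smul_eq_mul]
      field_simp
    have hyx : B x y = -1 := by rw [hskew, hxy]
    have hself : ∀ z, B z z = 0 := fun z => self_eq_neg.mp (hskew z z)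
    let W : Submodule ℂ V := LinearMap.ker (B x) ⊓ LinearMap.ker (B y)
    have hW : ∀ {w}, w ∈ W → B x w = 0 ∧ B y w = 0 := fun hw => hw
    have hdecomp : ∀ v, v - (B y v) • x + (B x v) • y ∈ W := fun v => by
      constructor <;> simp [LinearMap.mem_ker, hself, hxy, hyx]
    have hWn : Module.finrank ℂ W ≤ n := by
      refine Nat.lt_succ_iff.mp (lt_of_lt_of_le (Submodule.finrank_lt fun h => ?_) hn)
      have : x ∈ W := h ▸ Submodule.mem_top
      exact one_ne_zero (hxy.symm.trans (hW this).2)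
    obtain ⟨l, f, hf, hfJ⟩ := ih (B.restrict W) hWn (fun w hw => by
      refine Subtype.ext (hB w fun v => ?_)
      have h1 : B w (v - (B y v) • x + (B x v) • y) = 0 := hw ⟨_, hdecomp v⟩
      have h2 : B w x = 0 := by rw [hskew, (hW w.2).1, neg_zero]
      have h3 : B w y = 0 := by rw [hskew, (hW w.2).2, neg_zero]
      simpa [h2, h3] using h1) (fun u v => hskew u v)
    refine ⟨l + 1, Sum.elim (Fin.cons x fun i => f (.inl i)) (Fin.cons y fun i => f (.inr i)),
      fun v _ => ?_, ?_⟩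
    · set F : Fin (l + 1) ⊕ Fin (l + 1) → V :=
        Sum.elim (Fin.cons x fun i => f (.inl i)) (Fin.cons y fun i => f (.inr i))
      have hx' : x ∈ Submodule.span ℂ (Set.range F) := Submodule.subset_span ⟨.inl 0, rfl⟩
      have hy' : y ∈ Submodule.span ℂ (Set.range F) := Submodule.subset_span ⟨.inr 0, rfl⟩
      have hle : (Submodule.span ℂ (Set.range f)).map W.subtype ≤
          Submodule.span ℂ (Set.range F) := by
        rw [Submodule.map_span_le]
        rintro _ ⟨i | i, rfl⟩
        · exact Submodule.subset_span ⟨.inl i.succ, rfl⟩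
        · exact Submodule.subset_span ⟨.inr i.succ, rfl⟩
      have hw := hle (Submodule.mem_map_of_mem (hf (Submodule.mem_top (x := ⟨_, hdecomp v⟩))))
      refine (congrArg (· ∈ Submodule.span ℂ (Set.range F)) ?_).mp (Submodule.sub_mem _
        (Submodule.add_mem _ hw (Submodule.smul_mem _ (B y v) hx'))
        (Submodule.smul_mem _ (B x v) hy'))
      rw [Submodule.subtype_apply]
      module
    · have hx1 : ∀ i, B x (f i) = 0 := fun i => (hW (f i).2).1
      have hy1 : ∀ i, B y (f i) = 0 := fun i => (hW (f i).2).2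
      have hx2 : ∀ i, B (f i) x = 0 := fun i => by rw [hskew, hx1, neg_zero]
      have hy2 : ∀ i, B (f i) y = 0 := fun i => by rw [hskew, hy1, neg_zero]
      have hJ : ∀ i j, B (f i) (f j) = J (Fin l) ℂ i j := hfJ
      rintro (i | i) (j | j) <;> refine Fin.cases ?_ (fun i => ?_) i <;>
        refine Fin.cases ?_ (fun j => ?_) j <;>
        simp [J, hx1, hx2, hy1, hy2, hself, hxy, hyx, hJ, Matrix.one_apply, Fin.succ_ne_zero,
          (Fin.succ_ne_zero _).symm]

theorem exists_equiv_J [FiniteDimensional ℂ V] (hB : B.Nondegenerate)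
    (hskew : ∀ x y, B x y = -B y x) :
    ∃ (l : ℕ) (e : (Fin l ⊕ Fin l → ℂ) ≃ₗ[ℂ] V),
      ∀ u v, B (e u) (e v) = u ⬝ᵥ (J (Fin l) ℂ *ᵥ v) := by
  obtain ⟨l, f, hf, hfJ⟩ := exists_symplectic_family _ B le_rfl hB.1 hskew
  exact ⟨l, exists_equiv_of_gram hf hfJ (G' := -J (Fin l) ℂ) (by
    rw [Matrix.mul_neg, J_squared, neg_neg])⟩

end Coordinates

/-! ### Weak curvature maps on a tensor product -/

section WeakCurvature

variable {V₁ V₂ : Type*} [AddCommGroup V₁] [Module ℂ V₁] [FiniteDimensional ℂ V₁]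
  [AddCommGroup V₂] [Module ℂ V₂] [FiniteDimensional ℂ V₂]

/-- In dimension at least 3, the orthogonal complement of a vector has dimension greater than half the
total dimension, so it is not totally isotropic. -/
theorem exists_orthogonal_pair {b : LinearMap.BilinForm ℂ V₁} (hb : b.Nondegenerate) {ε : ℂ}
    (hε : ∀ x y, b x y = ε * b y x) (hdim : 3 ≤ Module.finrank ℂ V₁) (x : V₁) :
    ∃ y z, b x y = 0 ∧ b x z = 0 ∧ b y z = 1 := by
  have hrefl : b.IsRefl := fun u v h => by rw [hε, h, mul_zero]
  set W := b.orthogonal (Submodule.span ℂ {x})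
  have hW : ∀ y, y ∈ W → b x y = 0 := fun y hy => hy x (Submodule.mem_span_singleton_self x)
  have h1 : Module.finrank ℂ W = Module.finrank ℂ V₁ -
      Module.finrank ℂ (Submodule.span ℂ {x}) := LinearMap.BilinForm.finrank_orthogonal hb _
  have h2 : Module.finrank ℂ (b.orthogonal W) = Module.finrank ℂ V₁ - Module.finrank ℂ W :=
    LinearMap.BilinForm.finrank_orthogonal hb _
  have h3 : Module.finrank ℂ (Submodule.span ℂ {x}) ≤ 1 := by
    simpa using finrank_span_le_card (R := ℂ) ({x} : Set V₁)
  have h4 : ¬ W ≤ b.orthogonal W := fun h => by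
    have := Submodule.finrank_mono h
    omega
  obtain ⟨z, hz, hz'⟩ := SetLike.not_le_iff_exists.mp h4
  have : ∃ y ∈ W, b y z ≠ 0 := by
    by_contra! h
    exact hz' fun y hy => h y hy
  obtain ⟨y, hy, hyz⟩ := this
  refine ⟨(b y z)⁻¹ • y, z, by rw [map_smul, hW y hy, smul_zero], hW z hz, ?_⟩
  rw [map_smul, LinearMap.smul_apply, smul_eq_mul, inv_mul_cancel₀ hyz]

/-- The endomorphism `y ↦ a(x, y) s - ε a(s, y) x`. If `a(x, y) = ε a(y, x)` with `ε = ±1`, it is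
`a`-skew: the wedge of `x` and `s` for symmetric `a`, their symmetric product for alternating `a`. -/
def twistedWedge (a : LinearMap.BilinForm ℂ V₁) (ε : ℂ) (x s : V₁) : Module.End ℂ V₁ :=
  (a x).smulRight s - ε • (a s).smulRight x

theorem twistedWedge_apply (a : LinearMap.BilinForm ℂ V₁) (ε : ℂ) (x s y : V₁) :
    twistedWedge a ε x s y = a x y • s - ε • a s y • x := rfl

/-- The cyclic identity for `h = a ⊗ b` makes the `V₁`-component of a weak curvature map a twisted
wedge, with a vector `s` that depends only on `x'`. Evaluated on vectors `y'`, `z'` orthogonal to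
`x'` with `b(y', z') = 1`, the identity expresses `a(Q₁(x ⊗ x') y, z)` by three linear forms
`β`, `γ`, `δ` times values of `a`; skewness of `Q₁` forces `β = 0` and `γ = -δ`. -/
theorem exists_eq_twistedWedge {a : LinearMap.BilinForm ℂ V₁} {b : LinearMap.BilinForm ℂ V₂}
    (ha : a.Nondegenerate) (hb : b.Nondegenerate) {ε : ℂ} (hε : ε * ε = 1)
    (haε : ∀ x y, a x y = ε * a y x) (hbε : ∀ x y, b x y = ε * b y x)
    (h₁ : 3 ≤ Module.finrank ℂ V₁) (h₂ : 3 ≤ Module.finrank ℂ V₂)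
    (Q₁ : V₁ →ₗ[ℂ] V₂ →ₗ[ℂ] Module.End ℂ V₁) (Q₂ : V₁ →ₗ[ℂ] V₂ →ₗ[ℂ] Module.End ℂ V₂)
    (hskew : ∀ x x' y z, a (Q₁ x x' y) z = -a y (Q₁ x x' z))
    (hQ : ∀ x x' y y' z z',
      (a (Q₁ x x' y) z * b y' z' + a y z * b (Q₂ x x' y') z') +
      (a (Q₁ y y' z) x * b z' x' + a z x * b (Q₂ y y' z') x') +
      (a (Q₁ z z' x) y * b x' y' + a x y * b (Q₂ z z' x') y') = 0) (x' : V₂) :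
    ∃ s, ∀ x, Q₁ x x' = twistedWedge a ε x s := by
  obtain ⟨y', z', hxy', hxz', hyz'⟩ := exists_orthogonal_pair hb hbε h₂ x'
  have hzx' : b z' x' = 0 := by rw [hbε, hxz', mul_zero]
  -- the linear forms `β`, `γ`, `δ` are the coefficients of `a` in the cyclic identity
  let β : V₁ → ℂ := fun x => b (Q₂ x x' y') z'
  let γ : V₁ → ℂ := fun y => b (Q₂ y y' z') x'
  let δ : V₁ →ₗ[ℂ] ℂ := (b.flip y') ∘ₗ (LinearMap.applyₗ x') ∘ₗ (Q₂.flip z')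
  have hδ : ∀ z, δ z = b (Q₂ z z' x') y' := fun z => rfl
  have h3 : ∀ x y z, a (Q₁ x x' y) z + a y z * β x + a z x * γ y + a x y * δ z = 0 :=
    fun x y z => by
      have := hQ x x' y y' z z'
      rw [hyz', hzx', hxy'] at this
      simp only [hδ, β, γ]
      linear_combination this
  have hsw : ∀ x y z, a (Q₁ x x' z) y = -ε * a (Q₁ x x' y) z := fun x y z => by
    rw [hskew, haε]
    ring
  -- adding `ε` times the identity with `y` and `z` exchanged eliminates `Q₁`
  have h4 : ∀ x y z, 2 * a y z * β x + a z x * (γ y + δ y) + a x y * (γ z + δ z) = 0 :=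
    fun x y z => by
      have e1 := h3 x y z
      have e2 := h3 x z y
      rw [hsw] at e2
      rw [haε z y, haε y x, haε x z] at e2
      linear_combination e1 + ε * e2 + (a (Q₁ x x' y) z - a y z * β x - a z x * δ y -
        a x y * γ z) * hε
  have hβ : ∀ x, β x = 0 := fun x => by
    obtain ⟨y, z, hy, hz, hyz⟩ := exists_orthogonal_pair ha haε h₁ x
    have := h4 x y z
    rw [hy, hyz, haε z x, hz] at this
    linear_combination this / 2
  -- choose a nonzero `x` orthogonal to `y`, and `z` not orthogonal to `x`
  have hσ : ∀ y, γ y = -δ y := fun y => by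
    have h5 : ∃ x, x ≠ 0 ∧ a x y = 0 := by
      by_cases hy : y = 0
      · have : Nontrivial V₁ := Module.nontrivial_of_finrank_pos (R := ℂ) (by omega)
        obtain ⟨x, hx⟩ := exists_ne (0 : V₁)
        exact ⟨x, hx, by rw [hy, map_zero]⟩
      · obtain ⟨x, w, hx, hw, hxw⟩ := exists_orthogonal_pair ha haε h₁ y
        refine ⟨x, fun h0 => ?_, by rw [haε, hx, mul_zero]⟩
        simp [h0] at hxw
    obtain ⟨x, hx, hxy⟩ := h5
    obtain ⟨z, hz⟩ : ∃ z, a z x ≠ 0 := by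
      by_contra! h
      exact hx (ha.2 x h)
    have := h4 x y z
    rw [hxy, hβ] at this
    have h6 : a z x * (γ y + δ y) = 0 := by linear_combination this
    exact eq_neg_of_add_eq_zero_left ((mul_eq_zero.mp h6).resolve_left hz)
  obtain ⟨s, hs⟩ : ∃ s, ∀ z, a s z = -δ z :=
    ⟨(a.toDual ha).symm (-δ), fun z => by
      rw [LinearMap.BilinForm.apply_toDual_symm_apply]; rfl⟩
  refine ⟨s, fun x => LinearMap.ext fun y => ?_⟩
  refine sub_eq_zero.mp (ha.1 _ fun z => ?_)
  rw [twistedWedge_apply, map_sub, LinearMap.sub_apply, map_sub, LinearMap.sub_apply]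
  simp only [map_smul, LinearMap.smul_apply, smul_eq_mul, hs]
  have := h3 x y z
  rw [hβ, hσ] at this
  rw [haε x z]
  linear_combination this - δ y * a z x * hε

/-- An irreducible Lie algebra `L` of `a`-skew endomorphisms which contains all twisted wedges of one
nonzero vector `s` contains all `a`-skew endomorphisms. -/
theorem mem_of_twistedWedge_mem {a : LinearMap.BilinForm ℂ V₁} (ha : a.Nondegenerate) {ε : ℂ}
    (haε : ∀ x y, a x y = ε * a y x) (hε : ε * ε = 1) {L : LieSubalgebra ℂ (Module.End ℂ V₁)}
    (hirr : ∀ N : Submodule ℂ V₁, (∀ A ∈ L, ∀ v ∈ N, A v ∈ N) → N = ⊥ ∨ N = ⊤)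
    (hL : ∀ A ∈ L, ∀ x y, a (A x) y = -a x (A y)) {s : V₁} (hs : s ≠ 0)
    (hmem : ∀ x, twistedWedge a ε x s ∈ L) {A : Module.End ℂ V₁}
    (hA : ∀ x y, a (A x) y = -a x (A y)) : A ∈ L := by
  let N : Submodule ℂ V₁ :=
    { carrier := {s | ∀ x, twistedWedge a ε x s ∈ L}
      zero_mem' := fun x => by
        refine (congrArg (· ∈ L) (LinearMap.ext fun y => ?_)).mp L.zero_mem
        simp [twistedWedge_apply]
      add_mem' := fun {s t} hs ht x => by
        refine (congrArg (· ∈ L) (LinearMap.ext fun y => ?_)).mp (L.add_mem (hs x) (ht x))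
        simp only [LinearMap.add_apply, twistedWedge_apply, map_add]
        module
      smul_mem' := fun c s hs x => by
        refine (congrArg (· ∈ L) (LinearMap.ext fun y => ?_)).mp (L.smul_mem c (hs x))
        simp only [LinearMap.smul_apply, twistedWedge_apply, map_smul, smul_eq_mul]
        module }
  -- `N` is invariant because `[B, x ∧ s] = B x ∧ s + x ∧ B s` for `a`-skew `B`
  have hN : N = ⊤ := by
    refine (hirr N fun B hB s hs x => ?_).resolve_left fun h => hs ?_
    · refine (congrArg (· ∈ L) (LinearMap.ext fun y => ?_)).mp
        (L.sub_mem (L.lie_mem hB (hs x)) (hs (B x)))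
      simp only [LinearMap.sub_apply, Ring.lie_def, Module.End.mul_apply, twistedWedge_apply,
        map_sub, map_smul, hL B hB]
      module
    · exact (Submodule.mem_bot ℂ).mp (h ▸ (hmem : s ∈ N))
  have hall : ∀ x s, twistedWedge a ε x s ∈ L := fun x s =>
    (hN ▸ Submodule.mem_top : s ∈ N) x
  let e := Module.finBasis ℂ V₁
  have hdual : ∀ x, ∑ i, a x (e i) • a.dualBasis ha e i = x := fun x => by
    conv_rhs => rw [← (a.dualBasis ha e).sum_repr x]
    simp only [LinearMap.BilinForm.dualBasis_repr_apply]
  have hrec : ∀ y, ∑ i, a (a.dualBasis ha e i) y • e i = y := fun y => by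
    refine sub_eq_zero.mp (ha.2 _ fun x => ?_)
    have h1 : a x y = ∑ i, a x (e i) * a (a.dualBasis ha e i) y := by
      conv_lhs => rw [← hdual x]
      simp only [map_sum, LinearMap.sum_apply, map_smul, LinearMap.smul_apply, smul_eq_mul]
    rw [map_sub, map_sum, h1, ← Finset.sum_sub_distrib]
    refine Finset.sum_eq_zero fun i _ => ?_
    rw [map_smul, smul_eq_mul]
    ring
  -- with dual bases `e i`, `f i` for `a`, every skew `A` is half the sum of the `f i ∧ A (e i)`
  have h2A : (2 : ℂ) • A = ∑ i, twistedWedge a ε (a.dualBasis ha e i) (A (e i)) := by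
    refine LinearMap.ext fun y => ?_
    rw [LinearMap.sum_apply]
    simp only [twistedWedge_apply, Finset.sum_sub_distrib]
    have h1 : ∑ i, a (a.dualBasis ha e i) y • A (e i) = A y := by
      conv_rhs => rw [← hrec y, map_sum]
      simp only [map_smul]
    have h2 : ∑ i, ε • a (A (e i)) y • a.dualBasis ha e i = -A y := by
      conv_rhs => rw [← hdual (A y), ← Finset.sum_neg_distrib]
      refine Finset.sum_congr rfl fun i _ => ?_
      rw [hA, haε (e i), smul_smul, ← neg_smul]
      congr 1
      linear_combination -a (A y) (e i) * hε
    rw [h1, h2, LinearMap.smul_apply]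
    module
  have : A = (2 : ℂ)⁻¹ • (2 : ℂ) • A := by rw [smul_smul]; norm_num
  rw [this, h2A]
  exact L.smul_mem _ (sum_mem fun i _ => hall _ _)

end WeakCurvature

/-! ### Invariant forms on irreducible modules -/

section InvariantForms

variable {V : Type*} [AddCommGroup V] [Module ℂ V] [FiniteDimensional ℂ V]
  {S : Set (Module.End ℂ V)}
  (hS : ∀ N : Submodule ℂ V, (∀ A ∈ S, ∀ v ∈ N, A v ∈ N) → N = ⊥ ∨ N = ⊤)
include hS

theorem separatingLeft_of_invariant {a : LinearMap.BilinForm ℂ V}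
    (ha : ∀ A ∈ S, ∀ x y, a (A x) y = -a x (A y)) (ha0 : a ≠ 0) :
    ∀ x, (∀ y, a x y = 0) → x = 0 := by
  intro x hx
  have h := (hS (LinearMap.ker a) fun A hA v hv => LinearMap.ext fun y => by
    rw [ha A hA, LinearMap.mem_ker.mp hv]; simp).resolve_right fun h =>
      ha0 (LinearMap.ker_eq_top.mp h)
  exact (Submodule.mem_bot ℂ).mp (h ▸ LinearMap.mem_ker.mpr (LinearMap.ext hx))

theorem nondegenerate_of_invariant {a : LinearMap.BilinForm ℂ V}
    (ha : ∀ A ∈ S, ∀ x y, a (A x) y = -a x (A y)) (ha0 : a ≠ 0) : a.Nondegenerate := by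
  refine ⟨separatingLeft_of_invariant hS ha ha0, ?_⟩
  refine separatingLeft_of_invariant (a := a.flip) hS (fun A hA x y => ?_) fun h => ha0 ?_
  · rw [LinearMap.BilinForm.flip_apply, LinearMap.BilinForm.flip_apply, ha A hA, neg_neg]
  · exact LinearMap.ext₂ fun x y => LinearMap.congr_fun₂ h y x

theorem exists_eq_smul_of_invariant [Nontrivial V] {a c : LinearMap.BilinForm ℂ V}
    (ha : ∀ A ∈ S, ∀ x y, a (A x) y = -a x (A y)) (ha0 : a ≠ 0)
    (hc : ∀ A ∈ S, ∀ x y, c (A x) y = -c x (A y)) : ∃ t : ℂ, ∀ x y, c x y = t * a x y := by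
  have hnd := nondegenerate_of_invariant hS ha ha0
  let T : Module.End ℂ V := (a.toDual hnd).symm ∘ₗ c
  have hT : ∀ x y, a (T x) y = c x y := fun x y =>
    LinearMap.BilinForm.apply_toDual_symm_apply (hB := hnd) (c x) y
  obtain ⟨t, ht⟩ := exists_eq_smul_one_of_commute hS (T := T) fun A hA v => by
    refine sub_eq_zero.mp (hnd.1 _ fun y => ?_)
    rw [map_sub, LinearMap.sub_apply, hT, hc A hA, ha A hA, hT, sub_self]
  exact ⟨t, fun x y => by rw [← hT, ht]; simp⟩

end InvariantForms

/-! ### Factorization of an invariant form on a tensor product -/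

section Factorization

variable {V₁ V₂ : Type*} [AddCommGroup V₁] [Module ℂ V₁] [FiniteDimensional ℂ V₁] [Nontrivial V₁]
  [AddCommGroup V₂] [Module ℂ V₂] [FiniteDimensional ℂ V₂] [Nontrivial V₂]

/-- A symmetric form on `V₁ ⊗ V₂` which is invariant under irreducible sets of endomorphisms of both
factors is `a ⊗ b`, with `a` and `b` both symmetric or both alternating. With the vectors of `V₂`
fixed, the form is an invariant form on `V₁`, hence by Schur's lemma a multiple of a single `a`. -/
theorem exists_factorization {H : LinearMap.BilinForm ℂ (V₁ ⊗[ℂ] V₂)} (hH : H ≠ 0)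
    (hsymm : ∀ s t, H s t = H t s)
    {S₁ : Set (Module.End ℂ V₁)} {S₂ : Set (Module.End ℂ V₂)}
    (hS₁ : ∀ N : Submodule ℂ V₁, (∀ A ∈ S₁, ∀ v ∈ N, A v ∈ N) → N = ⊥ ∨ N = ⊤)
    (hS₂ : ∀ N : Submodule ℂ V₂, (∀ A ∈ S₂, ∀ v ∈ N, A v ∈ N) → N = ⊥ ∨ N = ⊤)
    (h₁ : ∀ A ∈ S₁, ∀ x x' y y', H (A x ⊗ₜ x') (y ⊗ₜ y') = -H (x ⊗ₜ x') (A y ⊗ₜ y'))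
    (h₂ : ∀ A ∈ S₂, ∀ x x' y y', H (x ⊗ₜ A x') (y ⊗ₜ y') = -H (x ⊗ₜ x') (y ⊗ₜ A y')) :
    ∃ (a : LinearMap.BilinForm ℂ V₁) (b : LinearMap.BilinForm ℂ V₂) (ε : ℂ), ε * ε = 1 ∧
      a.Nondegenerate ∧ b.Nondegenerate ∧ (∀ x y, a x y = ε * a y x) ∧
      (∀ x y, b x y = ε * b y x) ∧ (∀ A ∈ S₁, ∀ x y, a (A x) y = -a x (A y)) ∧
      (∀ A ∈ S₂, ∀ x y, b (A x) y = -b x (A y)) ∧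
      ∀ x x' y y', H (x ⊗ₜ x') (y ⊗ₜ y') = a x y * b x' y' := by
  obtain ⟨x₀, x₀', y₀, y₀', h0⟩ : ∃ x x' y y', H (x ⊗ₜ x') (y ⊗ₜ y') ≠ 0 := by
    by_contra! h
    exact hH (TensorProduct.ext' fun x x' => TensorProduct.ext' fun y y' => h x x' y y')
  let f : V₂ → V₂ → LinearMap.BilinForm ℂ V₁ := fun x' y' =>
    H.compl₁₂ ((TensorProduct.mk ℂ V₁ V₂).flip x') ((TensorProduct.mk ℂ V₁ V₂).flip y')
  have hf : ∀ x' y' x y, f x' y' x y = H (x ⊗ₜ x') (y ⊗ₜ y') := fun _ _ _ _ => rfl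
  let a := f x₀' y₀'
  have ha0 : a ≠ 0 := fun h => h0 (LinearMap.congr_fun₂ h x₀ y₀)
  have hinv : ∀ x' y', ∀ A ∈ S₁, ∀ x y, f x' y' (A x) y = -f x' y' x (A y) :=
    fun x' y' A hA x y => h₁ A hA x x' y y'
  have ha := hinv x₀' y₀'
  set c := H (x₀ ⊗ₜ x₀') (y₀ ⊗ₜ y₀') with hc
  let b : LinearMap.BilinForm ℂ V₂ :=
    c⁻¹ • H.compl₁₂ (TensorProduct.mk ℂ V₁ V₂ x₀) (TensorProduct.mk ℂ V₁ V₂ y₀)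
  have hb : ∀ x' y', b x' y' = c⁻¹ * H (x₀ ⊗ₜ x') (y₀ ⊗ₜ y') := fun _ _ => rfl
  have hb0 : b ≠ 0 := fun h => by
    have := LinearMap.congr_fun₂ h x₀' y₀'
    rw [hb, ← hc, inv_mul_cancel₀ h0] at this
    exact one_ne_zero this
  have hbinv : ∀ A ∈ S₂, ∀ x y, b (A x) y = -b x (A y) := fun A hA x y => by
    rw [hb, hb, h₂ A hA, mul_neg]
  have hfac : ∀ x x' y y', H (x ⊗ₜ x') (y ⊗ₜ y') = a x y * b x' y' := fun x x' y y' => by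
    obtain ⟨t, ht⟩ := exists_eq_smul_of_invariant hS₁ ha ha0 (hinv x' y')
    have h3 := ht x₀ y₀
    have h4 := ht x y
    rw [hf] at h3 h4
    have h5 : a x₀ y₀ = c := rfl
    rw [hb, h3, h4]
    rw [show f x₀' y₀' x₀ y₀ = c from rfl]
    field_simp
    rfl
  obtain ⟨ε, hε⟩ := exists_eq_smul_of_invariant (c := a.flip) hS₁ ha ha0 (fun A hA x y => by
    rw [LinearMap.BilinForm.flip_apply, LinearMap.BilinForm.flip_apply, ha A hA, neg_neg])
  have haε : ∀ x y, a x y = ε * a y x := fun x y => hε y x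
  have hac : a x₀ y₀ ≠ 0 := h0
  have hεε : ε * ε = 1 := by
    have h3 := haε x₀ y₀
    rw [haε y₀ x₀] at h3
    refine mul_right_cancel₀ hac ?_
    rw [one_mul, mul_assoc, ← h3]
  refine ⟨a, b, ε, hεε, nondegenerate_of_invariant hS₁ ha ha0,
    nondegenerate_of_invariant hS₂ hbinv hb0, haε, fun x' y' => ?_, ha, hbinv, hfac⟩
  have h3 := hsymm (x₀ ⊗ₜ x') (y₀ ⊗ₜ y')
  rw [hfac, hfac, haε y₀ x₀] at h3
  refine mul_left_cancel₀ hac ?_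
  rw [h3]
  ring

end Factorization

/-! ### Transport of tensor sums along isomorphisms -/

section TensorSum

variable {W₁ W₂ V₁ V₂ V : Type*} [AddCommGroup W₁] [Module ℂ W₁] [AddCommGroup W₂] [Module ℂ W₂]
  [AddCommGroup V₁] [Module ℂ V₁] [AddCommGroup V₂] [Module ℂ V₂] [AddCommGroup V] [Module ℂ V]

theorem congr_conj_rTensor_add_lTensor (e₁ : W₁ ≃ₗ[ℂ] V₁) (e₂ : W₂ ≃ₗ[ℂ] V₂)
    (A : Module.End ℂ W₁) (B : Module.End ℂ W₂) :
    (TensorProduct.congr e₁ e₂).conj (LinearMap.rTensor W₂ A + LinearMap.lTensor W₁ B) =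
      LinearMap.rTensor V₂ (e₁.conj A) + LinearMap.lTensor V₁ (e₂.conj B) := by
  refine TensorProduct.ext' fun x y => ?_
  simp [LinearEquiv.conj_apply_apply]

theorem map_tensorSum_trans (e₁ : W₁ ≃ₗ[ℂ] V₁) (e₂ : W₂ ≃ₗ[ℂ] V₂) (φ : (V₁ ⊗[ℂ] V₂) ≃ₗ[ℂ] V)
    (L₁ : LieSubalgebra ℂ (Module.End ℂ W₁)) (L₂ : LieSubalgebra ℂ (Module.End ℂ W₂)) :
    (tensorSum L₁ L₂).map (((TensorProduct.congr e₁ e₂).trans φ).lieConj :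
        Module.End ℂ (W₁ ⊗[ℂ] W₂) →ₗ⁅ℂ⁆ Module.End ℂ V) =
      (tensorSum (L₁.map (e₁.lieConj : Module.End ℂ W₁ →ₗ⁅ℂ⁆ Module.End ℂ V₁))
        (L₂.map (e₂.lieConj : Module.End ℂ W₂ →ₗ⁅ℂ⁆ Module.End ℂ V₂))).map
          (φ.lieConj : Module.End ℂ (V₁ ⊗[ℂ] V₂) →ₗ⁅ℂ⁆ Module.End ℂ V) := by
  ext T
  constructor
  · rintro ⟨_, ⟨A, hA, B, hB, rfl⟩, rfl⟩
    refine ⟨_, ⟨_, ⟨A, hA, rfl⟩, _, ⟨B, hB, rfl⟩, rfl⟩, ?_⟩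
    exact congrArg φ.conj (congr_conj_rTensor_add_lTensor e₁ e₂ A B).symm
  · rintro ⟨_, ⟨_, ⟨A, hA, rfl⟩, _, ⟨B, hB, rfl⟩, rfl⟩, rfl⟩
    refine ⟨_, ⟨A, hA, B, hB, rfl⟩, ?_⟩
    exact congrArg φ.conj (congr_conj_rTensor_add_lTensor e₁ e₂ A B)

end TensorSum

/-! ### The cyclic identity forces the full skew algebra -/

section FullSkew

variable {V₁ V₂ : Type*} [AddCommGroup V₁] [Module ℂ V₁] [FiniteDimensional ℂ V₁]
  [AddCommGroup V₂] [Module ℂ V₂] [FiniteDimensional ℂ V₂]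

/-- An irreducible Lie algebra `L` of `a`-skew endomorphisms that contains the values of a nonzero
`V₁`-component of a weak curvature map consists of all `a`-skew endomorphisms. -/
theorem mem_iff_skew_of_cyclic_identity {a : LinearMap.BilinForm ℂ V₁}
    {b : LinearMap.BilinForm ℂ V₂}
    (ha : a.Nondegenerate) (hb : b.Nondegenerate) {ε : ℂ} (hε : ε * ε = 1)
    (haε : ∀ x y, a x y = ε * a y x) (hbε : ∀ x y, b x y = ε * b y x)
    (h₁ : 3 ≤ Module.finrank ℂ V₁) (h₂ : 3 ≤ Module.finrank ℂ V₂)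
    {L : LieSubalgebra ℂ (Module.End ℂ V₁)}
    (hirr : ∀ N : Submodule ℂ V₁, (∀ A ∈ L, ∀ v ∈ N, A v ∈ N) → N = ⊥ ∨ N = ⊤)
    (hL : ∀ A ∈ L, ∀ x y, a (A x) y = -a x (A y))
    {Q₁ : V₁ →ₗ[ℂ] V₂ →ₗ[ℂ] Module.End ℂ V₁} {Q₂ : V₁ →ₗ[ℂ] V₂ →ₗ[ℂ] Module.End ℂ V₂}
    (hQL : ∀ x x', Q₁ x x' ∈ L) (hQ0 : Q₁ ≠ 0)
    (hQ : ∀ x x' y y' z z',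
      (a (Q₁ x x' y) z * b y' z' + a y z * b (Q₂ x x' y') z') +
      (a (Q₁ y y' z) x * b z' x' + a z x * b (Q₂ y y' z') x') +
      (a (Q₁ z z' x) y * b x' y' + a x y * b (Q₂ z z' x') y') = 0) (A : Module.End ℂ V₁) :
    A ∈ L ↔ ∀ x y, a (A x) y = -a x (A y) := by
  refine ⟨hL A, fun hA => ?_⟩
  obtain ⟨x', hx'⟩ : ∃ x', ∃ x, Q₁ x x' ≠ 0 := by
    by_contra! h
    exact hQ0 (LinearMap.ext₂ fun x x' => h x' x)
  obtain ⟨s, hs⟩ := exists_eq_twistedWedge ha hb hε haε hbε h₁ h₂ Q₁ Q₂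
    (fun x x' y z => hL _ (hQL x x') y z) hQ x'
  refine mem_of_twistedWedge_mem ha haε hε hirr hL (s := s) (fun h0 => ?_)
    (fun x => hs x ▸ hQL x x') hA
  obtain ⟨x, hx⟩ := hx'
  refine hx ((hs x).trans (LinearMap.ext fun y => ?_))
  simp [twistedWedge_apply, h0]

end FullSkew

/-! ### The decomposition into two ideals -/

section Decomposition

variable {V : Type*} [AddCommGroup V] [Module ℂ V] {g : LieSubalgebra ℂ (Module.End ℂ V)}
  {g₁ g₂ : LieIdeal ℂ g}
  {V₁ : Type*} [AddCommGroup V₁] [Module ℂ V₁] [LieRingModule g₁ V₁] [LieModule ℂ g₁ V₁]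
  {V₂ : Type*} [AddCommGroup V₂] [Module ℂ V₂] [LieRingModule g₂ V₂] [LieModule ℂ g₂ V₂]
  {φ : (V₁ ⊗[ℂ] V₂) ≃ₗ[ℂ] V}

theorem eq_map_tensorSum_range (hg : IsCompl g₁ g₂)
    (hφ : ∀ (X₁ : g₁) (X₂ : g₂) (v₁ : V₁) (v₂ : V₂),
      (((X₁ : g) + (X₂ : g) : g) : Module.End ℂ V) (φ (v₁ ⊗ₜ[ℂ] v₂)) =
        φ (⁅X₁, v₁⁆ ⊗ₜ[ℂ] v₂ + v₁ ⊗ₜ[ℂ] ⁅X₂, v₂⁆)) :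
    g = (tensorSum (LieModule.toEnd ℂ g₁ V₁).range (LieModule.toEnd ℂ g₂ V₂).range).map
      (φ.lieConj : Module.End ℂ (V₁ ⊗[ℂ] V₂) →ₗ⁅ℂ⁆ Module.End ℂ V) := by
  have key : ∀ (X₁ : g₁) (X₂ : g₂),
      (((X₁ : g) + (X₂ : g) : g) : Module.End ℂ V) = φ.conj
        (LinearMap.rTensor V₂ (LieModule.toEnd ℂ g₁ V₁ X₁) +
          LinearMap.lTensor V₁ (LieModule.toEnd ℂ g₂ V₂ X₂)) := fun X₁ X₂ => by
    refine LinearMap.ext fun v => ?_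
    obtain ⟨t, rfl⟩ := φ.surjective v
    rw [LinearEquiv.conj_apply_apply, φ.symm_apply_apply]
    induction t with
    | zero => simp
    | tmul x y => rw [hφ]; simp
    | add s t hs ht => rw [map_add, map_add, hs, ht, map_add, map_add]
  ext T
  constructor
  · intro hT
    have hmem : (⟨T, hT⟩ : g) ∈ g₁ ⊔ g₂ := hg.sup_eq_top ▸ LieSubmodule.mem_top _
    obtain ⟨X₁, h₁, X₂, h₂, hX⟩ := (LieSubmodule.mem_sup _ _ _).mp hmem
    refine ⟨_, ⟨_, ⟨⟨X₁, h₁⟩, rfl⟩, _, ⟨⟨X₂, h₂⟩, rfl⟩, rfl⟩, ?_⟩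
    exact (key ⟨X₁, h₁⟩ ⟨X₂, h₂⟩).symm.trans (congrArg Subtype.val hX)
  · rintro ⟨_, ⟨_, ⟨X₁, rfl⟩, _, ⟨X₂, rfl⟩, rfl⟩, rfl⟩
    exact (congrArg (· ∈ g) (key X₁ X₂)).mp ((X₁ : g) + (X₂ : g) : g).2

end Decomposition

theorem finrank_le_one_of_forall_submodule {M : Type*} [AddCommGroup M] [Module ℂ M]
    (hM : ∀ N : Submodule ℂ M, N = ⊥ ∨ N = ⊤) : Module.finrank ℂ M ≤ 1 := by
  by_cases h : ∃ v : M, v ≠ 0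
  · obtain ⟨v, hv⟩ := h
    have htop := (hM (Submodule.span ℂ {v})).resolve_left fun h => hv (by simpa using h)
    rw [← finrank_top ℂ M, ← htop]
    simpa using finrank_span_le_card (R := ℂ) ({v} : Set M)
  · push Not at h
    have : Subsingleton M := ⟨fun x y => by rw [h x, h y]⟩
    rw [Module.finrank_zero_of_subsingleton]
    exact zero_le_one

/-- A linear map on a weak-Berger algebra which kills all weak curvature maps is zero. -/
theorem IsWeakBerger.eq_zero_of_forall_comp_eq_zero {V M : Type*} [AddCommGroup V] [Module ℂ V]
    [AddCommGroup M] [Module ℂ M] {h : LinearMap.BilinForm ℂ V}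
    {g : LieSubalgebra ℂ (Module.End ℂ V)} (hwb : IsWeakBerger h g) (ρ : g →ₗ[ℂ] M)
    (hρ : ∀ Q ∈ weakCurvatureSpace h g, ρ ∘ₗ Q = 0) : ρ = 0 := by
  refine LinearMap.ker_eq_top.mp (top_le_iff.mp (hwb.2 ▸ Submodule.span_le.mpr ?_))
  rintro _ ⟨Q, hQ, x, rfl⟩
  exact LinearMap.congr_fun (hρ Q hQ) x

section Forms

variable {V : Type*} [AddCommGroup V] [Module ℂ V] [FiniteDimensional ℂ V]
  {h : LinearMap.BilinForm ℂ V} {g : LieSubalgebra ℂ (Module.End ℂ V)}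
  {g₁ g₂ : LieIdeal ℂ g}
  {V₁ : Type*} [AddCommGroup V₁] [Module ℂ V₁] [LieRingModule g₁ V₁] [LieModule ℂ g₁ V₁]
  {V₂ : Type*} [AddCommGroup V₂] [Module ℂ V₂] [LieRingModule g₂ V₂] [LieModule ℂ g₂ V₂]
  {φ : (V₁ ⊗[ℂ] V₂) ≃ₗ[ℂ] V}

/-- The Lie algebras by which the two ideals act are the full algebras of skew endomorphisms of two
forms, both symmetric or both alternating. -/
theorem exists_forms (hsymm : h.IsSymm) (hnondeg : h.Nondegenerate)
    (hwb : IsWeakBerger h g) (hg : IsCompl g₁ g₂)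
    (hirr₁ : LieModule.IsIrreducible ℂ g₁ V₁) (hirr₂ : LieModule.IsIrreducible ℂ g₂ V₂)
    (hφ : ∀ (X₁ : g₁) (X₂ : g₂) (v₁ : V₁) (v₂ : V₂),
      (((X₁ : g) + (X₂ : g) : g) : Module.End ℂ V) (φ (v₁ ⊗ₜ[ℂ] v₂)) =
        φ (⁅X₁, v₁⁆ ⊗ₜ[ℂ] v₂ + v₁ ⊗ₜ[ℂ] ⁅X₂, v₂⁆))
    (hV₁ : 3 ≤ Module.finrank ℂ V₁) (hV₂ : 3 ≤ Module.finrank ℂ V₂) :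
    ∃ (a : LinearMap.BilinForm ℂ V₁) (b : LinearMap.BilinForm ℂ V₂) (ε : ℂ), ε * ε = 1 ∧
      a.Nondegenerate ∧ b.Nondegenerate ∧ (∀ x y, a x y = ε * a y x) ∧
      (∀ x y, b x y = ε * b y x) ∧
      (∀ A, A ∈ (LieModule.toEnd ℂ g₁ V₁).range ↔ ∀ x y, a (A x) y = -a x (A y)) ∧
      (∀ A, A ∈ (LieModule.toEnd ℂ g₂ V₂).range ↔ ∀ x y, b (A x) y = -b x (A y)) := by
  have : FiniteDimensional ℂ V₁ := Module.finite_of_finrank_pos (by omega)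
  have : FiniteDimensional ℂ V₂ := Module.finite_of_finrank_pos (by omega)
  have : Nontrivial V₁ := Module.nontrivial_of_finrank_pos (R := ℂ) (by omega)
  have : Nontrivial V₂ := Module.nontrivial_of_finrank_pos (R := ℂ) (by omega)
  have hs₁ := hirr₁.eq_bot_or_eq_top_of_forall_mem
  have hs₂ := hirr₂.eq_bot_or_eq_top_of_forall_mem
  let H : LinearMap.BilinForm ℂ (V₁ ⊗[ℂ] V₂) :=
    h.compl₁₂ (φ : (V₁ ⊗[ℂ] V₂) →ₗ[ℂ] V) (φ : (V₁ ⊗[ℂ] V₂) →ₗ[ℂ] V)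
  have hHφ : ∀ s t, H s t = h (φ s) (φ t) := fun _ _ => rfl
  have hH0 : H ≠ 0 := fun h0 => by
    have : Nontrivial (V₁ ⊗[ℂ] V₂) := Module.nontrivial_of_finrank_pos (R := ℂ) (by
      rw [Module.finrank_tensorProduct]
      exact Nat.mul_pos (by omega) (by omega))
    obtain ⟨t, ht⟩ := exists_ne (0 : V₁ ⊗[ℂ] V₂)
    refine ht (φ.map_eq_zero_iff.mp (hnondeg.1 _ fun v => ?_))
    obtain ⟨s, rfl⟩ := φ.surjective v
    rw [← hHφ, h0]
    rfl
  have hskew : ∀ X : g, ∀ v w, h ((X : Module.End ℂ V) v) w = -h v ((X : Module.End ℂ V) w) :=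
    fun X v w => by
      have := hwb.1 X.2
      have h3 := this v w
      simpa using h3
  have hinv₁ : ∀ A ∈ (LieModule.toEnd ℂ g₁ V₁).range, ∀ x x' y y',
      H (A x ⊗ₜ x') (y ⊗ₜ y') = -H (x ⊗ₜ x') (A y ⊗ₜ y') := by
    rintro _ ⟨X, rfl⟩ x x' y y'
    have h1 : ∀ v v', (((X : g) : Module.End ℂ V)) (φ (v ⊗ₜ v')) = φ (⁅X, v⁆ ⊗ₜ v') :=
      fun v v' => by simpa using hφ X 0 v v'
    have := hskew X (φ (x ⊗ₜ x')) (φ (y ⊗ₜ y'))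
    rwa [h1, h1] at this
  have hinv₂ : ∀ A ∈ (LieModule.toEnd ℂ g₂ V₂).range, ∀ x x' y y',
      H (x ⊗ₜ A x') (y ⊗ₜ y') = -H (x ⊗ₜ x') (y ⊗ₜ A y') := by
    rintro _ ⟨X, rfl⟩ x x' y y'
    have h1 : ∀ v v', (((X : g) : Module.End ℂ V)) (φ (v ⊗ₜ v')) = φ (v ⊗ₜ ⁅X, v'⁆) :=
      fun v v' => by simpa using hφ 0 X v v'
    have := hskew X (φ (x ⊗ₜ x')) (φ (y ⊗ₜ y'))
    rwa [h1, h1] at this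
  obtain ⟨a, b, ε, hε, ha, hb, haε, hbε, hai, hbi, hab⟩ :=
    exists_factorization hH0 (fun s t => hsymm.eq _ _) hs₁ hs₂ hinv₁ hinv₂
  -- the components in `𝔤₁` and `𝔤₂` of the values of an element of `𝓑_h(𝔤)`
  have hcompl : IsCompl g₁.toSubmodule g₂.toSubmodule := LieSubmodule.isCompl_toSubmodule.mpr hg
  let π₁ : g →ₗ[ℂ] g₁ := Submodule.projectionOnto _ _ hcompl
  let π₂ : g →ₗ[ℂ] g₂ := Submodule.projectionOnto _ _ hcompl.symm
  have hπ : ∀ X, (π₁ X : g) + (π₂ X : g) = X := fun X =>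
    Submodule.projection_add_projection_eq_self hcompl X
  let ρ₁ : g →ₗ[ℂ] Module.End ℂ V₁ := (LieModule.toEnd ℂ g₁ V₁ : g₁ →ₗ[ℂ] _) ∘ₗ π₁
  let ρ₂ : g →ₗ[ℂ] Module.End ℂ V₂ := (LieModule.toEnd ℂ g₂ V₂ : g₂ →ₗ[ℂ] _) ∘ₗ π₂
  have hρ : ∀ (X : g) (v v'), (X : Module.End ℂ V) (φ (v ⊗ₜ v')) =
      φ (ρ₁ X v ⊗ₜ v' + v ⊗ₜ ρ₂ X v') := fun X v v' => by
    have := hφ (π₁ X) (π₂ X) v v'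
    rwa [hπ] at this
  let q₁ : (V →ₗ[ℂ] g) → V₁ →ₗ[ℂ] V₂ →ₗ[ℂ] Module.End ℂ V₁ := fun Q =>
    (TensorProduct.mk ℂ V₁ V₂).compr₂ (ρ₁ ∘ₗ Q ∘ₗ (φ : (V₁ ⊗[ℂ] V₂) →ₗ[ℂ] V))
  let q₂ : (V →ₗ[ℂ] g) → V₁ →ₗ[ℂ] V₂ →ₗ[ℂ] Module.End ℂ V₂ := fun Q =>
    (TensorProduct.mk ℂ V₁ V₂).compr₂ (ρ₂ ∘ₗ Q ∘ₗ (φ : (V₁ ⊗[ℂ] V₂) →ₗ[ℂ] V))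
  have hcyc : ∀ Q ∈ weakCurvatureSpace h g, ∀ x x' y y' z z',
      (a (q₁ Q x x' y) z * b y' z' + a y z * b (q₂ Q x x' y') z') +
      (a (q₁ Q y y' z) x * b z' x' + a z x * b (q₂ Q y y' z') x') +
      (a (q₁ Q z z' x) y * b x' y' + a x y * b (q₂ Q z z' x') y') = 0 :=
    fun Q hQ x x' y y' z z' => by
      have h1 := hQ (φ (x ⊗ₜ x')) (φ (y ⊗ₜ y')) (φ (z ⊗ₜ z'))
      have h2 : ∀ (X : g) u u' v v', h ((X : Module.End ℂ V) (φ (u ⊗ₜ u'))) (φ (v ⊗ₜ v')) =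
          a (ρ₁ X u) v * b u' v' + a u v * b (ρ₂ X u') v' := fun X u u' v v' => by
        rw [hρ, ← hHφ, map_add, LinearMap.add_apply, hab, hab]
      rw [h2, h2, h2] at h1
      exact h1
  -- otherwise `𝔤₁` would act by zero, and `V₁` would not be irreducible of dimension at least 3
  have hsurj₁ : ∃ Q ∈ weakCurvatureSpace h g, q₁ Q ≠ 0 := by
    by_contra! h0
    have hρ0 : ρ₁ = 0 := hwb.eq_zero_of_forall_comp_eq_zero ρ₁ fun Q hQ => LinearMap.ext fun v => by
      obtain ⟨t, rfl⟩ := φ.surjective v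
      induction t with
      | zero => simp
      | tmul x y => exact LinearMap.congr_fun₂ (h0 Q hQ) x y
      | add s t hs ht => rw [map_add, map_add, hs, ht]; simp
    have := finrank_le_one_of_forall_submodule fun N => hs₁ N (by
      rintro _ ⟨X, rfl⟩ v _
      have h1 : ρ₁ X v = 0 := LinearMap.congr_fun (LinearMap.congr_fun hρ0 X) v
      have h2 : π₁ X = X := Submodule.projectionOnto_apply_left hcompl X
      change LieModule.toEnd ℂ g₁ V₁ (π₁ X) v = 0 at h1
      rw [h2] at h1
      exact (congrArg (· ∈ N) h1).mpr N.zero_mem)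
    omega
  have hsurj₂ : ∃ Q ∈ weakCurvatureSpace h g, q₂ Q ≠ 0 := by
    by_contra! h0
    have hρ0 : ρ₂ = 0 := hwb.eq_zero_of_forall_comp_eq_zero ρ₂ fun Q hQ => LinearMap.ext fun v => by
      obtain ⟨t, rfl⟩ := φ.surjective v
      induction t with
      | zero => simp
      | tmul x y => exact LinearMap.congr_fun₂ (h0 Q hQ) x y
      | add s t hs ht => rw [map_add, map_add, hs, ht]; simp
    have := finrank_le_one_of_forall_submodule fun N => hs₂ N (by
      rintro _ ⟨X, rfl⟩ v _
      have h1 : ρ₂ X v = 0 := LinearMap.congr_fun (LinearMap.congr_fun hρ0 X) v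
      have h2 : π₂ X = X := Submodule.projectionOnto_apply_left hcompl.symm X
      change LieModule.toEnd ℂ g₂ V₂ (π₂ X) v = 0 at h1
      rw [h2] at h1
      exact (congrArg (· ∈ N) h1).mpr N.zero_mem)
    omega
  refine ⟨a, b, ε, hε, ha, hb, haε, hbε, ?_, ?_⟩
  · obtain ⟨Q, hQ, hQ0⟩ := hsurj₁
    exact mem_iff_skew_of_cyclic_identity ha hb hε haε hbε hV₁ hV₂ hs₁ hai
      (fun x x' => ⟨_, rfl⟩) hQ0 (hcyc Q hQ)
  · obtain ⟨Q, hQ, hQ0⟩ := hsurj₂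
    refine mem_iff_skew_of_cyclic_identity hb ha hε hbε haε hV₂ hV₁ hs₂ hbi
      (Q₁ := (q₂ Q).flip) (Q₂ := (q₁ Q).flip) (fun x x' => ⟨_, rfl⟩)
      (fun h0 => hQ0 (LinearMap.ext₂ fun x y => LinearMap.congr_fun₂ h0 y x))
      fun x x' y y' z z' => ?_
    have := hcyc Q hQ x' x y' y z' z
    simp only [LinearMap.flip_apply]
    linear_combination this

end Forms

/-! ### The classification -/

theorem corollary2p7
    {V : Type*} [AddCommGroup V] [Module ℂ V] [FiniteDimensional ℂ V]
    (h : LinearMap.BilinForm ℂ V) (hsymm : h.IsSymm) (hnondeg : h.Nondegenerate)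
    (g : LieSubalgebra ℂ (Module.End ℂ V))
    (hss : LieAlgebra.IsSemisimple ℂ g) (hns : ¬ LieAlgebra.IsSimple ℂ g)
    (hirr : LieModule.IsIrreducible ℂ g V)
    (hwb : IsWeakBerger h g)
    -- a decomposition of `g` into two complementary ideals
    (g₁ g₂ : LieIdeal ℂ g) (hg : IsCompl g₁ g₂)
    -- the corresponding decomposition of `V`
    {V₁ : Type*} [AddCommGroup V₁] [Module ℂ V₁] [LieRingModule g₁ V₁] [LieModule ℂ g₁ V₁]
    {V₂ : Type*} [AddCommGroup V₂] [Module ℂ V₂] [LieRingModule g₂ V₂] [LieModule ℂ g₂ V₂]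
    (hirr₁ : LieModule.IsIrreducible ℂ g₁ V₁) (hirr₂ : LieModule.IsIrreducible ℂ g₂ V₂)
    (φ : (V₁ ⊗[ℂ] V₂) ≃ₗ[ℂ] V)
    (hφ : ∀ (X₁ : g₁) (X₂ : g₂) (v₁ : V₁) (v₂ : V₂),
      (((X₁ : g) + (X₂ : g) : g) : Module.End ℂ V) (φ (v₁ ⊗ₜ[ℂ] v₂)) =
        φ (⁅X₁, v₁⁆ ⊗ₜ[ℂ] v₂ + v₁ ⊗ₜ[ℂ] ⁅X₂, v₂⁆))
    (hV₁ : 3 ≤ Module.finrank ℂ V₁) (hV₂ : 3 ≤ Module.finrank ℂ V₂) :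
    (∃ n m : ℕ, 3 ≤ n ∧ 3 ≤ m ∧
      (∃ (e₁ : (Fin n → ℂ) ≃ₗ[ℂ] V₁) (e₂ : (Fin m → ℂ) ≃ₗ[ℂ] V₂),
        (LieModule.toEnd ℂ g₁ V₁).range =
          (soStd n).map (e₁.lieConj : Module.End ℂ (Fin n → ℂ) →ₗ⁅ℂ⁆ Module.End ℂ V₁) ∧
        (LieModule.toEnd ℂ g₂ V₂).range =
          (soStd m).map (e₂.lieConj : Module.End ℂ (Fin m → ℂ) →ₗ⁅ℂ⁆ Module.End ℂ V₂) ∧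
        g = (tensorSum (soStd n) (soStd m)).map
          (((TensorProduct.congr e₁ e₂).trans φ).lieConj :
            Module.End ℂ ((Fin n → ℂ) ⊗[ℂ] (Fin m → ℂ)) →ₗ⁅ℂ⁆ Module.End ℂ V)) ∧
      IsComplexificationOf g (holonomyBDI n m)) ∨
    (∃ n m : ℕ, 2 ≤ n ∧ 2 ≤ m ∧
      (∃ (e₁ : (Fin n ⊕ Fin n → ℂ) ≃ₗ[ℂ] V₁) (e₂ : (Fin m ⊕ Fin m → ℂ) ≃ₗ[ℂ] V₂),
        (LieModule.toEnd ℂ g₁ V₁).range =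
          (spStd n).map (e₁.lieConj : Module.End ℂ (Fin n ⊕ Fin n → ℂ) →ₗ⁅ℂ⁆ Module.End ℂ V₁) ∧
        (LieModule.toEnd ℂ g₂ V₂).range =
          (spStd m).map (e₂.lieConj : Module.End ℂ (Fin m ⊕ Fin m → ℂ) →ₗ⁅ℂ⁆ Module.End ℂ V₂) ∧
        g = (tensorSum (spStd n) (spStd m)).map
          (((TensorProduct.congr e₁ e₂).trans φ).lieConj :
            Module.End ℂ ((Fin n ⊕ Fin n → ℂ) ⊗[ℂ] (Fin m ⊕ Fin m → ℂ)) →ₗ⁅ℂ⁆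
              Module.End ℂ V)) ∧
      IsComplexificationOf g (holonomyCII n m)) := by
  obtain ⟨a, b, ε, hε, ha, hb, haε, hbε, hL₁, hL₂⟩ :=
    exists_forms hsymm hnondeg hwb hg hirr₁ hirr₂ hφ hV₁ hV₂
  have : FiniteDimensional ℂ V₁ := Module.finite_of_finrank_pos (by omega)
  have : FiniteDimensional ℂ V₂ := Module.finite_of_finrank_pos (by omega)
  have hgφ := eq_map_tensorSum_range hg hφ
  rcases mul_self_eq_one_iff.mp hε with rfl | rfl
  · obtain ⟨e₁, he₁⟩ := exists_equiv_dotProduct ha (by simpa using haε)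
    obtain ⟨e₂, he₂⟩ := exists_equiv_dotProduct hb (by simpa using hbε)
    have hr₁ : (LieModule.toEnd ℂ g₁ V₁).range = (soStd (Module.finrank ℂ V₁)).map
        (e₁.lieConj : Module.End ℂ _ →ₗ⁅ℂ⁆ Module.End ℂ V₁) := eq_map_skewAdjointMatrices he₁ hL₁
    have hr₂ : (LieModule.toEnd ℂ g₂ V₂).range = (soStd (Module.finrank ℂ V₂)).map
        (e₂.lieConj : Module.End ℂ _ →ₗ⁅ℂ⁆ Module.End ℂ V₂) := eq_map_skewAdjointMatrices he₂ hL₂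
    rw [hr₁, hr₂, ← map_tensorSum_trans] at hgφ
    exact .inl ⟨_, _, hV₁, hV₂, ⟨e₁, e₂, hr₁, hr₂, hgφ⟩,
      isComplexificationOf_holonomyBDI (by omega) (by omega) hirr _ hgφ⟩
  · obtain ⟨n, e₁, he₁⟩ := exists_equiv_J ha (by simpa using haε)
    obtain ⟨m, e₂, he₂⟩ := exists_equiv_J hb (by simpa using hbε)
    have hr₁ : (LieModule.toEnd ℂ g₁ V₁).range = (spStd n).map
        (e₁.lieConj : Module.End ℂ _ →ₗ⁅ℂ⁆ Module.End ℂ V₁) := eq_map_skewAdjointMatrices he₁ hL₁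
    have hr₂ : (LieModule.toEnd ℂ g₂ V₂).range = (spStd m).map
        (e₂.lieConj : Module.End ℂ _ →ₗ⁅ℂ⁆ Module.End ℂ V₂) := eq_map_skewAdjointMatrices he₂ hL₂
    rw [hr₁, hr₂, ← map_tensorSum_trans] at hgφ
    have hn : Module.finrank ℂ V₁ = n + n := by rw [← e₁.finrank_eq]; simp
    have hm : Module.finrank ℂ V₂ = m + m := by rw [← e₂.finrank_eq]; simp
    exact .inr ⟨n, m, by omega, by omega, ⟨e₁, e₂, hr₁, hr₂, hgφ⟩,
      isComplexificationOf_holonomyCII (by omega) (by omega) hirr _ hgφ⟩
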